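/- **Setting.** Let $\mathcal H$ be a separable real reproducing kernel Hilbert space of functions on a measurable space $\mathcal X$, with kernel $K$ such that every $K(\cdot,x)$ is measurable and $K(x,y)\le\kappa^2$ for all $x,y$ $(\kappa\ge 0)$; put $\phi(x)=K(\cdot,x)$ and $(g\otimes f)h=\langle f,h\rangle_{\mathcal H}\,g$. Let $\mu_1,\dots,\mu_N$ be probability measures on $\mathcal X\times\mathbb R$ with $\mathbb E_{\mu_i}|Y|<\infty$ whose regression functions $\mathbb E_{\mu_i}[Y\mid X]$ are given by $f_i\in\mathcal H$, and let $\Sigma_i=\mathbb E_{\mu_i}[\phi(X)\otimes\phi(X)]$. The source condition with $r\in[0,1]$ and $R$ says $\|\Sigma_i^{-r}f_i\|_{\mathcal H}\le R$ for all $i$, i.e. $f_i=\Sigma_i^{r}h_i$ for some $h_i\in\mathcal H$ with $\|h_i\|_{\mathcal H}\le R$. For a sample $(x_j,y_j)_{j\le m}$, $\lambda>0$ and a complete subspace $W\subseteq\mathcal H$, the ridge estimator over $W$ is the minimizer over $f\in W$ of $\sum_{j=1}^m(y_j-f(x_j))^2+m\lambda\|f\|_{\mathcal H}^2$. For each $i$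 there are $2n$ independent observations of $\mu_i$, independent over $i$; $\hat f'_{i,\lambda}$ and $\hat f_{i,\lambda}$ are the ridge estimators over $\mathcal H$ from the first and the last $n$ of them. Put $$C_N=\frac1N\sum_{i=1}^N f_i\otimes f_i,\qquad \bar C_{N,n,\lambda}=\frac1N\sum_{i=1}^N\mathbb E[\hat f_{i,\lambda}]\otimes\mathbb E[\hat f_{i,\lambda}],\qquad \hat C_{N,n,\lambda}=\frac1N\sum_{i=1}^N\hat f'_{i,\lambda}\otimes\hat f_{i,\lambda}.$$ **(1) Bias bound.** There is $J_1$ depending only on $\kappa$ and $R$ such that, under the source condition with $r\in[0,1]$, for all $\lambda\in(0,1]$, $n\ge1$ and all $N$, the estimators $\hat f_{i,\lambda}$ are integrable and $$\|\bar C_{N,n,\lambda}-C_N\|_{HS}\le J_1\,\lambda^{r}\Bigl(1+\frac1{\lambda\sqrt n}\Bigr).$$ **(2) Excess risk when $N\gtrsim\exp(n)$.** Let moreover $\mu_T$ be a target probability measure on $\mathcal X\times\mathbb R$ with regression function $f_T\in\mathcal H$, let $\mathcal H_s=\operatorname{span}\{f_1,\dots,f_N\}$ have dimension $s\ge1$ and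 contain $f_T$, let $|Y|\le Y_\infty$ almost surely under every $\mu_i$ and under $\mu_T$, let $\gamma>0$ be a lower bound for the nonzero eigenvalues of $C_N$, and let $\|f_T\|_{\mathcal H}\le F$. For $\lambda=n^{-1/2}$ let $\hat{\mathcal H}_s$ be the span of $s$ orthonormal right singular vectors of $\hat C_{N,n,\lambda}$ for its $s$ largest singular values, and let $\hat f_{T,\lambda_*}$ be the ridge estimator over $\hat{\mathcal H}_s$ with parameter $\lambda_*=12\kappa^2(\log s\vee\tau)\,n_T^{-1}$ from $n_T$ independent observations of $\mu_T$, independent of the source data. Let $\mathcal E_{\mu_T}(f)=\bigl(\mathbb E_{\mu_T}(Y-f(X))^2-\mathbb E_{\mu_T}(Y-f_T(X))^2\bigr)^{1/2}$. For every $a>0$ there is a constant $C$ depending only on $\kappa,R,Y_\infty,\gamma,F$ and $a$ such that, whenever the source condition holds with $r\in[0,1]$, $n\ge1$, $N\ge a\,e^{n}$, $\tau\ge 2.6$ and $n_T\ge12\kappa^2(\log s\vee\tau)$, the following holds with probability at least $1-2e^{-\tau}$ over the source data: for every choice of the top $s$ right singular vectors, conditionally on the source data, with probability at least $1-3e^{-\tau}$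 over the target sample, $$\mathcal E_{\mu_T}(\hat f_{T,\lambda_*})\le C\,\tau\left(\sqrt{\frac{s}{n_T}}+n^{-r/2}\right).$$ -/

import Mathlib

open MeasureTheory ProbabilityTheory InnerProductSpace
open scoped ENNReal

noncomputable section

namespace MetaKRR

/-! ### Operators on a real Hilbert space -/

section Operators

variable {H : Type*} [NormedAddCommGroup H] [InnerProductSpace ℝ H] [CompleteSpace H]

/-- Hilbert-Schmidt norm `(∑ ‖A e‖²)^(1/2)` over an orthonormal basis, with value `∞` when `A` is
not Hilbert-Schmidt. It does not depend on the basis, see `hsNorm_eq`. -/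
def hsNorm (A : H →L[ℝ] H) : ℝ≥0∞ :=
  (∑' e : (exists_hilbertBasis ℝ H).choose, ‖A (e : H)‖ₑ ^ 2) ^ (1 / 2 : ℝ)

theorem enorm_sq_eq_tsum {ι H : Type*} [NormedAddCommGroup H] [InnerProductSpace ℝ H]
    (b : HilbertBasis ι ℝ H) (x : H) :
    ‖x‖ₑ ^ 2 = ∑' i, ‖inner ℝ (b i) x‖ₑ ^ 2 := by
  have h1 := b.hasSum_inner_mul_inner x x
  have h2 : HasSum (fun i => ‖inner ℝ (b i) x‖ ^ 2) (‖x‖ ^ 2) := by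
    rw [← real_inner_self_eq_norm_sq]
    refine h1.congr_fun ?_ |> fun h => h
    intro i
    rw [Real.norm_eq_abs, sq_abs, real_inner_comm x (b i)]
    ring
  have h3 := ENNReal.ofReal_tsum_of_nonneg (fun i => sq_nonneg ‖inner ℝ (b i) x‖) h2.summable
  rw [h2.tsum_eq] at h3
  simp_rw [ENNReal.ofReal_pow (norm_nonneg _), ofReal_norm] at h3
  exact h3

theorem tsum_enorm_sq_adjoint {ι ι' : Type*} (b : HilbertBasis ι ℝ H) (b' : HilbertBasis ι' ℝ H)
    (A : H →L[ℝ] H) : ∑' i, ‖A (b i)‖ₑ ^ 2 = ∑' j, ‖A.adjoint (b' j)‖ₑ ^ 2 := by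
  simp_rw [enorm_sq_eq_tsum b' (A _), enorm_sq_eq_tsum b (A.adjoint _)]
  rw [ENNReal.tsum_comm]
  refine tsum_congr fun j => tsum_congr fun i => ?_
  rw [ContinuousLinearMap.adjoint_inner_right, real_inner_comm]

/-- The Hilbert-Schmidt norm can be computed in any orthonormal basis. -/
theorem hsNorm_eq {ι : Type*} (b : HilbertBasis ι ℝ H) (A : H →L[ℝ] H) :
    hsNorm A = (∑' i, ‖A (b i)‖ₑ ^ 2) ^ (1 / 2 : ℝ) := by
  obtain ⟨b', hb'⟩ := (exists_hilbertBasis ℝ H).choose_spec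
  rw [tsum_enorm_sq_adjoint b b' A, ← tsum_enorm_sq_adjoint b' b' A, hb', hsNorm]

/-- The power `S ^ r` (`r ≥ 0`) of a compact positive self-adjoint operator through its spectral
decomposition: the sum over all eigenvalues `t` of `t ^ r` times the orthogonal projection onto the
eigenspace `ker (S - t)` (a real `t` that is not an eigenvalue contributes `0`). For `r = 0` this is
the identity, since `0 ^ 0 = 1`. -/
def opPow (S : H →L[ℝ] H) (r : ℝ) (h : H) : H :=
  ∑' t : ℝ, t ^ r •
    (S - t • ContinuousLinearMap.id ℝ H).ker.starProjection h

/-- `v 1, …, v s` are right singular vectors of `A` for its `s` largest singular values, counted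
with multiplicity: orthonormal eigenvectors `A* A v j = σ j ² v j` such that on the
orthogonal complement of their span `A` is bounded by every `σ j`. -/
def IsTopRightSingular {s : ℕ} (A : H →L[ℝ] H) (v : Fin s → H) : Prop :=
  Orthonormal ℝ v ∧ ∃ σ : Fin s → ℝ,
    (∀ j, 0 ≤ σ j ∧ A.adjoint (A (v j)) = σ j ^ 2 • v j) ∧
    ∀ w : H, (∀ j, inner ℝ (v j) w = 0) → ∀ j, ‖A w‖ ≤ σ j * ‖w‖

/-- The task operator `(1 / N) ∑ f i ⊗ f i`, where `(g ⊗ f) h = ⟨f, h⟩ g`. -/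
def taskCov {N : ℕ} (f : Fin N → H) : H →L[ℝ] H :=
  (1 / (N : ℝ)) • ∑ i, rankOne ℝ (f i) (f i)

end Operators

/-! ### Kernel ridge regression -/

section Regression

variable {X H : Type*} [NormedAddCommGroup H] [InnerProductSpace ℝ H] [RKHS ℝ H X ℝ]

/-- The objective `∑ (y j - f (x j))² + m l ‖f‖²` of ridge regression with regularization `l` on a
sample of size `m`. -/
def ridgeObjective {m : ℕ} (l : ℝ) (D : Fin m → X × ℝ) (f : H) : ℝ :=
  ∑ j, ((D j).2 - f (D j).1) ^ 2 + m * l * ‖f‖ ^ 2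

/-- `f` minimizes the ridge objective over the subspace `W`. -/
def IsRidge {m : ℕ} (W : Submodule ℝ H) (l : ℝ) (D : Fin m → X × ℝ) (f : H) : Prop :=
  f ∈ W ∧ ∀ g ∈ W, ridgeObjective l D f ≤ ridgeObjective l D g

/-- The ridge regression estimator over the subspace `W`, the minimizer of the ridge objective. -/
def ridge {m : ℕ} (W : Submodule ℝ H) (l : ℝ) (D : Fin m → X × ℝ) : H :=
  Classical.epsilon (IsRidge W l D)

/-- The squared expected risk. -/
def risk [MeasurableSpace X] (μ : Measure (X × ℝ)) (f : H) : ℝ :=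
  ∫ p, (p.2 - f p.1) ^ 2 ∂μ

/-- The excess risk of `f` relative to the regression function `fstar`. -/
def excessRisk [MeasurableSpace X] (μ : Measure (X × ℝ)) (f fstar : H) : ℝ :=
  √(risk μ f - risk μ fstar)

/-- `f` is the regression function `E[Y | X]` of `μ`. -/
def IsRegressionFunction [MeasurableSpace X] (μ : Measure (X × ℝ)) (f : H) : Prop :=
  Integrable Prod.snd μ ∧
    μ[Prod.snd | MeasurableSpace.comap Prod.fst inferInstance] =ᵐ[μ] fun p => f p.1

/-- The expected ridge estimator over the whole space from `n` independent observations of `μ`. -/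
def meanRidge [MeasurableSpace X] (H : Type*) [NormedAddCommGroup H] [InnerProductSpace ℝ H]
    [RKHS ℝ H X ℝ] (n : ℕ) (l : ℝ) (μ : Measure (X × ℝ)) : H :=
  ∫ D, ridge (⊤ : Submodule ℝ H) l D ∂(Measure.pi fun _ : Fin n => μ)

/-- The law of the source data: `2 n` independent observations of each of the `N` tasks. -/
def sourceLaw [MeasurableSpace X] {N : ℕ} (n : ℕ) (μ : Fin N → Measure (X × ℝ)) :
    Measure (Fin N → Fin (n + n) → X × ℝ) :=
  Measure.pi fun i => Measure.pi fun _ => μ i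

variable [CompleteSpace H]

/-- The estimator `(1 / N) ∑ f̂' i ⊗ f̂ i` of the task operator, where `f̂' i` and `f̂ i` are the ridge
estimators from the first and the last `n` observations of task `i`. -/
def empTaskCov (H : Type*) [NormedAddCommGroup H] [InnerProductSpace ℝ H] [RKHS ℝ H X ℝ]
    {N n : ℕ} (l : ℝ) (D : Fin N → Fin (n + n) → X × ℝ) : H →L[ℝ] H :=
  (1 / (N : ℝ)) • ∑ i, rankOne ℝ
    (ridge (⊤ : Submodule ℝ H) l fun j : Fin n => D i (Fin.castAdd n j))
    (ridge (⊤ : Submodule ℝ H) l fun j : Fin n => D i (Fin.natAdd n j))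

/-- The canonical feature map `φ x = K(·, x)`. -/
def featureMap (H : Type*) [NormedAddCommGroup H] [InnerProductSpace ℝ H] [RKHS ℝ H X ℝ]
    [CompleteSpace H] (x : X) : H :=
  RKHS.kerFun H x (1 : ℝ)

theorem inner_featureMap (x : X) (f : H) : inner ℝ (featureMap H x) f = f x := by
  simp [featureMap]

/-- Every feature `K(·, x)` is measurable and the kernel is bounded by `κ²`. -/
structure KernelAssumptions [MeasurableSpace X] (H : Type*) [NormedAddCommGroup H]
    [InnerProductSpace ℝ H] [RKHS ℝ H X ℝ] [CompleteSpace H] (κ : ℝ) : Prop where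
  measurable_feature : ∀ x : X, Measurable fun y : X => featureMap H x y
  kernel_le : ∀ x y : X, featureMap H x y ≤ κ ^ 2

/-- The covariance operator `E[φ(X) ⊗ φ(X)]`. -/
def covariance [MeasurableSpace X] (H : Type*) [NormedAddCommGroup H]
    [InnerProductSpace ℝ H] [RKHS ℝ H X ℝ] [CompleteSpace H] (μ : Measure (X × ℝ)) :
    H →L[ℝ] H :=
  ∫ p, rankOne ℝ (featureMap H p.1) (featureMap H p.1) ∂μ

/-- The source condition `‖Σ^(-r) f‖ ≤ R`: since `Σ^(-r) f` is the preimage of `f` under `Σ^r` of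
least norm, it says that `f = Σ^r h` for some `h` of norm at most `R`. -/
def SourceCondition [MeasurableSpace X] (μ : Measure (X × ℝ)) (r R : ℝ) (f : H) : Prop :=
  ∃ h : H, ‖h‖ ≤ R ∧ opPow (covariance H μ) r h = f

/-- The ridge estimator exists and is unique. -/
theorem existsUnique_isRidge {m : ℕ} (hm : 0 < m) (W : Submodule ℝ H) [CompleteSpace W] {l : ℝ}
    (hl : 0 < l) (D : Fin m → X × ℝ) : ∃! f : H, IsRidge W l D f := by
  have hml : 0 < (m : ℝ) * l := by positivity
  let u : Fin m → W := fun j => W.orthogonalProjectionOnto (featureMap H (D j).1)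
  have hu : ∀ j (g : W), inner ℝ (u j) g = (g : H) (D j).1 := by
    intro j g
    rw [← inner_featureMap, Submodule.coe_inner]
    exact Submodule.inner_orthogonalProjectionOnto_eq_of_mem_right g _
  let B : W →L[ℝ] W →L[ℝ] ℝ :=
    ((m : ℝ) * l) • LinearMap.mkContinuous₂ (innerₗ W) 1
        (fun x y => by simpa using norm_inner_le_norm (𝕜 := ℝ) x y) +
      ∑ j, (innerSL ℝ (u j)).smulRight (innerSL ℝ (u j))
  have hB : ∀ f g : W, B f g =
      (m : ℝ) * l * inner ℝ f g + ∑ j, inner ℝ (u j) f * inner ℝ (u j) g := by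
    intro f g
    simp [B, sum_apply]
  have hco : IsCoercive B := by
    refine ⟨(m : ℝ) * l, hml, fun f => ?_⟩
    rw [hB, real_inner_self_eq_norm_mul_norm]
    have : 0 ≤ ∑ j, inner ℝ (u j) f * inner ℝ (u j) f :=
      Finset.sum_nonneg fun j _ => mul_self_nonneg _
    linarith
  let f : W := hco.continuousLinearEquivOfBilin.symm (∑ j, (D j).2 • u j)
  have hf : ∀ g : W, B f g = ∑ j, (D j).2 * inner ℝ (u j) g := by
    intro g
    rw [← hco.continuousLinearEquivOfBilin_apply f g]
    simp [f, sum_inner, inner_smul_left]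
  have key : ∀ g : W, ridgeObjective l D (g : H) =
      ridgeObjective l D (f : H) + B (g - f) (g - f) := by
    intro g
    obtain ⟨d, rfl⟩ : ∃ d, g = f + d := ⟨g - f, by abel⟩
    have h1 := hf d
    rw [hB] at h1
    rw [add_sub_cancel_left, hB]
    unfold ridgeObjective
    have hn : ‖((f + d : W) : H)‖ ^ 2 = ‖(f : H)‖ ^ 2 + 2 * inner ℝ f d + inner ℝ d d := by
      rw [Submodule.coe_add, norm_add_sq_real, real_inner_self_eq_norm_sq, Submodule.coe_inner]
      rfl
    have hs : ∑ j, ((D j).2 - ((f + d : W) : H) (D j).1) ^ 2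
        = ∑ j, ((D j).2 - (f : H) (D j).1) ^ 2 - 2 * ∑ j, (D j).2 * inner ℝ (u j) d
          + 2 * ∑ j, inner ℝ (u j) f * inner ℝ (u j) d
          + ∑ j, inner ℝ (u j) d * inner ℝ (u j) d := by
      simp only [Finset.mul_sum, ← Finset.sum_sub_distrib, ← Finset.sum_add_distrib]
      refine Finset.sum_congr rfl fun j _ => ?_
      rw [← hu j (f + d), ← hu j f, inner_add_right]
      ring
    rw [hn, hs, ← h1]
    ring
  have hpos : ∀ d : W, (m : ℝ) * l * ‖d‖ ^ 2 ≤ B d d := by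
    intro d
    rw [hB, real_inner_self_eq_norm_sq]
    have : 0 ≤ ∑ j, inner ℝ (u j) d * inner ℝ (u j) d :=
      Finset.sum_nonneg fun j _ => mul_self_nonneg _
    linarith
  refine ⟨f, ⟨f.2, fun g hg => ?_⟩, ?_⟩
  · have h1 := key ⟨g, hg⟩
    have h2 := hpos (⟨g, hg⟩ - f)
    have h3 : 0 ≤ (m : ℝ) * l * ‖(⟨g, hg⟩ : W) - f‖ ^ 2 := by positivity
    simp only at h1
    linarith
  · rintro g ⟨hg, hmin⟩
    have h1 := key ⟨g, hg⟩
    have h2 := hpos (⟨g, hg⟩ - f)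
    have h4 := hmin f f.2
    simp only at h1
    have h5 : (m : ℝ) * l * ‖(⟨g, hg⟩ : W) - f‖ ^ 2 ≤ 0 := by linarith
    have h6 : ‖(⟨g, hg⟩ : W) - f‖ ^ 2 ≤ 0 := by
      by_contra h
      push Not at h
      have := mul_pos hml h
      linarith
    have h7 : (⟨g, hg⟩ : W) - f = 0 := by
      have h8 : ‖(⟨g, hg⟩ : W) - f‖ = 0 := by nlinarith [norm_nonneg ((⟨g, hg⟩ : W) - f)]
      exact norm_eq_zero.mp h8
    exact congrArg Subtype.val (sub_eq_zero.mp h7)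

theorem isRidge_ridge {m : ℕ} (hm : 0 < m) (W : Submodule ℝ H) [CompleteSpace W] {l : ℝ}
    (hl : 0 < l) (D : Fin m → X × ℝ) : IsRidge W l D (ridge W l D) :=
  Classical.epsilon_spec (existsUnique_isRidge hm W hl D).exists

end Regression

end MetaKRR

end

open MeasureTheory ProbabilityTheory InnerProductSpace
open scoped ENNReal

noncomputable section

namespace MetaKRR

/-! ### Hilbert-Schmidt norm -/

section HilbertSchmidt

variable {H : Type*} [NormedAddCommGroup H] [InnerProductSpace ℝ H] [CompleteSpace H]

/-! Bias. Write `S` for the empirical covariance, `Σ` for the true one, and `l` for the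
regularization. The residual is centred given the inputs, so the label noise averages out exactly
and the mean estimator is `E[(S + l)⁻¹ S f]` (`meanRidge_eq`). With `g = (Σ + l)⁻¹ f` one has `Σ g -
(S + l)⁻¹ S f = l (S + l)⁻¹ (Σ - S) g`. Its mean has norm at most `κ² ‖g‖ / √n`, while the source
condition gives `‖g‖ ≤ l ^ (r - 1) R`; this yields `norm_meanRidge_sub_le`, and rank one algebra
passes to the task operators. Source data. The two halves of each sample are independent, so
`empTaskCov` is an average of `N` independent operators and is unbiased for the task operator of the
mean estimators. Its squared Hilbert-Schmidt deviation has mean at most `(B² / l)² / N`. With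
exponentially many tasks, Markov's inequality already gives probability `exp (-τ)` when `n ≥ 2τ`;
when `n < 2τ`, crude norm bounds are small enough. Adding the bias at `l = n ^ (-1/2)` gives an
operator error `Δ` of order `τ n ^ (-r/2)` (`sourceLaw_norm_sub_gt_le`). Subspace. `fT` lies in the
range of the task operator, where its inverse is bounded by `1 / γ`. A dimension count then shows,
deterministically and for every choice of singular vectors, that projecting `fT` on their span loses
at most `2 Δ ‖fT‖ / γ` (`IsTopRightSingular.norm_sub_starProjection_le`). Target. Over a fixed
subspace of dimension `s` two facts suffice. The regularized empirical norm dominates the population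
norm (`measure_empirical_norm_lt_le`); this is a lower tail bound for a sum of random rank one
matrices, obtained by following the mean of the trace of the `p`-th inverse power as summands are
added one by one. The noise functional is of order `√(m s)` (`measure_noise_gt_le`), by exponential
moments in whitened coordinates. The normal equation tested on the error turns both into the risk
bound (`excessRisk_ridge_le`). -/

theorem hsNorm_sq {ι : Type*} (b : HilbertBasis ι ℝ H) (A : H →L[ℝ] H) :
    hsNorm A ^ 2 = ∑' i, ‖A (b i)‖ₑ ^ 2 := by
  rw [hsNorm_eq b, ← ENNReal.rpow_natCast, ← ENNReal.rpow_mul]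
  norm_num

theorem hsNorm_add_le (A B : H →L[ℝ] H) : hsNorm (A + B) ≤ hsNorm A + hsNorm B := by
  obtain ⟨b, -⟩ := (exists_hilbertBasis ℝ H).choose_spec
  have key : hsNorm (A + B) ^ 2 ≤ (hsNorm A + hsNorm B) ^ 2 := by
    rw [hsNorm_sq b, ENNReal.tsum_eq_iSup_sum]
    refine iSup_le fun s => ?_
    have h1 := ENNReal.Lp_add_le s (fun i => ‖A (b i)‖ₑ) (fun i => ‖B (b i)‖ₑ)
      (p := 2) (by norm_num)
    have h2 : ∀ C : H →L[ℝ] H, (∑ i ∈ s, ‖C (b i)‖ₑ ^ (2 : ℝ)) ^ (1 / 2 : ℝ) ≤ hsNorm C := by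
      intro C
      rw [hsNorm_eq b]
      simp only [ENNReal.rpow_ofNat]
      gcongr
      exact ENNReal.sum_le_tsum s
    have h3 : (∑ i ∈ s, (‖A (b i)‖ₑ + ‖B (b i)‖ₑ) ^ (2 : ℝ)) ^ (1 / 2 : ℝ)
        ≤ hsNorm A + hsNorm B := h1.trans (add_le_add (h2 A) (h2 B))
    calc ∑ i ∈ s, ‖(A + B) (b i)‖ₑ ^ 2
        ≤ ∑ i ∈ s, (‖A (b i)‖ₑ + ‖B (b i)‖ₑ) ^ (2 : ℝ) := by
          refine Finset.sum_le_sum fun i _ => ?_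
          rw [ENNReal.rpow_ofNat]
          gcongr
          exact enorm_add_le _ _
      _ = ((∑ i ∈ s, (‖A (b i)‖ₑ + ‖B (b i)‖ₑ) ^ (2 : ℝ)) ^ (1 / 2 : ℝ)) ^ 2 := by
          rw [← ENNReal.rpow_natCast, ← ENNReal.rpow_mul]
          norm_num
      _ ≤ _ := by gcongr
  exact (ENNReal.pow_le_pow_left_iff two_ne_zero).1 key

theorem hsNorm_smul (c : ℝ) (A : H →L[ℝ] H) : hsNorm (c • A) = ‖c‖ₑ * hsNorm A := by
  obtain ⟨b, -⟩ := (exists_hilbertBasis ℝ H).choose_spec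
  refine (ENNReal.pow_right_strictMono two_ne_zero).injective ?_
  rw [mul_pow, hsNorm_sq b, hsNorm_sq b,
    ← ENNReal.tsum_mul_left]
  simp [enorm_smul, mul_pow]

theorem hsNorm_rankOne (x y : H) : hsNorm (rankOne ℝ x y) = ‖x‖ₑ * ‖y‖ₑ := by
  obtain ⟨b, -⟩ := (exists_hilbertBasis ℝ H).choose_spec
  refine (ENNReal.pow_right_strictMono two_ne_zero).injective ?_
  rw [mul_pow, hsNorm_sq b, enorm_sq_eq_tsum b y,
    ← ENNReal.tsum_mul_left]
  refine tsum_congr fun i => ?_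
  rw [rankOne_apply, enorm_smul, mul_pow, mul_comm, real_inner_comm]

theorem hsNorm_zero : hsNorm (0 : H →L[ℝ] H) = 0 := by
  simpa using hsNorm_smul 0 (0 : H →L[ℝ] H)

theorem hsNorm_sum_le {ι : Type*} (s : Finset ι) (A : ι → H →L[ℝ] H) :
    hsNorm (∑ i ∈ s, A i) ≤ ∑ i ∈ s, hsNorm (A i) := by
  classical
  induction s using Finset.induction_on with
  | empty => simp [hsNorm_zero]
  | insert i s hi ih =>
    rw [Finset.sum_insert hi, Finset.sum_insert hi]
    exact (hsNorm_add_le _ _).trans (by gcongr)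

/-- One factor of the tensor is changed at a time. -/
theorem hsNorm_rankOne_sub_le (a f : H) :
    hsNorm (rankOne ℝ a a - rankOne ℝ f f) ≤ ENNReal.ofReal (‖a - f‖ * (‖a‖ + ‖f‖)) := by
  have h : rankOne ℝ a a - rankOne ℝ f f = rankOne ℝ (a - f) a + rankOne ℝ f (a - f) := by
    simp [sub_eq_add_neg, add_assoc]
  rw [h]
  refine (hsNorm_add_le _ _).trans ?_
  rw [hsNorm_rankOne, hsNorm_rankOne, mul_comm ‖f‖ₑ, ← mul_add,
    ENNReal.ofReal_mul (norm_nonneg _), ENNReal.ofReal_add (norm_nonneg _) (norm_nonneg _),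
    ofReal_norm, ofReal_norm, ofReal_norm]

/-- The operator norm is at most the Hilbert-Schmidt norm. -/
theorem enorm_apply_le_hsNorm (A : H →L[ℝ] H) (x : H) : ‖A x‖ₑ ≤ hsNorm A * ‖x‖ₑ := by
  obtain ⟨b, -⟩ := (exists_hilbertBasis ℝ H).choose_spec
  rcases eq_or_ne x 0 with rfl | hx
  · simp
  have hx' : ‖x‖ₑ ≠ 0 := by simpa using hx
  -- compare with the rank one operator through the adjoint
  have h1 : ‖A x‖ₑ ^ 2 ≤ (hsNorm A * ‖x‖ₑ) ^ 2 := by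
    have hadj : hsNorm A ^ 2 = ∑' i, ‖A.adjoint (b i)‖ₑ ^ 2 := by
      rw [hsNorm_sq b, tsum_enorm_sq_adjoint b b]
    rw [enorm_sq_eq_tsum b, mul_pow, hadj, ← ENNReal.tsum_mul_right]
    refine ENNReal.tsum_le_tsum fun i => ?_
    rw [← mul_pow, ← ContinuousLinearMap.adjoint_inner_left]
    gcongr
    simpa [enorm_eq_nnnorm, ← ENNReal.coe_mul] using
      nnnorm_inner_le_nnnorm (𝕜 := ℝ) (A.adjoint (b i)) x
  exact (ENNReal.pow_le_pow_left_iff two_ne_zero).1 h1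

end HilbertSchmidt

/-! ### Resolvents of positive operators -/

section Resolvent

variable {H : Type*} [NormedAddCommGroup H] [InnerProductSpace ℝ H] [CompleteSpace H]

/-- The operator `(S + l)⁻¹`. -/
def regInv (S : H →L[ℝ] H) (l : ℝ) : H →L[ℝ] H :=
  Ring.inverse (S + l • ContinuousLinearMap.id ℝ H)

theorem isUnit_add_smul_id {S : H →L[ℝ] H} (hS : S.IsPositive) {l : ℝ} (hl : 0 < l) :
    IsUnit (S + l • ContinuousLinearMap.id ℝ H) := by
  refine ContinuousLinearMap.isUnit_of_forall_le_norm_inner_map _ (c := ⟨l, hl.le⟩) hl fun x => ?_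
  have h1 : 0 ≤ inner ℝ (S x) x := hS.inner_nonneg_left x
  have h2 : inner ℝ ((S + l • ContinuousLinearMap.id ℝ H) x) x
      = inner ℝ (S x) x + l * ‖x‖ ^ 2 := by
    simp [inner_add_left, inner_smul_left]
  rw [h2, Real.norm_of_nonneg (by positivity)]
  change ‖x‖ ^ 2 * l ≤ _
  linarith

theorem regInv_apply_add {S : H →L[ℝ] H} (hS : S.IsPositive) {l : ℝ} (hl : 0 < l) (x : H) :
    regInv S l (S x + l • x) = x := by
  have h := Ring.inverse_mul_cancel _ (isUnit_add_smul_id hS hl)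
  simpa [regInv] using DFunLike.congr_fun h x

theorem add_apply_regInv {S : H →L[ℝ] H} (hS : S.IsPositive) {l : ℝ} (hl : 0 < l) (x : H) :
    S (regInv S l x) + l • regInv S l x = x := by
  have h := Ring.mul_inverse_cancel _ (isUnit_add_smul_id hS hl)
  simpa [regInv] using DFunLike.congr_fun h x

-- The cross term `2 l ⟨S z, z⟩` is nonnegative. Dropping either square on the left gives the two
-- resolvent bounds `norm_regInv_le` and `norm_regInv_apply_le`.
omit [CompleteSpace H] in
theorem norm_add_smul_sq_ge {S : H →L[ℝ] H} (hS : S.IsPositive) {l : ℝ} (hl : 0 < l) (z : H) :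
    ‖S z‖ ^ 2 + l ^ 2 * ‖z‖ ^ 2 ≤ ‖S z + l • z‖ ^ 2 := by
  have h1 : 0 ≤ inner ℝ (S z) z := hS.inner_nonneg_left z
  rw [norm_add_sq_real, inner_smul_right, norm_smul, Real.norm_of_nonneg hl.le]
  nlinarith [mul_nonneg hl.le h1]

theorem norm_regInv_le {S : H →L[ℝ] H} (hS : S.IsPositive) {l : ℝ} (hl : 0 < l) (x : H) :
    ‖regInv S l x‖ ≤ l⁻¹ * ‖x‖ := by
  have h := norm_add_smul_sq_ge hS hl (regInv S l x)
  rw [add_apply_regInv hS hl] at h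
  rw [inv_mul_eq_div, le_div_iff₀ hl]
  refine le_of_sq_le_sq ?_ (norm_nonneg _)
  nlinarith [sq_nonneg ‖S (regInv S l x)‖]

theorem apply_regInv_comm {S : H →L[ℝ] H} (hS : S.IsPositive) {l : ℝ} (hl : 0 < l) (x : H) :
    regInv S l (S x) = x - l • regInv S l x := by
  have h := regInv_apply_add hS hl x
  rw [map_add, map_smul] at h
  exact eq_sub_of_add_eq h

theorem norm_regInv_apply_le {S : H →L[ℝ] H} (hS : S.IsPositive) {l : ℝ} (hl : 0 < l) (x : H) :
    ‖regInv S l (S x)‖ ≤ ‖x‖ := by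
  have h := norm_add_smul_sq_ge hS hl (regInv S l x)
  have h2 := add_apply_regInv hS hl x
  rw [apply_regInv_comm hS hl, ← eq_sub_of_add_eq h2]
  rw [h2] at h
  refine le_of_sq_le_sq ?_ (norm_nonneg _)
  nlinarith [sq_nonneg ‖regInv S l x‖, mul_nonneg (sq_nonneg l) (sq_nonneg ‖regInv S l x‖)]

end Resolvent

/-! ### Powers of a positive operator -/

section Power

variable {H : Type*} [NormedAddCommGroup H] [InnerProductSpace ℝ H] [CompleteSpace H]

/-- The orthogonal projection onto the eigenspace `ker (S - t)`. -/
def eigProj (S : H →L[ℝ] H) (t : ℝ) : H →L[ℝ] H :=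
  (S - t • ContinuousLinearMap.id ℝ H).ker.starProjection

theorem apply_eigProj (S : H →L[ℝ] H) (t : ℝ) (h : H) : S (eigProj S t h) = t • eigProj S t h := by
  have h1 : eigProj S t h ∈ (S - t • ContinuousLinearMap.id ℝ H).ker :=
    Submodule.starProjection_apply_mem _ _
  rw [LinearMap.mem_ker] at h1
  simpa [sub_eq_zero] using h1

theorem inner_eigProj_self (S : H →L[ℝ] H) (t : ℝ) (h : H) :
    inner ℝ (eigProj S t h) h = ‖eigProj S t h‖ ^ 2 := by
  rw [eigProj, ← real_inner_self_eq_norm_sq, Submodule.inner_starProjection_left_eq_right,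
    Submodule.inner_starProjection_left_eq_right,
    Submodule.starProjection_eq_self_iff.2 (Submodule.starProjection_apply_mem _ _)]

theorem inner_eigProj_of_ne {S : H →L[ℝ] H} (hS : S.IsPositive) {t u : ℝ} (htu : t ≠ u) (h : H) :
    inner ℝ (eigProj S t h) (eigProj S u h) = 0 := by
  have h1 : inner ℝ (S (eigProj S t h)) (eigProj S u h)
      = inner ℝ (eigProj S t h) (S (eigProj S u h)) := hS.isSymmetric _ _
  rw [apply_eigProj, apply_eigProj, inner_smul_left, inner_smul_right] at h1
  have h2 : (t - u) * inner ℝ (eigProj S t h) (eigProj S u h) = 0 := by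
    rw [conj_trivial] at h1; linarith
  exact (mul_eq_zero.1 h2).resolve_left (sub_ne_zero.2 htu)

theorem norm_sum_smul_eigProj_sq {S : H →L[ℝ] H} (hS : S.IsPositive) (s : Finset ℝ) (c : ℝ → ℝ)
    (h : H) : ‖∑ t ∈ s, c t • eigProj S t h‖ ^ 2 = ∑ t ∈ s, c t ^ 2 * ‖eigProj S t h‖ ^ 2 := by
  classical
  rw [← real_inner_self_eq_norm_sq, sum_inner]
  refine Finset.sum_congr rfl fun t ht => ?_
  rw [inner_sum, Finset.sum_eq_single t]
  · rw [inner_smul_left, inner_smul_right, real_inner_self_eq_norm_sq]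
    simp; ring
  · intro u _ hu
    rw [inner_smul_left, inner_smul_right, inner_eigProj_of_ne hS (Ne.symm hu)]
    simp
  · exact fun h => absurd ht h

theorem sum_norm_eigProj_sq_le {S : H →L[ℝ] H} (hS : S.IsPositive) (s : Finset ℝ) (h : H) :
    ∑ t ∈ s, ‖eigProj S t h‖ ^ 2 ≤ ‖h‖ ^ 2 := by
  have h1 := norm_sum_smul_eigProj_sq hS s (fun _ => 1) h
  simp only [one_smul, one_pow, one_mul] at h1
  have h2 : inner ℝ (∑ t ∈ s, eigProj S t h) h = ∑ t ∈ s, ‖eigProj S t h‖ ^ 2 := by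
    rw [sum_inner]
    exact Finset.sum_congr rfl fun t _ => inner_eigProj_self S t h
  have h3 := real_inner_le_norm (∑ t ∈ s, eigProj S t h) h
  rw [h2, ← h1] at h3
  rw [← h1]
  nlinarith [norm_nonneg (∑ t ∈ s, eigProj S t h), norm_nonneg h,
    sq_nonneg (‖∑ t ∈ s, eigProj S t h‖ - ‖h‖)]

/-- Eigenspaces for different eigenvalues are orthogonal, so this is Bessel's inequality with
weights; only eigenvalues that `h` charges matter. -/
theorem norm_sum_smul_eigProj_le {S : H →L[ℝ] H} (hS : S.IsPositive) (s : Finset ℝ) {c : ℝ → ℝ}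
    {C : ℝ} (hC : 0 ≤ C) (h : H) (hc : ∀ t, eigProj S t h ≠ 0 → |c t| ≤ C) :
    ‖∑ t ∈ s, c t • eigProj S t h‖ ≤ C * ‖h‖ := by
  refine le_of_sq_le_sq ?_ (by positivity)
  rw [norm_sum_smul_eigProj_sq hS, mul_pow]
  calc ∑ t ∈ s, c t ^ 2 * ‖eigProj S t h‖ ^ 2 ≤ ∑ t ∈ s, C ^ 2 * ‖eigProj S t h‖ ^ 2 := by
        refine Finset.sum_le_sum fun t _ => ?_
        by_cases ht : eigProj S t h = 0
        · simp [ht]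
        · have := hc t ht
          rw [← sq_abs (c t)]
          gcongr
    _ = C ^ 2 * ∑ t ∈ s, ‖eigProj S t h‖ ^ 2 := by rw [Finset.mul_sum]
    _ ≤ _ := by gcongr; exact sum_norm_eigProj_sq_le hS s h

theorem eigenvalue_bounds {S : H →L[ℝ] H} (hS : S.IsPositive) {t : ℝ} {h : H}
    (ht : eigProj S t h ≠ 0) : 0 ≤ t ∧ t ≤ ‖S‖ := by
  have hpos : 0 < ‖eigProj S t h‖ := norm_pos_iff.2 ht
  have h1 : 0 ≤ inner ℝ (S (eigProj S t h)) (eigProj S t h) := hS.inner_nonneg_left _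
  have h2 := S.le_opNorm (eigProj S t h)
  rw [apply_eigProj] at h1 h2
  rw [inner_smul_left, real_inner_self_eq_norm_sq] at h1
  simp only [conj_trivial] at h1
  have h0 : 0 ≤ t := nonneg_of_mul_nonneg_left h1 (by positivity)
  rw [norm_smul, Real.norm_of_nonneg h0] at h2
  exact ⟨h0, le_of_mul_le_mul_right h2 hpos⟩

/-- A bounded operator acting by scalars on the eigenspaces maps `S ^ r h` into a ball. -/
theorem norm_apply_opPow_le {S : H →L[ℝ] H} (hS : S.IsPositive) (T : H →L[ℝ] H) {r C : ℝ}
    {c : ℝ → ℝ} (h : H) (hT : ∀ t, T (eigProj S t h) = c t • eigProj S t h) (hC : 0 ≤ C)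
    (hc : ∀ t, 0 ≤ t → t ≤ ‖S‖ → |t ^ r * c t| ≤ C) : ‖T (opPow S r h)‖ ≤ C * ‖h‖ := by
  have hdef : opPow S r h = ∑' t : ℝ, t ^ r • eigProj S t h := rfl
  rw [hdef]
  by_cases hs : Summable fun t : ℝ => t ^ r • eigProj S t h
  · have h1 := hs.hasSum.mapL T
    refine le_of_tendsto h1.norm (Filter.Eventually.of_forall fun s => ?_)
    have h2 : ∀ t : ℝ, T (t ^ r • eigProj S t h) = (t ^ r * c t) • eigProj S t h := fun t => by
      rw [map_smul, hT, smul_smul]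
    simp only [h2]
    exact norm_sum_smul_eigProj_le hS s hC h fun t ht =>
      hc t (eigenvalue_bounds hS ht).1 (eigenvalue_bounds hS ht).2
  -- A divergent sum is `0` by convention, and the bound is then trivial, so summability never has
  -- to be proved.
  · rw [tsum_eq_zero_of_not_summable hs, map_zero, norm_zero]
    positivity

theorem norm_opPow_le {S : H →L[ℝ] H} (hS : S.IsPositive) {r K : ℝ} (hr0 : 0 ≤ r) (hr1 : r ≤ 1)
    (hK : ‖S‖ ≤ K) (h : H) : ‖opPow S r h‖ ≤ max 1 K * ‖h‖ := by
  refine norm_apply_opPow_le hS (ContinuousLinearMap.id ℝ H) (c := fun _ => 1) h (by simp)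
    (by positivity) fun t h0 ht => ?_
  rw [mul_one, abs_of_nonneg (Real.rpow_nonneg h0 r)]
  rcases le_total t 1 with h1 | h1
  · exact (Real.rpow_le_one h0 h1 hr0).trans (le_max_left _ _)
  · calc t ^ r ≤ t ^ (1 : ℝ) := Real.rpow_le_rpow_of_exponent_le h1 hr1
      _ = t := Real.rpow_one t
      _ ≤ _ := (ht.trans hK).trans (le_max_right _ _)

/-- On the eigenspace of `t` the operator is multiplication by `t ^ r / (t + l)`, and weighted AM-GM
gives `t ^ r * l ^ (1 - r) ≤ r t + (1 - r) l ≤ t + l`. -/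
theorem norm_regInv_opPow_le {S : H →L[ℝ] H} (hS : S.IsPositive) {r l : ℝ} (hr0 : 0 ≤ r)
    (hr1 : r ≤ 1) (hl : 0 < l) (h : H) :
    ‖regInv S l (opPow S r h)‖ ≤ l ^ (r - 1) * ‖h‖ := by
  refine norm_apply_opPow_le hS _ (c := fun t => (t + l)⁻¹) h (fun t => ?_)
    (by positivity) fun t h0 ht => ?_
  · by_cases hz : eigProj S t h = 0
    · simp [hz]
    have h0 := (eigenvalue_bounds hS hz).1
    have h1 := regInv_apply_add hS hl (eigProj S t h)
    rw [apply_eigProj, ← add_smul, map_smul] at h1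
    have h2 : t + l ≠ 0 := by positivity
    rw [eq_inv_smul_iff₀ h2, h1]
  · have h1 := Real.geom_mean_le_arith_mean2_weighted hr0 (by linarith : 0 ≤ 1 - r) h0 hl.le
      (by ring)
    have h2 : t ^ r * l ^ (1 - r) ≤ t + l := by nlinarith
    have h3 : 0 < l ^ (1 - r) := Real.rpow_pos_of_pos hl _
    have h4 : l ^ (r - 1) = (l ^ (1 - r))⁻¹ := by
      rw [← Real.rpow_neg hl.le]; congr 1; ring
    rw [abs_of_nonneg (by positivity), h4, ← div_eq_mul_inv, div_le_iff₀ (by positivity),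
      inv_mul_eq_div, le_div_iff₀ h3]
    exact h2

end Power

/-! ### Measurability in a separable reproducing kernel Hilbert space -/

/-- Basis vectors are at mutual distance `√2`, so balls of radius `1/2` around them are disjoint
open sets, of which a separable space has only countably many. -/
theorem HilbertBasis.countable_index {ι H : Type*} [NormedAddCommGroup H] [InnerProductSpace ℝ H]
    [TopologicalSpace.SeparableSpace H] (b : HilbertBasis ι ℝ H) : Countable ι := by
  refine Pairwise.countable_of_isOpen_disjoint (s := fun i => Metric.ball (b i) (1 / 2)) ?_
    (fun i => Metric.isOpen_ball) fun i => ⟨b i, by simp⟩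
  intro i j hij
  refine Metric.ball_disjoint_ball ?_
  have h1 : ‖b i - b j‖ ^ 2 = 2 := by
    rw [norm_sub_sq_real, b.orthonormal.1, b.orthonormal.1, b.orthonormal.2 hij]
    norm_num
  rw [dist_eq_norm]
  nlinarith [norm_nonneg (b i - b j)]

section Features

variable {X H : Type*} [MeasurableSpace X] [NormedAddCommGroup H] [InnerProductSpace ℝ H]
  [CompleteSpace H] [RKHS ℝ H X ℝ] {κ : ℝ}

theorem norm_featureMap_le (hκ : 0 ≤ κ) (hK : KernelAssumptions H κ) (x : X) :
    ‖featureMap H x‖ ≤ κ := by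
  refine le_of_sq_le_sq ?_ hκ
  rw [← real_inner_self_eq_norm_sq, inner_featureMap]
  exact hK.kernel_le x x

theorem abs_apply_le (hκ : 0 ≤ κ) (hK : KernelAssumptions H κ) (f : H) (x : X) :
    |f x| ≤ κ * ‖f‖ := by
  rw [← inner_featureMap]
  exact (abs_real_inner_le_norm _ _).trans (by gcongr; exact norm_featureMap_le hκ hK x)

/-- Finite combinations of kernel sections are dense, and norm convergence implies pointwise
convergence because evaluations are continuous. -/
theorem measurable_coe (hK : KernelAssumptions H κ) (f : H) : Measurable fun x : X => f x := by
  have hmem : f ∈ (Submodule.span ℝ {RKHS.kerFun H x v | (x : X) (v : ℝ)}).topologicalClosure := by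
    rw [RKHS.kerFun_dense]; trivial
  obtain ⟨u, hu, hlim⟩ := mem_closure_iff_seq_limit.1 hmem
  refine measurable_of_tendsto_metrizable (f := fun n x => u n x) (fun n => ?_)
    (tendsto_pi_nhds.2 fun x => ((RKHS.continuous_eval x).tendsto f).comp hlim)
  refine Submodule.span_induction (p := fun g _ => Measurable fun x : X => g x) ?_ ?_ ?_ ?_ (hu n)
  · rintro _ ⟨y, v, rfl⟩
    have h1 : RKHS.kerFun H y v = v • featureMap H y := by
      rw [featureMap, ← map_smul, smul_eq_mul, mul_one]
    simp only [h1, RKHS.coe_smul, Pi.smul_apply, smul_eq_mul]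
    exact (hK.measurable_feature y).const_mul v
  · simp only [RKHS.coe_zero, Pi.zero_apply]; exact measurable_const
  · intro g h _ _ hg hh
    simp only [RKHS.coe_add, Pi.add_apply]; exact hg.add hh
  · intro c g _ hg
    simp only [RKHS.coe_smul, Pi.smul_apply, smul_eq_mul]; exact hg.const_mul c

/-- The feature expands in a countable orthonormal basis with coefficients `(b i) x`, which are
measurable functions of `x`. -/
theorem stronglyMeasurable_featureMap [TopologicalSpace.SeparableSpace H]
    (hK : KernelAssumptions H κ) : StronglyMeasurable fun x : X => featureMap H x := by
  obtain ⟨w, b, -⟩ := exists_hilbertBasis ℝ H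
  have : Countable w := HilbertBasis.countable_index b
  refine stronglyMeasurable_of_tendsto (u := Filter.atTop)
    (f := fun (s : Finset w) x => ∑ i ∈ s, (b i) x • b i) (fun s => ?_)
    (tendsto_pi_nhds.2 fun x => ?_)
  · exact Finset.stronglyMeasurable_fun_sum s fun i _ =>
      (measurable_coe hK (b i)).stronglyMeasurable.smul_const (b i)
  · have h := b.hasSum_repr (featureMap H x)
    refine h.congr_fun ?_ |> fun h => h
    intro i
    rw [b.repr_apply_apply, real_inner_comm, inner_featureMap]

end Features

/-! ### Closed form of the ridge estimator -/

section Ridge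

variable {X H : Type*} [NormedAddCommGroup H] [InnerProductSpace ℝ H]
  [CompleteSpace H] [RKHS ℝ H X ℝ]

-- First variation: along `f + t • g` the objective changes by `t² b - 2 t a`, which can be
-- nonnegative for all `t` only if `a = 0`.
omit [CompleteSpace H] in
theorem IsRidge.normal_equation {m : ℕ} {W : Submodule ℝ H} {l : ℝ} (hl : 0 ≤ l)
    {D : Fin m → X × ℝ} {f : H} (hf : IsRidge W l D f) {g : H} (hg : g ∈ W) :
    ∑ j, ((D j).2 - f (D j).1) * g (D j).1 = m * l * inner ℝ f g := by
  set a := ∑ j, ((D j).2 - f (D j).1) * g (D j).1 - m * l * inner ℝ f g with ha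
  set b := ∑ j, g (D j).1 ^ 2 + m * l * ‖g‖ ^ 2 with hb
  have hb0 : 0 ≤ b := by positivity
  have key : ∀ t : ℝ, 0 ≤ t ^ 2 * b - 2 * t * a := by
    intro t
    have h1 := hf.2 (f + t • g) (W.add_mem hf.1 (W.smul_mem t hg))
    have h2 : ridgeObjective l D (f + t • g) = ridgeObjective l D f + (t ^ 2 * b - 2 * t * a) := by
      have h3 : ‖f + t • g‖ ^ 2 = ‖f‖ ^ 2 + 2 * t * inner ℝ f g + t ^ 2 * ‖g‖ ^ 2 := by
        rw [norm_add_sq_real, inner_smul_right, norm_smul, mul_pow, Real.norm_eq_abs, sq_abs]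
        ring
      have h4 : ∑ j, ((D j).2 - (f + t • g) (D j).1) ^ 2 = ∑ j, ((D j).2 - f (D j).1) ^ 2
          + t ^ 2 * ∑ j, g (D j).1 ^ 2 - 2 * t * ∑ j, ((D j).2 - f (D j).1) * g (D j).1 := by
        simp only [Finset.mul_sum, ← Finset.sum_sub_distrib, ← Finset.sum_add_distrib]
        refine Finset.sum_congr rfl fun j _ => ?_
        simp only [RKHS.coe_add, RKHS.coe_smul, Pi.add_apply, Pi.smul_apply, smul_eq_mul]
        ring
      rw [ridgeObjective, ridgeObjective, h3, h4, ha, hb]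
      ring
    linarith
  -- The minimizing step would be `a / b`; using `b + 1` also covers `b = 0` and still makes the
  -- change negative unless `a = 0`.
  have h1 := key (a / (b + 1))
  have h2 : (a / (b + 1)) ^ 2 * b - 2 * (a / (b + 1)) * a = -(a ^ 2 * (b + 2)) / (b + 1) ^ 2 := by
    field_simp
    ring
  rw [h2, le_div_iff₀ (by positivity)] at h1
  have h3 : a = 0 := by
    by_contra hne
    have : 0 < a ^ 2 * (b + 2) := by positivity
    linarith
  linarith

-- Comparison of the minimizer with the zero function.
omit [CompleteSpace H] in
theorem IsRidge.norm_sq_le {m : ℕ} (hm : 0 < m) {W : Submodule ℝ H} {l : ℝ} (hl : 0 < l)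
    {D : Fin m → X × ℝ} {f : H} (hf : IsRidge W l D f) {B : ℝ} (hB : ∀ j, |(D j).2| ≤ B) :
    ‖f‖ ^ 2 ≤ B ^ 2 / l := by
  have h1 := hf.2 0 W.zero_mem
  simp only [ridgeObjective, RKHS.coe_zero, Pi.zero_apply, sub_zero, norm_zero] at h1
  have h2 : ∑ j, (D j).2 ^ 2 ≤ m * B ^ 2 := by
    refine (Finset.sum_le_card_nsmul _ _ (B ^ 2) fun j _ => ?_).trans (by simp)
    rw [← sq_abs]
    exact pow_le_pow_left₀ (abs_nonneg _) (hB j) 2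
  have h3 : 0 ≤ ∑ j, ((D j).2 - f (D j).1) ^ 2 := by positivity
  have hm' : (0 : ℝ) < m := by exact_mod_cast hm
  rw [le_div_iff₀ hl]
  refine le_of_mul_le_mul_left ?_ hm'
  nlinarith

/-- The empirical covariance operator of points `z j` of `H`. -/
def pointCov {m : ℕ} (z : Fin m → H) : H →L[ℝ] H := (1 / (m : ℝ)) • ∑ j, rankOne ℝ (z j) (z j)

omit [CompleteSpace H] in
theorem isPositive_pointCov {m : ℕ} (z : Fin m → H) :
    (pointCov z).IsPositive := by
  have h : (∑ j, rankOne ℝ (z j) (z j)).IsPositive := by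
    refine Finset.sum_induction _ (fun A : H →L[ℝ] H => A.IsPositive) (fun _ _ => .add) ?_ ?_
    · exact ContinuousLinearMap.isPositive_zero
    · exact fun j _ => isPositive_rankOne_self (z j)
  exact h.smul_of_nonneg (by positivity)

omit [CompleteSpace H] in
theorem pointCov_apply {m : ℕ} (z : Fin m → H) (g : H) :
    pointCov z g = (1 / (m : ℝ)) • ∑ j, inner ℝ (z j) g • z j := by
  simp [pointCov]

/-- The normal equation over the whole space, solved for the estimator. This form makes its
measurability and its mean accessible. -/
theorem ridge_top_eq {m : ℕ} (hm : 0 < m) {l : ℝ} (hl : 0 < l) (D : Fin m → X × ℝ) :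
    ridge (⊤ : Submodule ℝ H) l D = regInv (pointCov fun j => featureMap H (D j).1) l
      ((1 / (m : ℝ)) • ∑ j, (D j).2 • featureMap H (D j).1) := by
  set f := ridge (⊤ : Submodule ℝ H) l D with hf
  have : CompleteSpace (⊤ : Submodule ℝ H) := isClosed_univ.isComplete.completeSpace_coe
  have hR : IsRidge ⊤ l D f := isRidge_ridge hm ⊤ hl D
  have hm' : (m : ℝ) ≠ 0 := by positivity
  have h1 : ∑ j, (D j).2 • featureMap H (D j).1
      = ∑ j, f (D j).1 • featureMap H (D j).1 + (m * l) • f := by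
    refine ext_inner_right ℝ fun g => ?_
    have h2 := hR.normal_equation hl.le (g := g) trivial
    simp only [sub_mul, Finset.sum_sub_distrib] at h2
    simp only [inner_add_left, sum_inner, inner_smul_left, inner_featureMap, conj_trivial]
    linarith
  rw [h1, smul_add, smul_smul]
  have h3 : 1 / (m : ℝ) * (m * l) = l := by field_simp
  have h4 := regInv_apply_add (isPositive_pointCov fun j => featureMap H (D j).1) hl f
  rw [pointCov_apply] at h4
  simp only [inner_featureMap] at h4
  rw [h3, h4]

theorem continuous_regInv_pointCov {m : ℕ} {l : ℝ} (hl : 0 < l) :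
    Continuous fun z : Fin m → H => regInv (pointCov z) l := by
  refine continuous_iff_continuousAt.2 fun z => ?_
  obtain ⟨u, hu⟩ := isUnit_add_smul_id (isPositive_pointCov z) hl
  have h1 : ContinuousAt Ring.inverse (pointCov z + l • ContinuousLinearMap.id ℝ H) := by
    rw [← hu]; exact NormedRing.inverse_continuousAt u
  have h2 : Continuous fun z : Fin m → H => pointCov z + l • ContinuousLinearMap.id ℝ H := by
    unfold pointCov
    have h3 : Continuous fun z : Fin m → H => ∑ j, rankOne ℝ (z j) (z j) := by
      refine continuous_finsetSum _ fun j _ => ?_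
      have hj : Continuous fun z : Fin m → H => z j := continuous_apply j
      exact ((rankOne ℝ).continuous.comp hj).clm_apply hj
    exact (h3.const_smul (1 / (m : ℝ))).add continuous_const
  exact ContinuousAt.comp (f := fun z : Fin m → H => pointCov z + l • ContinuousLinearMap.id ℝ H)
    h1 h2.continuousAt

variable [MeasurableSpace X] [TopologicalSpace.SeparableSpace H] {κ : ℝ}

theorem stronglyMeasurable_regInv_features (hK : KernelAssumptions H κ) {m : ℕ} {l : ℝ}
    (hl : 0 < l) :
    StronglyMeasurable fun x : Fin m → X => regInv (pointCov fun j => featureMap H (x j)) l := by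
  have hS : SecondCountableTopology H := UniformSpace.secondCountable_of_separable H
  borelize H
  have hφ : Measurable fun x : X => featureMap H x :=
    (stronglyMeasurable_featureMap hK).measurable
  have h1 : Measurable fun (x : Fin m → X) (j : Fin m) => featureMap H (x j) :=
    measurable_pi_lambda _ fun j => hφ.comp (measurable_pi_apply j)
  have h2 : StronglyMeasurable fun (x : Fin m → X) (j : Fin m) => featureMap H (x j) :=
    h1.stronglyMeasurable
  exact (continuous_regInv_pointCov hl).comp_stronglyMeasurable h2

theorem stronglyMeasurable_ridge (hK : KernelAssumptions H κ) {m : ℕ} (hm : 0 < m) {l : ℝ}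
    (hl : 0 < l) :
    StronglyMeasurable fun D : Fin m → X × ℝ => ridge (⊤ : Submodule ℝ H) l D := by
  have hφ : StronglyMeasurable fun x : X => featureMap H x := stronglyMeasurable_featureMap hK
  have hg : Measurable fun (D : Fin m → X × ℝ) (j : Fin m) => (D j).1 :=
    measurable_pi_lambda _ fun j => measurable_fst.comp (measurable_pi_apply j)
  have h1 : StronglyMeasurable fun D : Fin m → X × ℝ =>
      regInv (pointCov fun j => featureMap H (D j).1) l :=
    (stronglyMeasurable_regInv_features (H := H) (m := m) hK hl).comp_measurable hg
  have h2 : StronglyMeasurable fun D : Fin m → X × ℝ =>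
      (1 / (m : ℝ)) • ∑ j, (D j).2 • featureMap H (D j).1 := by
    refine StronglyMeasurable.const_smul (Finset.stronglyMeasurable_fun_sum _ fun j _ => ?_) _
    have h3 : Measurable fun D : Fin m → X × ℝ => (D j).2 :=
      measurable_snd.comp (measurable_pi_apply j)
    have h4 : Measurable fun D : Fin m → X × ℝ => (D j).1 :=
      measurable_fst.comp (measurable_pi_apply j)
    exact h3.stronglyMeasurable.smul (hφ.comp_measurable h4)
  have h5 : Continuous fun p : (H →L[ℝ] H) × H => p.1 p.2 := isBoundedBilinearMap_apply.continuous
  have h6 := h5.comp_stronglyMeasurable (h1.prodMk h2)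
  have h7 : (fun D : Fin m → X × ℝ => ridge (⊤ : Submodule ℝ H) l D) = fun D =>
      regInv (pointCov fun j => featureMap H (D j).1) l
        ((1 / (m : ℝ)) • ∑ j, (D j).2 • featureMap H (D j).1) :=
    funext fun D => ridge_top_eq hm hl D
  rw [h7]
  exact h6

end Ridge

/-! ### Second moments of sums of independent vectors -/

section SecondMoment

theorem lintegral_sum_sub_integral_sq_le {ι : Type*} [Fintype ι] {Ω : ι → Type*}
    {mΩ : ∀ i, MeasurableSpace (Ω i)} (ν : ∀ i, Measure (Ω i)) [∀ i, IsProbabilityMeasure (ν i)]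
    {ξ : ∀ i, Ω i → ℝ} (hξ : ∀ i, MemLp (ξ i) 2 (ν i)) :
    ∫⁻ ω, ‖∑ i, (ξ i (ω i) - ∫ a, ξ i a ∂ν i)‖ₑ ^ 2 ∂Measure.pi ν
      ≤ ∑ i, ∫⁻ a, ‖ξ i a‖ₑ ^ 2 ∂ν i := by
  have hmp : ∀ i, MemLp (fun ω : ∀ i, Ω i => ξ i (ω i)) 2 (Measure.pi ν) := fun i =>
    (hξ i).comp_measurePreserving (measurePreserving_eval ν i)
  have hsum : MemLp (∑ i, fun ω : ∀ i, Ω i => ξ i (ω i)) 2 (Measure.pi ν) :=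
    memLp_finsetSum' _ fun i _ => hmp i
  have hmean : ∫ ω, (∑ i, fun ω : ∀ i, Ω i => ξ i (ω i)) ω ∂Measure.pi ν
      = ∑ i, ∫ a, ξ i a ∂ν i := by
    simp only [Finset.sum_apply]
    rw [integral_finsetSum _ fun i _ => (hmp i).integrable one_le_two]
    refine Finset.sum_congr rfl fun i _ => ?_
    have h := integral_map (μ := Measure.pi ν) (φ := Function.eval i)
      (measurable_pi_apply i).aemeasurable (f := ξ i)
      (by rw [(measurePreserving_eval ν i).map_eq]; exact (hξ i).1)
    rw [(measurePreserving_eval ν i).map_eq] at h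
    exact h.symm
  have hL : ∫⁻ ω, ‖∑ i, (ξ i (ω i) - ∫ a, ξ i a ∂ν i)‖ₑ ^ 2 ∂Measure.pi ν
      = evariance (∑ i, fun ω : ∀ i, Ω i => ξ i (ω i)) (Measure.pi ν) := by
    rw [evariance, hmean]
    simp [Finset.sum_sub_distrib]
  rw [hL, ← ofReal_variance hsum, variance_sum_pi hξ,
    ENNReal.ofReal_sum_of_nonneg fun i _ => variance_nonneg _ _]
  refine Finset.sum_le_sum fun i _ => ?_
  calc ENNReal.ofReal Var[ξ i; ν i] ≤ ENNReal.ofReal (∫ a, ξ i a ^ 2 ∂ν i) :=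
        ENNReal.ofReal_le_ofReal (variance_le_expectation_sq (hξ i).1)
    _ = ∫⁻ a, ‖ξ i a‖ₑ ^ 2 ∂ν i := by
        rw [ofReal_integral_eq_lintegral_ofReal (hξ i).integrable_sq
          (Filter.Eventually.of_forall fun a => sq_nonneg _)]
        refine lintegral_congr fun a => ?_
        rw [← sq_abs, ENNReal.ofReal_pow (abs_nonneg _), ← Real.norm_eq_abs, ofReal_norm]

variable {H : Type*} [NormedAddCommGroup H] [InnerProductSpace ℝ H] [CompleteSpace H]
  [TopologicalSpace.SeparableSpace H]

/-- Parseval's identity reduces this to real coordinates, where variances of independent terms add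
and each is at most a second moment. -/
theorem lintegral_enorm_sum_sub_integral_sq_le {ι : Type*} [Fintype ι] {Ω : ι → Type*}
    {mΩ : ∀ i, MeasurableSpace (Ω i)} (ν : ∀ i, Measure (Ω i)) [∀ i, IsProbabilityMeasure (ν i)]
    {ξ : ∀ i, Ω i → H} (hξ : ∀ i, MemLp (ξ i) 2 (ν i)) :
    ∫⁻ ω, ‖∑ i, (ξ i (ω i) - ∫ a, ξ i a ∂ν i)‖ₑ ^ 2 ∂Measure.pi ν
      ≤ ∑ i, ∫⁻ a, ‖ξ i a‖ₑ ^ 2 ∂ν i := by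
  obtain ⟨w, b, -⟩ := exists_hilbertBasis ℝ H
  have : Countable w := HilbertBasis.countable_index b
  have hmem : ∀ e i, MemLp (fun a => inner ℝ (b e) (ξ i a)) 2 (ν i) := fun e i =>
    (hξ i).const_inner (b e)
  have hcoord : ∀ (e : w) (ω : ∀ i, Ω i), inner ℝ (b e) (∑ i, (ξ i (ω i) - ∫ a, ξ i a ∂ν i))
      = ∑ i, (inner ℝ (b e) (ξ i (ω i)) - ∫ a, inner ℝ (b e) (ξ i a) ∂ν i) := by
    intro e ω
    rw [inner_sum]
    refine Finset.sum_congr rfl fun i _ => ?_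
    rw [inner_sub_right, integral_inner ((hξ i).integrable one_le_two)]
  have hR : ∀ i, ∫⁻ a, ‖ξ i a‖ₑ ^ 2 ∂ν i = ∑' e, ∫⁻ a, ‖inner ℝ (b e) (ξ i a)‖ₑ ^ 2 ∂ν i := by
    intro i
    rw [← lintegral_tsum fun e => (hmem e i).1.enorm.pow_const 2]
    exact lintegral_congr fun a => enorm_sq_eq_tsum b _
  have hL : ∫⁻ ω, ‖∑ i, (ξ i (ω i) - ∫ a, ξ i a ∂ν i)‖ₑ ^ 2 ∂Measure.pi ν
      = ∑' e, ∫⁻ ω, ‖∑ i, (inner ℝ (b e) (ξ i (ω i)) - ∫ a, inner ℝ (b e) (ξ i a) ∂ν i)‖ₑ ^ 2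
        ∂Measure.pi ν := by
    rw [← lintegral_tsum]
    · refine lintegral_congr fun ω => ?_
      rw [enorm_sq_eq_tsum b]
      exact tsum_congr fun e => by rw [hcoord]
    · intro e
      refine AEMeasurable.pow_const (AEMeasurable.enorm ?_) 2
      refine Finset.aemeasurable_fun_sum _ fun i _ => AEMeasurable.sub_const ?_ _
      exact ((hmem e i).comp_measurePreserving (measurePreserving_eval ν i)).1.aemeasurable
  have hS : ∑ i, ∫⁻ a, ‖ξ i a‖ₑ ^ 2 ∂ν i
      = ∑' e, ∑ i, ∫⁻ a, ‖inner ℝ (b e) (ξ i a)‖ₑ ^ 2 ∂ν i := by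
    simp only [hR]
    exact (Summable.tsum_finsetSum fun i _ => ENNReal.summable).symm
  have hle : ∀ e, ∫⁻ ω, ‖∑ i, (inner ℝ (b e) (ξ i (ω i)) - ∫ a, inner ℝ (b e) (ξ i a) ∂ν i)‖ₑ ^ 2
      ∂Measure.pi ν ≤ ∑ i, ∫⁻ a, ‖inner ℝ (b e) (ξ i a)‖ₑ ^ 2 ∂ν i := fun e =>
    lintegral_sum_sub_integral_sq_le ν (ξ := fun i a => inner ℝ (b e) (ξ i a)) (hmem e)
  rw [hL, hS]
  exact ENNReal.tsum_le_tsum hle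

theorem enorm_integral_le_of_lintegral_sq_le {Ω E : Type*} [MeasurableSpace Ω]
    [NormedAddCommGroup E] [NormedSpace ℝ E] {ν : Measure Ω} [IsProbabilityMeasure ν] {u : Ω → E}
    (hu : AEStronglyMeasurable u ν) {c : ℝ≥0∞} (h : ∫⁻ ω, ‖u ω‖ₑ ^ 2 ∂ν ≤ c ^ 2) :
    ‖∫ ω, u ω ∂ν‖ₑ ≤ c := by
  refine (enorm_integral_le_lintegral_enorm u).trans ?_
  have h1 := eLpNorm_le_eLpNorm_of_exponent_le (μ := ν) (p := 1) (q := 2) one_le_two hu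
  rw [eLpNorm_one_eq_lintegral_enorm] at h1
  refine h1.trans ?_
  rw [eLpNorm_eq_lintegral_rpow_enorm_toReal two_ne_zero ENNReal.ofNat_ne_top]
  simp only [ENNReal.toReal_ofNat, ENNReal.rpow_ofNat]
  calc (∫⁻ ω, ‖u ω‖ₑ ^ 2 ∂ν) ^ (1 / 2 : ℝ) ≤ (c ^ 2) ^ (1 / 2 : ℝ) := by gcongr
    _ = c := by rw [← ENNReal.rpow_natCast, ← ENNReal.rpow_mul]; norm_num

end SecondMoment

/-! ### Expectation of the ridge estimator -/

section Residual

variable {X H E : Type*} [MeasurableSpace X] [NormedAddCommGroup H] [InnerProductSpace ℝ H]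
  [RKHS ℝ H X ℝ] [NormedAddCommGroup E] [NormedSpace ℝ E] [CompleteSpace E]
  {μ : Measure (X × ℝ)} [IsProbabilityMeasure μ] {f : H}

omit [IsProbabilityMeasure μ] in
theorem IsRegressionFunction.integrable_coe (hf : IsRegressionFunction μ f) :
    Integrable (fun p : X × ℝ => f p.1) μ :=
  integrable_condExp.congr hf.2

theorem IsRegressionFunction.integral_residual_smul (hf : IsRegressionFunction μ f) {h : X → E}
    (hh : StronglyMeasurable h) {c : ℝ} (hc : ∀ x, ‖h x‖ ≤ c) :
    ∫ p, (p.2 - f p.1) • h p.1 ∂μ = 0 := by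
  have hle : MeasurableSpace.comap (Prod.fst : X × ℝ → X) inferInstance ≤ Prod.instMeasurableSpace :=
    measurable_fst.comap_le
  have hg : StronglyMeasurable[MeasurableSpace.comap Prod.fst inferInstance]
      fun p : X × ℝ => h p.1 :=
    hh.comp_measurable (comap_measurable Prod.fst)
  have hg' : AEStronglyMeasurable (fun p : X × ℝ => h p.1) μ :=
    (hh.comp_measurable measurable_fst).aestronglyMeasurable
  have hbdd : ∀ᵐ p : X × ℝ ∂μ, ‖h p.1‖ ≤ c := Filter.Eventually.of_forall fun p => hc p.1
  have hi1 : Integrable (fun p : X × ℝ => p.2 • h p.1) μ := hf.1.smul_bdd c hg' hbdd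
  have hi2 : Integrable (fun p : X × ℝ => f p.1 • h p.1) μ :=
    hf.integrable_coe.smul_bdd c hg' hbdd
  have h1 : μ[(Prod.snd : X × ℝ → ℝ) • (fun p : X × ℝ => h p.1) |
      MeasurableSpace.comap Prod.fst inferInstance]
      =ᵐ[μ] μ[(Prod.snd : X × ℝ → ℝ) | MeasurableSpace.comap Prod.fst inferInstance]
        • fun p : X × ℝ => h p.1 :=
    condExp_smul_of_aestronglyMeasurable_right hf.1 hi1 hg.aestronglyMeasurable
  have h2 : ∫ p, p.2 • h p.1 ∂μ = ∫ p, f p.1 • h p.1 ∂μ := by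
    calc ∫ p, p.2 • h p.1 ∂μ
        = ∫ p, (μ[(Prod.snd : X × ℝ → ℝ) • (fun p : X × ℝ => h p.1) |
            MeasurableSpace.comap Prod.fst inferInstance]) p ∂μ :=
          (integral_condExp hle).symm
      _ = ∫ p, f p.1 • h p.1 ∂μ := by
          refine integral_congr_ae ?_
          filter_upwards [h1, hf.2] with p hp hp2
          rw [hp, Pi.smul_apply', hp2]
  simp_rw [sub_smul]
  rw [integral_sub hi1 hi2, h2, sub_self]

/-- The weight may involve the `j`-th input as well as all the others. Freezing the other
observations by Fubini's theorem makes it a bounded function of that input, against which the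
residual integrates to zero. -/
theorem IsRegressionFunction.integral_pi_residual_smul (hf : IsRegressionFunction μ f) {m : ℕ}
    {ψ : (Fin m → X) → E} (hψ : StronglyMeasurable ψ) {c : ℝ} (hc : ∀ x, ‖ψ x‖ ≤ c) (j : Fin m) :
    ∫ D : Fin m → X × ℝ, ((D j).2 - f (D j).1) • ψ (fun k => (D k).1)
      ∂(Measure.pi fun _ => μ) = 0 := by
  obtain ⟨k, rfl⟩ : ∃ k, m = k + 1 := ⟨m - 1, by have := j.pos; omega⟩
  -- A nonintegrable product has integral `0` by convention, so Fubini's theorem is needed only in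
  -- the integrable case.
  by_cases hi : Integrable (fun D : Fin (k + 1) → X × ℝ =>
    ((D j).2 - f (D j).1) • ψ (fun i => (D i).1)) (Measure.pi fun _ => μ)
  swap
  · exact integral_undef hi
  have hmp := (measurePreserving_piFinSuccAbove (fun _ : Fin (k + 1) => μ) j).symm
  rw [← hmp.integral_comp']
  rw [← hmp.integrable_comp_emb (MeasurableEquiv.measurableEmbedding _)] at hi
  rw [integral_prod_symm _ (by exact hi)]
  refine integral_eq_zero_of_ae (Filter.Eventually.of_forall fun D' => ?_)
  have h1 : ∀ p : X × ℝ, (fun i => (((MeasurableEquiv.piFinSuccAbove (fun _ => X × ℝ) j).symm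
      (p, D')) i).1) = j.insertNth p.1 (fun i => (D' i).1) := by
    intro p
    refine funext fun i => ?_
    refine Fin.succAboveCases j ?_ (fun i => ?_) i <;>
    simp [MeasurableEquiv.piFinSuccAbove_symm_apply, Fin.insertNthEquiv]
  have h2 : ∀ p : X × ℝ, ((MeasurableEquiv.piFinSuccAbove (fun _ => X × ℝ) j).symm (p, D')) j
      = p := by
    intro p
    simp [MeasurableEquiv.piFinSuccAbove_symm_apply, Fin.insertNthEquiv]
  simp only [h1, h2, Pi.zero_apply]
  refine hf.integral_residual_smul (h := fun x => ψ (j.insertNth x fun i => (D' i).1)) ?_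
    (fun x => hc _)
  refine hψ.comp_measurable (measurable_pi_lambda _ fun i => ?_)
  refine Fin.succAboveCases j ?_ (fun i => ?_) i
  · simpa using measurable_id'
  · simp

end Residual

/-! ### Bias of the averaged ridge estimators -/

section Bias

variable {X H : Type*} [MeasurableSpace X] [NormedAddCommGroup H] [InnerProductSpace ℝ H]
  [CompleteSpace H] [TopologicalSpace.SeparableSpace H] [RKHS ℝ H X ℝ] {κ : ℝ}
  {μ : Measure (X × ℝ)} [IsProbabilityMeasure μ]

theorem integrable_rankOne_featureMap (hκ : 0 ≤ κ) (hK : KernelAssumptions H κ) :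
    Integrable (fun p : X × ℝ => rankOne ℝ (featureMap H p.1) (featureMap H p.1)) μ := by
  have hφ : StronglyMeasurable fun p : X × ℝ => featureMap H p.1 :=
    (stronglyMeasurable_featureMap hK).comp_measurable measurable_fst
  have hc : Continuous fun z : H => rankOne ℝ z z :=
    (rankOne ℝ).continuous.clm_apply continuous_id
  refine Integrable.of_bound (hc.comp_stronglyMeasurable hφ).aestronglyMeasurable (κ * κ)
    (Filter.Eventually.of_forall fun p => ?_)
  rw [norm_rankOne]
  have := norm_featureMap_le hκ hK p.1
  gcongr

theorem covariance_apply (hκ : 0 ≤ κ) (hK : KernelAssumptions H κ) (g : H) :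
    covariance H μ g = ∫ p, g p.1 • featureMap H p.1 ∂μ := by
  rw [covariance, ContinuousLinearMap.integral_apply (integrable_rankOne_featureMap hκ hK)]
  simp only [rankOne_apply, inner_featureMap]

theorem integrable_smul_featureMap (hκ : 0 ≤ κ) (hK : KernelAssumptions H κ) (g : H) :
    Integrable (fun p : X × ℝ => g p.1 • featureMap H p.1) μ := by
  have h := (integrable_rankOne_featureMap (μ := μ) hκ hK).apply_continuousLinearMap g
  simpa only [rankOne_apply, inner_featureMap] using h

theorem inner_covariance (hκ : 0 ≤ κ) (hK : KernelAssumptions H κ) (g h : H) :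
    inner ℝ (covariance H μ g) h = ∫ p, g p.1 * h p.1 ∂μ := by
  rw [covariance_apply hκ hK, real_inner_comm,
    ← integral_inner (integrable_smul_featureMap hκ hK g)]
  refine integral_congr_ae (Filter.Eventually.of_forall fun p => ?_)
  simp only [inner_smul_right]
  rw [real_inner_comm, inner_featureMap]

theorem isPositive_covariance (hκ : 0 ≤ κ) (hK : KernelAssumptions H κ) :
    (covariance H μ).IsPositive := by
  refine ⟨fun g h => ?_, fun g => ?_⟩
  · change inner ℝ (covariance H μ g) h = inner ℝ g (covariance H μ h)
    rw [inner_covariance hκ hK, real_inner_comm, inner_covariance hκ hK]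
    simp_rw [mul_comm]
  · change 0 ≤ inner ℝ (covariance H μ g) g
    rw [inner_covariance hκ hK]
    exact integral_nonneg fun p => mul_self_nonneg _

omit [TopologicalSpace.SeparableSpace H] in
theorem norm_covariance_le (hκ : 0 ≤ κ) (hK : KernelAssumptions H κ) :
    ‖covariance H μ‖ ≤ κ ^ 2 := by
  have h := norm_integral_le_of_norm_le_const (μ := μ) (C := κ * κ)
    (f := fun p : X × ℝ => rankOne ℝ (featureMap H p.1) (featureMap H p.1))
    (Filter.Eventually.of_forall fun p => by
      rw [norm_rankOne]
      have := norm_featureMap_le hκ hK p.1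
      gcongr)
  rw [covariance]
  simpa [sq] using h

theorem SourceCondition.norm_le (hκ : 0 ≤ κ) (hK : KernelAssumptions H κ) {r R : ℝ} (hr0 : 0 ≤ r)
    (hr1 : r ≤ 1) {f : H} (hf : SourceCondition μ r R f) : ‖f‖ ≤ max 1 (κ ^ 2) * R := by
  obtain ⟨h, hh, rfl⟩ := hf
  refine (norm_opPow_le (isPositive_covariance hκ hK) hr0 hr1 (norm_covariance_le hκ hK) h).trans ?_
  gcongr

/-- The closed form is dominated by `l⁻¹ κ` times the average of the `|y j|`, so a first moment of
the labels suffices. -/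
theorem integrable_ridge (hκ : 0 ≤ κ) (hK : KernelAssumptions H κ) {n : ℕ} (hn : 0 < n) {l : ℝ}
    (hl : 0 < l) (hμ : Integrable Prod.snd μ) :
    Integrable (fun D => ridge (⊤ : Submodule ℝ H) l D) (Measure.pi fun _ : Fin n => μ) := by
  have hi : Integrable (fun D : Fin n → X × ℝ => ∑ j, |(D j).2|)
      (Measure.pi fun _ : Fin n => μ) :=
    integrable_finsetSum _ fun j _ =>
      (measurePreserving_eval (fun _ : Fin n => μ) j).integrable_comp_of_integrable hμ.abs
  refine (hi.const_mul (l⁻¹ * (1 / (n : ℝ) * κ))).mono'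
    (stronglyMeasurable_ridge hK hn hl).aestronglyMeasurable
    (Filter.Eventually.of_forall fun D => ?_)
  rw [ridge_top_eq hn hl]
  refine (norm_regInv_le (isPositive_pointCov _) hl _).trans ?_
  rw [norm_smul, Real.norm_of_nonneg (by positivity), mul_assoc, mul_assoc, Finset.mul_sum]
  gcongr
  refine (norm_sum_le _ _).trans (Finset.sum_le_sum fun j _ => ?_)
  rw [norm_smul, mul_comm, Real.norm_eq_abs]
  gcongr
  exact norm_featureMap_le hκ hK _

/-- Replacing the labels by `f (x j)` changes the estimator by a sum of residuals weighted by
functions of the inputs alone, which has mean zero. -/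
theorem meanRidge_eq (hκ : 0 ≤ κ) (hK : KernelAssumptions H κ) {n : ℕ} (hn : 0 < n) {l : ℝ}
    (hl : 0 < l) {f : H} (hf : IsRegressionFunction μ f) :
    Integrable (fun D : Fin n → X × ℝ => regInv (pointCov fun j => featureMap H (D j).1) l
      (pointCov (fun j => featureMap H (D j).1) f)) (Measure.pi fun _ : Fin n => μ) ∧
    meanRidge H n l μ = ∫ D, regInv (pointCov fun j => featureMap H (D j).1) l
      (pointCov (fun j => featureMap H (D j).1) f) ∂(Measure.pi fun _ : Fin n => μ) := by
  have hφ : StronglyMeasurable fun x : X => featureMap H x := stronglyMeasurable_featureMap hK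
  have hψ : ∀ j, StronglyMeasurable fun x : Fin n → X =>
      regInv (pointCov fun j => featureMap H (x j)) l (featureMap H (x j)) := fun j => by
    have h5 : Continuous fun p : (H →L[ℝ] H) × H => p.1 p.2 :=
      isBoundedBilinearMap_apply.continuous
    have h6 : StronglyMeasurable fun x : Fin n → X => featureMap H (x j) :=
      hφ.comp_measurable (measurable_pi_apply j)
    exact h5.comp_stronglyMeasurable ((stronglyMeasurable_regInv_features hK hl).prodMk h6)
  have hb : ∀ (j : Fin n) (x : Fin n → X),
      ‖regInv (pointCov fun j => featureMap H (x j)) l (featureMap H (x j))‖ ≤ l⁻¹ * κ := by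
    intro j x
    refine (norm_regInv_le (isPositive_pointCov _) hl _).trans ?_
    gcongr
    exact norm_featureMap_le hκ hK _
  have hfst : Measurable fun (D : Fin n → X × ℝ) (j : Fin n) => (D j).1 :=
    measurable_pi_lambda _ fun j => measurable_fst.comp (measurable_pi_apply j)
  have hψi : ∀ j : Fin n, Integrable (fun D : Fin n → X × ℝ => ((D j).2 - f (D j).1) •
      regInv (pointCov fun j => featureMap H (D j).1) l (featureMap H (D j).1))
      (Measure.pi fun _ : Fin n => μ) := by
    intro j
    have h1 : Integrable (fun D : Fin n → X × ℝ => (D j).2 - f (D j).1)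
        (Measure.pi fun _ : Fin n => μ) :=
      (measurePreserving_eval (fun _ : Fin n => μ) j).integrable_comp_of_integrable
        (hf.1.sub hf.integrable_coe)
    exact h1.smul_bdd (l⁻¹ * κ) ((hψ j).comp_measurable hfst).aestronglyMeasurable
      (Filter.Eventually.of_forall fun D => hb j fun k => (D k).1)
  have hdiff : ∀ D : Fin n → X × ℝ, regInv (pointCov fun j => featureMap H (D j).1) l
      (pointCov (fun j => featureMap H (D j).1) f) = ridge (⊤ : Submodule ℝ H) l D
      - (1 / (n : ℝ)) • ∑ j, ((D j).2 - f (D j).1) •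
        regInv (pointCov fun j => featureMap H (D j).1) l (featureMap H (D j).1) := by
    intro D
    rw [ridge_top_eq hn hl, pointCov_apply, map_smul, map_smul, ← smul_sub, map_sum, map_sum,
      ← Finset.sum_sub_distrib]
    congr 1
    refine Finset.sum_congr rfl fun j _ => ?_
    rw [map_smul, map_smul, ← sub_smul, inner_featureMap]
    congr 1
    ring
  have hs : Integrable (fun D : Fin n → X × ℝ => (1 / (n : ℝ)) • ∑ j, ((D j).2 - f (D j).1) •
      regInv (pointCov fun j => featureMap H (D j).1) l (featureMap H (D j).1))
      (Measure.pi fun _ : Fin n => μ) := (integrable_finsetSum _ fun j _ => hψi j).smul _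
  have hr := integrable_ridge (μ := μ) hκ hK hn hl hf.1
  simp only [hdiff]
  refine ⟨hr.sub hs, ?_⟩
  rw [integral_sub hr hs, integral_smul, integral_finsetSum _ fun j _ => hψi j]
  have h0 : ∀ j : Fin n, ∫ D : Fin n → X × ℝ, ((D j).2 - f (D j).1) •
      regInv (pointCov fun j => featureMap H (D j).1) l (featureMap H (D j).1)
      ∂(Measure.pi fun _ : Fin n => μ) = 0 := fun j =>
    hf.integral_pi_residual_smul (hψ j) (hb j) j
  simp only [h0, Finset.sum_const_zero, smul_zero, sub_zero]
  rfl

theorem norm_meanRidge_le (hκ : 0 ≤ κ) (hK : KernelAssumptions H κ) {n : ℕ} (hn : 0 < n) {l : ℝ}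
    (hl : 0 < l) {f : H} (hf : IsRegressionFunction μ f) : ‖meanRidge H n l μ‖ ≤ ‖f‖ := by
  rw [(meanRidge_eq hκ hK hn hl hf).2]
  refine (norm_integral_le_of_norm_le_const (Filter.Eventually.of_forall fun D =>
    norm_regInv_apply_le (isPositive_pointCov _) hl f)).trans ?_
  simp

/-- Only the deviation at one fixed vector is needed, so this is the second moment of an average of
independent vectors of norm at most `κ² ‖g‖`. -/
theorem lintegral_pointCov_sub_covariance_sq_le (hκ : 0 ≤ κ) (hK : KernelAssumptions H κ) {n : ℕ}
    (hn : 0 < n) (g : H) :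
    ∫⁻ D, ‖pointCov (fun j => featureMap H (D j).1) g - covariance H μ g‖ₑ ^ 2
      ∂(Measure.pi fun _ : Fin n => μ) ≤ ENNReal.ofReal (κ ^ 2 * ‖g‖ / √n) ^ 2 := by
  have hn' : (0 : ℝ) < n := by exact_mod_cast hn
  have hbd : ∀ p : X × ℝ, ‖g p.1 • featureMap H p.1‖ ≤ κ ^ 2 * ‖g‖ := by
    intro p
    rw [norm_smul, Real.norm_eq_abs]
    calc |g p.1| * ‖featureMap H p.1‖ ≤ (κ * ‖g‖) * κ := by
          gcongr
          · exact abs_apply_le hκ hK g _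
          · exact norm_featureMap_le hκ hK _
      _ = _ := by ring
  have hmem : MemLp (fun p : X × ℝ => g p.1 • featureMap H p.1) 2 μ :=
    MemLp.of_bound (integrable_smul_featureMap hκ hK g).1 _ (Filter.Eventually.of_forall hbd)
  have h1 := lintegral_enorm_sum_sub_integral_sq_le (fun _ : Fin n => μ)
    (ξ := fun _ p => g p.1 • featureMap H p.1) fun _ => hmem
  have h2 : ∀ D : Fin n → X × ℝ,
      ‖pointCov (fun j => featureMap H (D j).1) g - covariance H μ g‖ₑ ^ 2
      = ENNReal.ofReal (1 / (n : ℝ)) ^ 2 * ‖∑ i, (g (D i).1 • featureMap H (D i).1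
        - ∫ p, g p.1 • featureMap H p.1 ∂μ)‖ₑ ^ 2 := by
    intro D
    have h3 : pointCov (fun j => featureMap H (D j).1) g - covariance H μ g
        = (1 / (n : ℝ)) • ∑ i, (g (D i).1 • featureMap H (D i).1
          - ∫ p, g p.1 • featureMap H p.1 ∂μ) := by
      rw [pointCov_apply, covariance_apply hκ hK, Finset.sum_sub_distrib, smul_sub]
      simp only [inner_featureMap, Finset.sum_const, Finset.card_univ, Fintype.card_fin]
      rw [← Nat.cast_smul_eq_nsmul ℝ, smul_smul, one_div_mul_cancel hn'.ne', one_smul]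
    rw [h3, enorm_smul, mul_pow, Real.enorm_eq_ofReal (by positivity)]
  simp only [h2]
  rw [lintegral_const_mul' _ _ (by simp)]
  have h4 : ∫⁻ p : X × ℝ, ‖g p.1 • featureMap H p.1‖ₑ ^ 2 ∂μ
      ≤ ENNReal.ofReal (κ ^ 2 * ‖g‖) ^ 2 := by
    calc ∫⁻ p : X × ℝ, ‖g p.1 • featureMap H p.1‖ₑ ^ 2 ∂μ
        ≤ ∫⁻ _, ENNReal.ofReal (κ ^ 2 * ‖g‖) ^ 2 ∂μ := by
          refine lintegral_mono fun p => ?_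
          rw [← ofReal_norm]
          gcongr
          exact hbd p
      _ = _ := by simp
  calc ENNReal.ofReal (1 / (n : ℝ)) ^ 2 * ∫⁻ D : Fin n → X × ℝ, ‖∑ i, (g (D i).1 •
        featureMap H (D i).1 - ∫ p, g p.1 • featureMap H p.1 ∂μ)‖ₑ ^ 2
          ∂(Measure.pi fun _ : Fin n => μ)
      ≤ ENNReal.ofReal (1 / (n : ℝ)) ^ 2 * (n * ENNReal.ofReal (κ ^ 2 * ‖g‖) ^ 2) := by
        gcongr
        refine h1.trans ((Finset.sum_le_card_nsmul _ _ _ fun i _ => h4).trans ?_)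
        simp
    _ = ENNReal.ofReal (κ ^ 2 * ‖g‖ / √n) ^ 2 := by
        rw [← ENNReal.ofReal_natCast, ← ENNReal.ofReal_pow (by positivity),
          ← ENNReal.ofReal_pow (by positivity), ← ENNReal.ofReal_mul (by positivity),
          ← ENNReal.ofReal_mul (by positivity), ← ENNReal.ofReal_pow (by positivity)]
        congr 1
        rw [div_pow (κ ^ 2 * ‖g‖), Real.sq_sqrt hn'.le]
        field_simp

theorem norm_meanRidge_sub_le (hκ : 0 ≤ κ) (hK : KernelAssumptions H κ) {n : ℕ} (hn : 0 < n)
    {l r R : ℝ} (hl : 0 < l) (hr0 : 0 ≤ r) (hr1 : r ≤ 1) {f : H} (hf : IsRegressionFunction μ f)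
    (hs : SourceCondition μ r R f) :
    ‖meanRidge H n l μ - f‖ ≤ R * l ^ r * (1 + κ ^ 2 / (l * √n)) := by
  have hn' : (0 : ℝ) < n := by exact_mod_cast hn
  obtain ⟨hint, hmean⟩ := meanRidge_eq hκ hK hn hl hf
  have hcov := isPositive_covariance (μ := μ) hκ hK
  set g := regInv (covariance H μ) l f with hg
  have hgle : ‖g‖ ≤ l ^ (r - 1) * R := by
    obtain ⟨h, hh, rfl⟩ := hs
    refine (norm_regInv_opPow_le hcov hr0 hr1 hl h).trans ?_
    gcongr
  set S : (Fin n → X × ℝ) → H →L[ℝ] H := fun D => pointCov fun j => featureMap H (D j).1 with hS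
  have hpos : ∀ D, (S D).IsPositive := fun D => isPositive_pointCov _
  -- Since `f - l • g = Σ g`, this resolvent identity trades the bias for the covariance fluctuation
  -- at the deterministic vector `g`; the factor `l` cancels the norm `l⁻¹` of the resolvent.
  have hu : ∀ D, f - l • g - regInv (S D) l (S D f) =
      l • regInv (S D) l ((covariance H μ g) - S D g) := by
    intro D
    have h1 : f = covariance H μ g + l • g := (add_apply_regInv hcov hl f).symm
    have h2 := regInv_apply_add (hpos D) hl g
    have h3 : covariance H μ g - S D g = f - (S D g + l • g) := by
      rw [eq_sub_of_add_eq h1.symm]; abel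
    rw [h3, map_sub, h2, apply_regInv_comm (hpos D) hl, smul_sub]
    abel
  have hmeas : AEStronglyMeasurable (fun D => f - l • g - regInv (S D) l (S D f))
      (Measure.pi fun _ : Fin n => μ) := ((integrable_const _).sub hint).1
  have h1 : ‖∫ D, (f - l • g - regInv (S D) l (S D f)) ∂(Measure.pi fun _ : Fin n => μ)‖ₑ
      ≤ ENNReal.ofReal (κ ^ 2 * ‖g‖ / √n) := by
    refine enorm_integral_le_of_lintegral_sq_le hmeas ?_
    refine le_trans (lintegral_mono fun D => ?_)
      (lintegral_pointCov_sub_covariance_sq_le (μ := μ) hκ hK hn g)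
    rw [hu]
    gcongr
    rw [← ofReal_norm, ← ofReal_norm]
    refine ENNReal.ofReal_le_ofReal ?_
    rw [norm_smul, Real.norm_of_nonneg hl.le, norm_sub_rev (S D g)]
    have h2 := norm_regInv_le (hpos D) hl (covariance H μ g - S D g)
    rwa [inv_mul_eq_div, le_div_iff₀ hl, mul_comm] at h2
  rw [integral_sub (integrable_const _) hint, ← hmean] at h1
  simp only [integral_const, probReal_univ, one_smul] at h1
  rw [← ofReal_norm, ENNReal.ofReal_le_ofReal_iff (by positivity)] at h1
  have h2 : meanRidge H n l μ - f = -(f - l • g - meanRidge H n l μ) - l • g := by abel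
  rw [h2]
  refine (norm_sub_le _ _).trans ?_
  rw [norm_neg, norm_smul, Real.norm_of_nonneg hl.le]
  have h3 : l * l ^ (r - 1) = l ^ r := by
    nth_rewrite 1 [← Real.rpow_one l]
    rw [← Real.rpow_add hl]
    congr 1
    ring
  calc ‖f - l • g - meanRidge H n l μ‖ + l * ‖g‖
      ≤ κ ^ 2 * (l ^ (r - 1) * R) / √n + l * (l ^ (r - 1) * R) := by
        refine add_le_add (h1.trans ?_) ?_ <;> gcongr
    _ = R * l ^ r * (1 + κ ^ 2 / (l * √n)) := by
        have : 0 < √(n : ℝ) := Real.sqrt_pos.2 hn'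
        rw [← h3]
        field_simp
        ring

theorem hsNorm_taskCov_meanRidge_sub_le (hκ : 0 ≤ κ) (hK : KernelAssumptions H κ) {N n : ℕ}
    (hn : 0 < n) {l r R : ℝ} (hl : 0 < l) (hr0 : 0 ≤ r) (hr1 : r ≤ 1)
    (μ : Fin N → Measure (X × ℝ)) [∀ i, IsProbabilityMeasure (μ i)] (f : Fin N → H)
    (hf : ∀ i, IsRegressionFunction (μ i) (f i)) (hs : ∀ i, SourceCondition (μ i) r R (f i)) :
    hsNorm (taskCov (fun i => meanRidge H n l (μ i)) - taskCov f)
      ≤ ENNReal.ofReal (2 * R ^ 2 * max 1 (κ ^ 2) ^ 2 * l ^ r * (1 + 1 / (l * √n))) := by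
  -- Without tasks both task operators are zero.
  rcases Nat.eq_zero_or_pos N with rfl | hN
  · simp [taskCov, hsNorm_zero]
  have hN' : (0 : ℝ) < N := by exact_mod_cast hN
  set b := 2 * R ^ 2 * max 1 (κ ^ 2) ^ 2 * l ^ r * (1 + 1 / (l * √n)) with hb
  have hterm : ∀ i, hsNorm (rankOne ℝ (meanRidge H n l (μ i)) (meanRidge H n l (μ i))
      - rankOne ℝ (f i) (f i)) ≤ ENNReal.ofReal b := by
    intro i
    refine (hsNorm_rankOne_sub_le _ _).trans (ENNReal.ofReal_le_ofReal ?_)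
    have h1 := norm_meanRidge_sub_le hκ hK hn hl hr0 hr1 (hf i) (hs i)
    have h2 := norm_meanRidge_le hκ hK hn hl (hf i)
    have h3 := (hs i).norm_le hκ hK hr0 hr1
    have hR : 0 ≤ R := by
      obtain ⟨h, hh, -⟩ := hs i
      exact (norm_nonneg h).trans hh
    set M := max 1 (κ ^ 2) with hM
    have hM1 : 1 ≤ M := le_max_left _ _
    have hMκ : κ ^ 2 ≤ M := le_max_right _ _
    have h4 : 1 + κ ^ 2 / (l * √n) ≤ M * (1 + 1 / (l * √n)) := by
      rw [mul_add, mul_one, mul_one_div]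
      gcongr
    calc ‖meanRidge H n l (μ i) - f i‖ * (‖meanRidge H n l (μ i)‖ + ‖f i‖)
        ≤ (R * l ^ r * (M * (1 + 1 / (l * √n)))) * (M * R + M * R) := by
          gcongr
          · exact h1.trans (by gcongr)
          · exact h2.trans h3
      _ = b := by rw [hb]; ring
  rw [taskCov, taskCov, ← smul_sub, ← Finset.sum_sub_distrib, hsNorm_smul,
    Real.enorm_eq_ofReal (by positivity)]
  calc ENNReal.ofReal (1 / (N : ℝ)) * hsNorm (∑ i, (rankOne ℝ (meanRidge H n l (μ i))
        (meanRidge H n l (μ i)) - rankOne ℝ (f i) (f i)))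
      ≤ ENNReal.ofReal (1 / (N : ℝ)) * (N * ENNReal.ofReal b) := by
        gcongr
        refine (hsNorm_sum_le _ _).trans ((Finset.sum_le_card_nsmul _ _ _
          fun i _ => hterm i).trans ?_)
        simp
    _ = ENNReal.ofReal b := by
        rw [← mul_assoc, ← ENNReal.ofReal_natCast, ← ENNReal.ofReal_mul (by positivity),
          one_div_mul_cancel hN'.ne', ENNReal.ofReal_one, one_mul]

end Bias

/-! ### Perturbation of the span of the top right singular vectors -/

section Perturbation

variable {H : Type*} [NormedAddCommGroup H] [InnerProductSpace ℝ H] [CompleteSpace H]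

/-- If `A` is `Δ`-close to an operator of rank at most `s`, then `A` is bounded by `Δ` on the
orthogonal complement of its top `s` right singular vectors. -/
theorem IsTopRightSingular.norm_apply_le {s : ℕ} {A C : H →L[ℝ] H} {v : Fin s → H}
    (hv : IsTopRightSingular A v) {V : Submodule ℝ H} [FiniteDimensional ℝ V]
    (hV : Module.finrank ℝ V ≤ s) (hC : ∀ x, C x ∈ V) {Δ : ℝ} (hΔ : 0 ≤ Δ)
    (hAC : ∀ x, ‖A x - C x‖ ≤ Δ * ‖x‖) {w : H} (hw : ∀ j, inner ℝ (v j) w = 0) :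
    ‖A w‖ ≤ Δ * ‖w‖ := by
  obtain ⟨hon, σ, hσ, htop⟩ := hv
  rcases eq_or_ne w 0 with rfl | hw0
  · simp
  have hwpos : 0 < ‖w‖ := norm_pos_iff.2 hw0
  -- `U` parametrizes the span of the `v j` and `w` by `s + 1` coefficients. As `C` has rank at most
  -- `s`, some nonzero combination is annihilated by `C`, and there `A` is bounded by `Δ`.
  let U : (Fin s → ℝ) × ℝ →ₗ[ℝ] H :=
    (Fintype.linearCombination ℝ v).coprod (LinearMap.toSpanSingleton ℝ H w)
  have hU : ∀ p, U p = ∑ j, p.1 j • v j + p.2 • w := fun p => by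
    simp [U, Fintype.linearCombination_apply]
  let L : (Fin s → ℝ) × ℝ →ₗ[ℝ] V := ((C : H →ₗ[ℝ] H).comp U).codRestrict V fun p => hC _
  have hker : LinearMap.ker L ≠ ⊥ := by
    refine LinearMap.ker_ne_bot_of_finrank_lt ?_
    simp only [Module.finrank_prod, Module.finrank_fin_fun, Module.finrank_self]
    omega
  obtain ⟨p, hp, hp0⟩ := Submodule.exists_mem_ne_zero_of_ne_bot hker
  have hCu : C (U p) = 0 := by
    have := congrArg Subtype.val (LinearMap.mem_ker.1 hp)
    simpa [L] using this
  have hw' : ∀ j, inner ℝ w (v j) = 0 := fun j => by rw [real_inner_comm]; exact hw j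
  have hvu : ∀ j, inner ℝ (v j) (U p) = p.1 j := by
    intro j
    rw [hU, inner_add_right, inner_smul_right, hw, hon.inner_right_fintype]
    simp
  have hwu : inner ℝ w (U p) = p.2 * ‖w‖ ^ 2 := by
    rw [hU, inner_add_right, inner_smul_right, inner_sum, real_inner_self_eq_norm_sq]
    simp [inner_smul_right, hw']
  have hAwu : inner ℝ (A w) (A (U p)) = p.2 * ‖A w‖ ^ 2 := by
    have h1 : ∀ j, inner ℝ (A w) (A (v j)) = 0 := fun j => by
      rw [← ContinuousLinearMap.adjoint_inner_right, (hσ j).2, inner_smul_right, hw', mul_zero]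
    rw [hU, map_add, map_sum, map_smul, inner_add_right, inner_sum, inner_smul_right,
      real_inner_self_eq_norm_sq]
    simp [inner_smul_right, h1]
  have hAvu : ∀ j, inner ℝ (A (v j)) (A (U p)) = σ j ^ 2 * p.1 j := fun j => by
    rw [← ContinuousLinearMap.adjoint_inner_left, (hσ j).2, inner_smul_left, hvu]
    simp
  have hnu : ‖U p‖ ^ 2 = ∑ j, p.1 j ^ 2 + p.2 ^ 2 * ‖w‖ ^ 2 := by
    rw [← real_inner_self_eq_norm_sq]
    nth_rewrite 1 [hU]
    rw [inner_add_left, sum_inner, inner_smul_left, hwu]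
    simp only [inner_smul_left, hvu, conj_trivial]
    congr 1
    · exact Finset.sum_congr rfl fun j _ => by ring
    · ring
  have hnAu : ‖A (U p)‖ ^ 2 = ∑ j, σ j ^ 2 * p.1 j ^ 2 + p.2 ^ 2 * ‖A w‖ ^ 2 := by
    rw [← real_inner_self_eq_norm_sq]
    have h1 : A (U p) = ∑ j, p.1 j • A (v j) + p.2 • A w := by
      rw [hU]; simp
    nth_rewrite 1 [h1]
    rw [inner_add_left, sum_inner, inner_smul_left, hAwu]
    simp only [inner_smul_left, hAvu, conj_trivial]
    congr 1
    · exact Finset.sum_congr rfl fun j _ => by ring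
    · ring
  have hupos : 0 < ‖U p‖ ^ 2 := by
    by_contra hcon
    have h0 : ‖U p‖ ^ 2 = 0 := le_antisymm (not_lt.1 hcon) (sq_nonneg _)
    have hu0 : U p = 0 := by simpa using h0
    refine hp0 (Prod.ext (funext fun j => ?_) ?_)
    · rw [← hvu, hu0, inner_zero_right]; rfl
    · have h2 : p.2 * ‖w‖ ^ 2 = 0 := by rw [← hwu, hu0, inner_zero_right]
      simpa [hw0] using h2
  -- The images of the `v j` and of `w` under `A` are orthogonal and `w` is the direction of least
  -- stretching, so `A` stretches the combination `U p` at least as much as it stretches `w`.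
  have h1 : ‖A w‖ ^ 2 * ‖U p‖ ^ 2 ≤ ‖A (U p)‖ ^ 2 * ‖w‖ ^ 2 := by
    rw [hnu, hnAu, mul_add, add_mul, Finset.mul_sum, Finset.sum_mul]
    refine add_le_add (Finset.sum_le_sum fun j _ => ?_) (le_of_eq (by ring))
    have h2 := pow_le_pow_left₀ (norm_nonneg _) (htop w hw j) 2
    nlinarith [mul_le_mul_of_nonneg_right h2 (sq_nonneg (p.1 j))]
  have h2 : ‖A (U p)‖ ^ 2 ≤ Δ ^ 2 * ‖U p‖ ^ 2 := by
    have h3 := hAC (U p)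
    rw [hCu, sub_zero] at h3
    rw [← mul_pow]
    exact pow_le_pow_left₀ (norm_nonneg _) h3 2
  refine le_of_sq_le_sq ?_ (by positivity)
  refine le_of_mul_le_mul_right (h1.trans ?_) hupos
  nlinarith [mul_le_mul_of_nonneg_right h2 (sq_nonneg ‖w‖)]

omit [CompleteSpace H] in
theorem taskCov_apply {N : ℕ} (f : Fin N → H) (g : H) :
    taskCov f g = (1 / (N : ℝ)) • ∑ i, inner ℝ (f i) g • f i := by
  simp [taskCov]

omit [CompleteSpace H] in
theorem isSymmetric_taskCov {N : ℕ} (f : Fin N → H) :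
    (taskCov f : H →ₗ[ℝ] H).IsSymmetric := by
  intro x y
  simp only [ContinuousLinearMap.coe_coe, taskCov_apply, inner_smul_left, inner_smul_right,
    sum_inner, inner_sum, conj_trivial]
  congr 1
  refine Finset.sum_congr rfl fun i _ => ?_
  rw [real_inner_comm x (f i)]
  ring

omit [CompleteSpace H] in
theorem taskCov_mem_span {N : ℕ} (f : Fin N → H) (g : H) :
    taskCov f g ∈ Submodule.span ℝ (Set.range f) := by
  rw [taskCov_apply]
  exact Submodule.smul_mem _ _ (Submodule.sum_mem _ fun i _ =>
    Submodule.smul_mem _ _ (Submodule.subset_span ⟨i, rfl⟩))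

-- `⟨taskCov f g, g⟩` is the average of the `⟨f i, g⟩ ^ 2`, so `g` is orthogonal to the span that
-- contains it.
omit [CompleteSpace H] in
theorem eq_zero_of_taskCov_eq_zero {N : ℕ} (hN : 0 < N) (f : Fin N → H) {g : H}
    (hg : g ∈ Submodule.span ℝ (Set.range f)) (h : taskCov f g = 0) : g = 0 := by
  have hN' : (0 : ℝ) < 1 / N := by positivity
  have h1 : inner ℝ (taskCov f g) g = 0 := by rw [h, inner_zero_left]
  rw [taskCov_apply, inner_smul_left, sum_inner] at h1
  have h2 : ∑ i, inner ℝ (f i) g ^ 2 = 0 := by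
    have h3 := (mul_eq_zero.1 h1).resolve_left (by simpa using hN.ne')
    rw [← h3]
    refine Finset.sum_congr rfl fun i _ => ?_
    rw [inner_smul_left, conj_trivial, sq]
  rw [Finset.sum_eq_zero_iff_of_nonneg fun i _ => sq_nonneg _] at h2
  have h3 : ∀ i, inner ℝ (f i) g = 0 := fun i => by simpa using h2 i (Finset.mem_univ i)
  have h4 : g ∈ (Submodule.span ℝ (Set.range f))ᗮ := by
    rw [Submodule.mem_orthogonal]
    intro u hu
    refine Submodule.span_induction (p := fun u _ => inner ℝ u g = 0) ?_ (inner_zero_left _)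
      ?_ ?_ hu
    · rintro _ ⟨i, rfl⟩; exact h3 i
    · intro x y _ _ hx hy; rw [inner_add_left, hx, hy, add_zero]
    · intro c x _ hx; rw [inner_smul_left, hx, mul_zero]
  exact inner_self_eq_zero.1 (Submodule.inner_right_of_mem_orthogonal hg h4)

omit [CompleteSpace H] in
/-- A lower bound for the nonzero eigenvalues bounds the inverse on the range. -/
theorem exists_taskCov_eq {N : ℕ} (hN : 0 < N) (f : Fin N → H) {γ : ℝ} (hγ : 0 < γ)
    (hgap : ∀ t : ℝ, t ≠ 0 → Module.End.HasEigenvalue (taskCov f : H →ₗ[ℝ] H) t → γ ≤ t) {x : H}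
    (hx : x ∈ Submodule.span ℝ (Set.range f)) : ∃ g, taskCov f g = x ∧ γ * ‖g‖ ≤ ‖x‖ := by
  set V := Submodule.span ℝ (Set.range f) with hV
  have : FiniteDimensional ℝ V := FiniteDimensional.span_of_finite ℝ (Set.finite_range f)
  have hmaps : ∀ g ∈ V, (taskCov f : H →ₗ[ℝ] H) g ∈ V := fun g _ => taskCov_mem_span f g
  -- On the finite dimensional span the task operator is symmetric and injective, hence bijective.
  -- Its eigenvalues there are nonzero eigenvalues of `taskCov f`, so they are at least `γ`.
  set T : V →ₗ[ℝ] V := (taskCov f : H →ₗ[ℝ] H).restrict hmaps with hT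
  have hTc : ∀ g : V, ((T g : V) : H) = taskCov f (g : H) := fun g => rfl
  have hsymm : T.IsSymmetric := (isSymmetric_taskCov f).restrict_invariant hmaps
  have hinj : Function.Injective T := by
    rw [injective_iff_map_eq_zero]
    intro g hg
    refine Subtype.ext (eq_zero_of_taskCov_eq_zero hN f g.2 ?_)
    rw [← hTc, hg]; rfl
  obtain ⟨g, hg⟩ := LinearMap.surjective_of_injective hinj ⟨x, hx⟩
  refine ⟨g, by rw [← hTc, hg], ?_⟩
  set e := hsymm.eigenvectorBasis rfl with he
  have hev : ∀ i, γ ≤ hsymm.eigenvalues rfl i := by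
    intro i
    have h1 : T (e i) = hsymm.eigenvalues rfl i • e i :=
      hsymm.apply_eigenvectorBasis rfl i
    have hne : e i ≠ 0 := e.orthonormal.ne_zero i
    refine hgap _ (fun h0 => hne (hinj ?_)) ?_
    · rw [h1, h0, zero_smul, map_zero]
    · refine Module.End.hasEigenvalue_of_hasEigenvector (x := ((e i : V) : H)) ⟨?_, ?_⟩
      · rw [Module.End.mem_eigenspace_iff]
        have h2 := congrArg Subtype.val h1
        rw [hTc] at h2
        exact h2
      · simpa using hne
  have h1 : γ ^ 2 * ‖g‖ ^ 2 ≤ ‖T g‖ ^ 2 := by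
    rw [← e.sum_sq_norm_inner_right, ← e.sum_sq_norm_inner_right, Finset.mul_sum]
    refine Finset.sum_le_sum fun i _ => ?_
    have h2 : inner ℝ (e i) (T g) = hsymm.eigenvalues rfl i * inner ℝ (e i) g := by
      rw [← hsymm (e i) g]
      have h1 : T (e i) = hsymm.eigenvalues rfl i • e i :=
        hsymm.apply_eigenvectorBasis rfl i
      rw [h1, inner_smul_left, conj_trivial]
    rw [h2, norm_mul, mul_pow, Real.norm_of_nonneg (hγ.le.trans (hev i))]
    gcongr
    exact hev i
  have h2 : γ * ‖g‖ ≤ ‖T g‖ := by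
    refine le_of_sq_le_sq ?_ (norm_nonneg _)
    rw [mul_pow]; exact h1
  rw [hg] at h2
  exact h2

/-- Let `q` be the part of `x` orthogonal to the singular vectors. `A`, and therefore `taskCov f`,
is small on `q`; writing `x = taskCov f g` gives `‖q‖² = ⟨q, x⟩ = ⟨taskCov f q, g⟩`. No relation
between `Δ` and `γ` is required. -/
theorem IsTopRightSingular.norm_sub_starProjection_le {N s : ℕ} (hN : 0 < N) (f : Fin N → H)
    {γ : ℝ} (hγ : 0 < γ)
    (hgap : ∀ t : ℝ, t ≠ 0 → Module.End.HasEigenvalue (taskCov f : H →ₗ[ℝ] H) t → γ ≤ t) {x : H}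
    (hx : x ∈ Submodule.span ℝ (Set.range f))
    (hs : Module.finrank ℝ (Submodule.span ℝ (Set.range f)) = s) {A : H →L[ℝ] H} {v : Fin s → H}
    (hv : IsTopRightSingular A v) {Δ : ℝ} (hΔ : 0 ≤ Δ)
    (hA : ∀ x, ‖A x - taskCov f x‖ ≤ Δ * ‖x‖) {W : Submodule ℝ H} [W.HasOrthogonalProjection]
    (hW : W = Submodule.span ℝ (Set.range v)) :
    ‖x - W.starProjection x‖ ≤ 2 * Δ * ‖x‖ / γ := by
  have : FiniteDimensional ℝ (Submodule.span ℝ (Set.range f)) :=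
    FiniteDimensional.span_of_finite ℝ (Set.finite_range f)
  obtain ⟨g, hg, hgn⟩ := exists_taskCov_eq hN f hγ hgap hx
  set q := x - W.starProjection x with hq
  have hq1 : q ∈ Wᗮ := W.sub_starProjection_mem_orthogonal x
  have hqv : ∀ j, inner ℝ (v j) q = 0 := fun j =>
    Submodule.inner_right_of_mem_orthogonal (by rw [hW]; exact Submodule.subset_span ⟨j, rfl⟩) hq1
  have h1 : ‖A q‖ ≤ Δ * ‖q‖ := hv.norm_apply_le hs.le (taskCov_mem_span f) hΔ hA hqv
  have h2 : ‖taskCov f q‖ ≤ 2 * Δ * ‖q‖ := by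
    have h3 := hA q
    have h4 := norm_sub_le (A q) (A q - taskCov f q)
    rw [sub_sub_cancel] at h4
    linarith
  have h5 : ‖q‖ ^ 2 = inner ℝ (taskCov f q) g := by
    have h6 : inner ℝ (taskCov f q) g = inner ℝ q (taskCov f g) := isSymmetric_taskCov f q g
    have h7 : inner ℝ q (W.starProjection x) = 0 :=
      Submodule.inner_left_of_mem_orthogonal (W.starProjection_apply_mem x) hq1
    have h8 : x = q + W.starProjection x := by rw [hq]; abel
    have h9 : inner ℝ q x = inner ℝ q (q + W.starProjection x) := congrArg _ h8
    rw [h6, hg, h9, inner_add_right, h7, real_inner_self_eq_norm_sq, add_zero]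
  have h6 : ‖q‖ ^ 2 ≤ 2 * Δ * ‖q‖ * ‖g‖ := by
    rw [h5]
    exact (real_inner_le_norm _ _).trans (by gcongr)
  rw [le_div_iff₀ hγ]
  rcases (norm_nonneg q).eq_or_lt with h0 | h0
  · rw [← h0]; simp only [zero_mul]; positivity
  · have h7 : ‖q‖ ≤ 2 * Δ * ‖g‖ := by
      refine le_of_mul_le_mul_right ?_ h0
      nlinarith
    calc ‖q‖ * γ ≤ 2 * Δ * ‖g‖ * γ := by gcongr
      _ = 2 * Δ * (γ * ‖g‖) := by ring
      _ ≤ _ := by gcongr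

end Perturbation

/-! ### Concentration of the empirical task operator -/

section Source

theorem measurePreserving_finAppend {Ω : Type*} [MeasurableSpace Ω] (μ : Measure Ω)
    [IsProbabilityMeasure μ] (m n : ℕ) :
    MeasurePreserving (fun p : (Fin m → Ω) × (Fin n → Ω) => Fin.append p.1 p.2)
      ((Measure.pi fun _ => μ).prod (Measure.pi fun _ => μ)) (Measure.pi fun _ => μ) := by
  have hmeas : Measurable fun p : (Fin m → Ω) × (Fin n → Ω) => Fin.append p.1 p.2 := by
    refine measurable_pi_lambda _ fun i => ?_
    refine Fin.addCases (fun i => ?_) (fun i => ?_) i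
    · simp only [Fin.append_left]; exact (measurable_pi_apply i).comp measurable_fst
    · simp only [Fin.append_right]; exact (measurable_pi_apply i).comp measurable_snd
  refine ⟨hmeas, (Measure.pi_eq fun s hs => ?_).symm⟩
  rw [Measure.map_apply hmeas (MeasurableSet.univ_pi hs)]
  have hpre : (fun p : (Fin m → Ω) × (Fin n → Ω) => Fin.append p.1 p.2) ⁻¹' Set.univ.pi s
      = (Set.univ.pi fun i => s (Fin.castAdd n i)) ×ˢ
        (Set.univ.pi fun i => s (Fin.natAdd m i)) := by
    ext p
    simp only [Set.mem_preimage, Set.mem_pi, Set.mem_univ, true_implies, Set.mem_prod,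
      Fin.forall_fin_add, Fin.append_left, Fin.append_right]
  rw [hpre, Measure.prod_prod, Measure.pi_pi, Measure.pi_pi, Fin.prod_univ_add]

/-- This is the purpose of sample splitting: the two halves are independent, so the mean of the
product is the product of the means. -/
theorem integral_pi_inner_smul {Ω H : Type*} [MeasurableSpace Ω] [NormedAddCommGroup H]
    [InnerProductSpace ℝ H] [CompleteSpace H] (μ : Measure Ω) [IsProbabilityMeasure μ] {n : ℕ}
    {g : (Fin n → Ω) → H} (hg : StronglyMeasurable g)
    (hgi : Integrable g (Measure.pi fun _ => μ)) (e : H) :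
    ∫ D : Fin (n + n) → Ω, (inner ℝ e (g fun j => D (Fin.natAdd n j)) : ℝ) •
        g (fun j => D (Fin.castAdd n j)) ∂(Measure.pi fun _ => μ)
      = (inner ℝ e (∫ D, g D ∂(Measure.pi fun _ => μ)) : ℝ) •
        ∫ D, g D ∂(Measure.pi fun _ => μ) := by
  have hmp := measurePreserving_finAppend μ n n
  have hl : StronglyMeasurable fun D : Fin (n + n) → Ω => g fun j => D (Fin.castAdd n j) :=
    hg.comp_measurable (measurable_pi_lambda _ fun j => measurable_pi_apply _)
  have hr : StronglyMeasurable fun D : Fin (n + n) → Ω => g fun j => D (Fin.natAdd n j) :=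
    hg.comp_measurable (measurable_pi_lambda _ fun j => measurable_pi_apply _)
  have hF : StronglyMeasurable fun D : Fin (n + n) → Ω =>
      (inner ℝ e (g fun j => D (Fin.natAdd n j)) : ℝ) • g fun j => D (Fin.castAdd n j) :=
    ((innerSL ℝ e).continuous.comp_stronglyMeasurable hr).smul hl
  rw [← hmp.map_eq, integral_map hmp.measurable.aemeasurable hF.aestronglyMeasurable]
  simp only [Fin.append_left, Fin.append_right]
  rw [← integral_prod_swap]
  simp only [Prod.fst_swap, Prod.snd_swap]
  have h := integral_prod_smul (μ := Measure.pi fun _ : Fin n => μ)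
    (ν := Measure.pi fun _ : Fin n => μ) (fun D => inner ℝ e (g D)) g
  rw [integral_inner hgi] at h
  exact h

variable {X H : Type*} [MeasurableSpace X] [NormedAddCommGroup H] [InnerProductSpace ℝ H]
  [CompleteSpace H] [TopologicalSpace.SeparableSpace H] [RKHS ℝ H X ℝ] {κ : ℝ}

theorem ae_pi_abs_le {ι : Type*} [Fintype ι] {μ : Measure (X × ℝ)} [IsProbabilityMeasure μ] {B : ℝ}
    (hB : ∀ᵐ p ∂μ, |p.2| ≤ B) : ∀ᵐ D ∂(Measure.pi fun _ : ι => μ), ∀ j, |(D j).2| ≤ B :=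
  ae_all_iff.2 fun j =>
    (measurePreserving_eval (fun _ : ι => μ) j).quasiMeasurePreserving.ae hB

omit [MeasurableSpace X] [TopologicalSpace.SeparableSpace H] in
theorem norm_ridge_top_sq_le {m : ℕ} (hm : 0 < m) {l : ℝ} (hl : 0 < l) {D : Fin m → X × ℝ} {B : ℝ}
    (hB : ∀ j, |(D j).2| ≤ B) : ‖ridge (⊤ : Submodule ℝ H) l D‖ ^ 2 ≤ B ^ 2 / l := by
  have : CompleteSpace (⊤ : Submodule ℝ H) := isClosed_univ.isComplete.completeSpace_coe
  exact (isRidge_ridge hm ⊤ hl D).norm_sq_le hm hl hB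

/-- Evaluated at each basis vector, the deviation is an average of `N` independent centred vectors.
Summing their second moments over the basis gives the Hilbert-Schmidt norm. -/
theorem lintegral_hsNorm_empTaskCov_sub_sq_le (hκ : 0 ≤ κ) (hK : KernelAssumptions H κ) {N n : ℕ}
    (hN : 0 < N) (hn : 0 < n) {l B : ℝ} (hl : 0 < l) (μ : Fin N → Measure (X × ℝ))
    [∀ i, IsProbabilityMeasure (μ i)] (hμ : ∀ i, Integrable Prod.snd (μ i))
    (hB : ∀ i, ∀ᵐ p ∂μ i, |p.2| ≤ B) :
    AEMeasurable (fun D => hsNorm (empTaskCov H l D - taskCov fun i => meanRidge H n l (μ i)) ^ 2)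
      (sourceLaw n μ) ∧
    ∫⁻ D, hsNorm (empTaskCov H l D - taskCov fun i => meanRidge H n l (μ i)) ^ 2 ∂sourceLaw n μ
      ≤ ENNReal.ofReal ((B ^ 2 / l) ^ 2 / N) := by
  have hN' : (0 : ℝ) < N := by exact_mod_cast hN
  obtain ⟨w, b, -⟩ := exists_hilbertBasis ℝ H
  have : Countable w := HilbertBasis.countable_index b
  set g : (Fin n → X × ℝ) → H := fun D => ridge (⊤ : Submodule ℝ H) l D with hgdef
  have hg : StronglyMeasurable g := stronglyMeasurable_ridge hK hn hl
  set ξ : w → Fin N → (Fin (n + n) → X × ℝ) → H := fun e _ D =>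
    (inner ℝ (b e) (g fun j => D (Fin.natAdd n j)) : ℝ) • g (fun j => D (Fin.castAdd n j)) with hξ
  have hl' : StronglyMeasurable fun D : Fin (n + n) → X × ℝ => g fun j => D (Fin.castAdd n j) :=
    hg.comp_measurable (measurable_pi_lambda _ fun j => measurable_pi_apply _)
  have hr' : StronglyMeasurable fun D : Fin (n + n) → X × ℝ => g fun j => D (Fin.natAdd n j) :=
    hg.comp_measurable (measurable_pi_lambda _ fun j => measurable_pi_apply _)
  have hξm : ∀ e i, StronglyMeasurable (ξ e i) := fun e i =>
    ((innerSL ℝ (b e)).continuous.comp_stronglyMeasurable hr').smul hl'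
  have hbd : ∀ i, ∀ᵐ D ∂(Measure.pi fun _ : Fin (n + n) => μ i),
      ‖g fun j => D (Fin.castAdd n j)‖ ^ 2 ≤ B ^ 2 / l ∧
      ‖g fun j => D (Fin.natAdd n j)‖ ^ 2 ≤ B ^ 2 / l := fun i => by
    filter_upwards [ae_pi_abs_le (ι := Fin (n + n)) (hB i)] with D hD
    exact ⟨norm_ridge_top_sq_le hn hl fun j => hD _, norm_ridge_top_sq_le hn hl fun j => hD _⟩
  have hmem : ∀ e i, MemLp (ξ e i) 2 (Measure.pi fun _ => μ i) := by
    intro e i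
    refine MemLp.of_bound (hξm e i).aestronglyMeasurable (B ^ 2 / l) ?_
    filter_upwards [hbd i] with D hD
    have h1 := norm_inner_le_norm (𝕜 := ℝ) (b e) (g fun j => D (Fin.natAdd n j))
    rw [b.orthonormal.1, one_mul] at h1
    rw [hξ, norm_smul]
    nlinarith [norm_nonneg (g fun j => D (Fin.natAdd n j)),
      norm_nonneg (g fun j => D (Fin.castAdd n j)), hD.1, hD.2,
      mul_le_mul_of_nonneg_right h1 (norm_nonneg (g fun j => D (Fin.castAdd n j))),
      sq_nonneg (‖g fun j => D (Fin.natAdd n j)‖ - ‖g fun j => D (Fin.castAdd n j)‖)]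
  have hmean : ∀ e i, ∫ D, ξ e i D ∂(Measure.pi fun _ => μ i)
      = (inner ℝ (b e) (meanRidge H n l (μ i)) : ℝ) • meanRidge H n l (μ i) := fun e i =>
    integral_pi_inner_smul (μ i) hg (integrable_ridge hκ hK hn hl (hμ i)) (b e)
  have hZ : ∀ e D, ‖(empTaskCov H l D - taskCov fun i => meanRidge H n l (μ i)) (b e)‖ₑ ^ 2
      = ENNReal.ofReal (1 / (N : ℝ)) ^ 2 *
        ‖∑ i, (ξ e i (D i) - ∫ a, ξ e i a ∂(Measure.pi fun _ => μ i))‖ₑ ^ 2 := by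
    intro e D
    have h1 : (empTaskCov H l D - taskCov fun i => meanRidge H n l (μ i)) (b e)
        = (1 / (N : ℝ)) • ∑ i, (ξ e i (D i) - ∫ a, ξ e i a ∂(Measure.pi fun _ => μ i)) := by
      simp only [hmean, Finset.sum_sub_distrib, smul_sub]
      rw [sub_apply, taskCov_apply]
      congr 1
      · simp [empTaskCov, hξ, hgdef, real_inner_comm]
      · simp only [real_inner_comm]
    rw [h1, enorm_smul, mul_pow, Real.enorm_eq_ofReal (by positivity)]
  have hsum : ∀ D, hsNorm (empTaskCov H l D - taskCov fun i => meanRidge H n l (μ i)) ^ 2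
      = ∑' e, ENNReal.ofReal (1 / (N : ℝ)) ^ 2 *
        ‖∑ i, (ξ e i (D i) - ∫ a, ξ e i a ∂(Measure.pi fun _ => μ i))‖ₑ ^ 2 := fun D => by
    rw [hsNorm_sq b]
    exact tsum_congr fun e => hZ e D
  have hmeas : ∀ e, AEMeasurable (fun D : Fin N → Fin (n + n) → X × ℝ =>
      ENNReal.ofReal (1 / (N : ℝ)) ^ 2 *
        ‖∑ i, (ξ e i (D i) - ∫ a, ξ e i a ∂(Measure.pi fun _ => μ i))‖ₑ ^ 2) (sourceLaw n μ) := by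
    intro e
    have h1 : StronglyMeasurable fun D : Fin N → Fin (n + n) → X × ℝ =>
        ∑ i, (ξ e i (D i) - ∫ a, ξ e i a ∂(Measure.pi fun _ => μ i)) :=
      Finset.stronglyMeasurable_fun_sum _ fun i _ =>
        ((hξm e i).comp_measurable (measurable_pi_apply i)).sub stronglyMeasurable_const
    exact ((h1.enorm.pow_const 2).const_mul _).aemeasurable
  have hbound : ∀ i, ∑' e, ∫⁻ D, ‖ξ e i D‖ₑ ^ 2 ∂(Measure.pi fun _ => μ i)
      ≤ ENNReal.ofReal ((B ^ 2 / l) ^ 2) := by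
    intro i
    rw [← lintegral_tsum fun e => ((hξm e i).enorm.pow_const 2).aemeasurable]
    calc ∫⁻ D, ∑' e, ‖ξ e i D‖ₑ ^ 2 ∂(Measure.pi fun _ => μ i)
        ≤ ∫⁻ _, ENNReal.ofReal ((B ^ 2 / l) ^ 2) ∂(Measure.pi fun _ : Fin (n + n) => μ i) := by
          refine lintegral_mono_ae ?_
          filter_upwards [hbd i] with D hD
          -- Parseval in the right tensor factor: the total is the squared Hilbert-Schmidt norm of
          -- one summand, so no dimension enters.
          have h1 : ∑' e, ‖ξ e i D‖ₑ ^ 2 = ‖g fun j => D (Fin.natAdd n j)‖ₑ ^ 2 *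
              ‖g fun j => D (Fin.castAdd n j)‖ₑ ^ 2 := by
            rw [enorm_sq_eq_tsum b (g fun j => D (Fin.natAdd n j)), ← ENNReal.tsum_mul_right]
            exact tsum_congr fun e => by rw [hξ, enorm_smul, mul_pow]
          rw [h1, ← ofReal_norm, ← ofReal_norm, ← ENNReal.ofReal_pow (norm_nonneg _),
            ← ENNReal.ofReal_pow (norm_nonneg _), ← ENNReal.ofReal_mul (by positivity),
            sq (B ^ 2 / l)]
          exact ENNReal.ofReal_le_ofReal (mul_le_mul hD.2 hD.1 (by positivity) (by positivity))
      _ = _ := by simp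
  simp only [hsum]
  refine ⟨AEMeasurable.tsum hmeas, ?_⟩
  rw [lintegral_tsum hmeas]
  have hstep : ∀ e, ∫⁻ D, ENNReal.ofReal (1 / (N : ℝ)) ^ 2 *
      ‖∑ i, (ξ e i (D i) - ∫ a, ξ e i a ∂(Measure.pi fun _ => μ i))‖ₑ ^ 2 ∂sourceLaw n μ
      ≤ ENNReal.ofReal (1 / (N : ℝ)) ^ 2 *
        ∑ i, ∫⁻ D, ‖ξ e i D‖ₑ ^ 2 ∂(Measure.pi fun _ => μ i) := by
    intro e
    rw [lintegral_const_mul' _ _ (by simp)]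
    gcongr
    exact lintegral_enorm_sum_sub_integral_sq_le
      (fun i : Fin N => Measure.pi fun _ : Fin (n + n) => μ i) (ξ := ξ e) (hmem e)
  refine (ENNReal.tsum_le_tsum hstep).trans ?_
  rw [ENNReal.tsum_mul_left, Summable.tsum_finsetSum fun i _ => ENNReal.summable]
  calc ENNReal.ofReal (1 / (N : ℝ)) ^ 2 *
        ∑ i, ∑' e, ∫⁻ D, ‖ξ e i D‖ₑ ^ 2 ∂(Measure.pi fun _ => μ i)
      ≤ ENNReal.ofReal (1 / (N : ℝ)) ^ 2 * (N * ENNReal.ofReal ((B ^ 2 / l) ^ 2)) := by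
        gcongr
        refine (Finset.sum_le_card_nsmul _ _ _ fun i _ => hbound i).trans ?_
        simp
    _ = ENNReal.ofReal ((B ^ 2 / l) ^ 2 / N) := by
        rw [← ENNReal.ofReal_natCast, ← ENNReal.ofReal_pow (by positivity),
          ← ENNReal.ofReal_mul (by positivity), ← ENNReal.ofReal_mul (by positivity)]
        congr 1
        field_simp

end Source

/-! ### High probability bound for the empirical task operator -/

section SourceTail

theorem norm_apply_le_of_hsNorm_le {H : Type*} [NormedAddCommGroup H] [InnerProductSpace ℝ H]
    [CompleteSpace H] {A : H →L[ℝ] H} {c : ℝ} (hc : 0 ≤ c) (hA : hsNorm A ≤ ENNReal.ofReal c)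
    (x : H) : ‖A x‖ ≤ c * ‖x‖ := by
  have h := (enorm_apply_le_hsNorm A x).trans (mul_le_mul_left hA ‖x‖ₑ)
  rw [← ofReal_norm, ← ofReal_norm, ← ENNReal.ofReal_mul hc] at h
  exact (ENNReal.ofReal_le_ofReal_iff (by positivity)).1 h

theorem norm_average_rankOne_apply_le {H : Type*} [NormedAddCommGroup H] [InnerProductSpace ℝ H]
    {N : ℕ} (hN : 0 < N) (a b : Fin N → H) {c : ℝ} (hc : ∀ i, ‖a i‖ * ‖b i‖ ≤ c) (x : H) :
    ‖((1 / (N : ℝ)) • ∑ i, rankOne ℝ (a i) (b i)) x‖ ≤ c * ‖x‖ := by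
  have hN' : (0 : ℝ) < N := by exact_mod_cast hN
  have h1 : ((1 / (N : ℝ)) • ∑ i, rankOne ℝ (a i) (b i)) x
      = (1 / (N : ℝ)) • ∑ i, inner ℝ (b i) x • a i := by simp
  rw [h1, norm_smul, Real.norm_of_nonneg (by positivity), one_div, inv_mul_le_iff₀ hN']
  refine (norm_sum_le _ _).trans ((Finset.sum_le_card_nsmul _ _ (c * ‖x‖) fun i _ => ?_).trans
    (by simp))
  rw [norm_smul]
  calc ‖(inner ℝ (b i) x : ℝ)‖ * ‖a i‖ ≤ (‖b i‖ * ‖x‖) * ‖a i‖ := by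
        gcongr; exact norm_inner_le_norm _ _
    _ = (‖a i‖ * ‖b i‖) * ‖x‖ := by ring
    _ ≤ c * ‖x‖ := by gcongr; exact hc i

/-- The constant in the deviation bound for the empirical task operator. -/
def sourceConst (κ R B a : ℝ) : ℝ :=
  √(8 * (B ^ 4 + 1) / a) + 2 * (2 * R ^ 2 * max 1 (κ ^ 2) ^ 2)
    + 2 * (B ^ 2 + (max 1 (κ ^ 2) * R) ^ 2)

theorem sourceConst_nonneg (κ R B a : ℝ) : 0 ≤ sourceConst κ R B a := by
  unfold sourceConst; positivity

variable {X H : Type*} [MeasurableSpace X] [NormedAddCommGroup H] [InnerProductSpace ℝ H]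
  [CompleteSpace H] [TopologicalSpace.SeparableSpace H] [RKHS ℝ H X ℝ] {κ : ℝ}

-- The three summands of `sourceConst` pay for the fluctuation, for the bias and for the regime of
-- few observations per task. The choice `l = n ^ (-1/2)` makes `l √n = 1` and `l ^ r = n ^ (-r/2)`.
set_option maxHeartbeats 800000 in
theorem sourceLaw_norm_sub_gt_le (hκ : 0 ≤ κ) (hK : KernelAssumptions H κ) {N n : ℕ}
    (hn : 1 ≤ n) {r R B a τ : ℝ} (hr0 : 0 ≤ r) (hr1 : r ≤ 1) (ha : 0 < a) (hτ : 1 ≤ τ)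
    (hN : a * Real.exp n ≤ N) (μ : Fin N → Measure (X × ℝ)) [∀ i, IsProbabilityMeasure (μ i)]
    (f : Fin N → H) (hf : ∀ i, IsRegressionFunction (μ i) (f i))
    (hs : ∀ i, SourceCondition (μ i) r R (f i)) (hB : ∀ i, ∀ᵐ p ∂μ i, |p.2| ≤ B) :
    sourceLaw n μ {D | ¬ ∀ x, ‖empTaskCov H ((n : ℝ) ^ (-(1 / 2) : ℝ)) D x - taskCov f x‖
      ≤ sourceConst κ R B a * τ * (n : ℝ) ^ (-(r / 2)) * ‖x‖}
      ≤ ENNReal.ofReal (2 * Real.exp (-τ)) := by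
  have hn0 : 0 < n := hn
  have hn' : (1 : ℝ) ≤ n := by exact_mod_cast hn
  have hnpos : (0 : ℝ) < n := by linarith
  have hNpos' : (0 : ℝ) < N := lt_of_lt_of_le (by positivity) hN
  have hNpos : 0 < N := by exact_mod_cast hNpos'
  set l : ℝ := (n : ℝ) ^ (-(1 / 2) : ℝ) with hl
  have hlpos : 0 < l := Real.rpow_pos_of_pos hnpos _
  have hsq : 0 < √(n : ℝ) := Real.sqrt_pos.2 hnpos
  have hlinv : l = (√n)⁻¹ := by
    rw [hl, Real.rpow_neg hnpos.le, Real.sqrt_eq_rpow]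
  have hlr : l ^ r = (n : ℝ) ^ (-(r / 2)) := by
    rw [hl, ← Real.rpow_mul hnpos.le]; congr 1; ring
  have hl_le : l ≤ (n : ℝ) ^ (-(r / 2)) := by
    rw [hl]
    exact Real.rpow_le_rpow_of_exponent_le hn' (by linarith)
  set ρ := (n : ℝ) ^ (-(r / 2)) with hρ
  have hρpos : 0 < ρ := Real.rpow_pos_of_pos hnpos _
  set M := max 1 (κ ^ 2) * R with hM
  set K1 := √(8 * (B ^ 4 + 1) / a) with hK1
  have hK1sq : K1 ^ 2 = 8 * (B ^ 4 + 1) / a := Real.sq_sqrt (by positivity)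
  have hK1pos : 0 < K1 := Real.sqrt_pos.2 (by positivity)
  have hconst : sourceConst κ R B a
      = K1 + 2 * (2 * R ^ 2 * max 1 (κ ^ 2) ^ 2) + 2 * (B ^ 2 + M ^ 2) := rfl
  have hJ : 0 ≤ 2 * R ^ 2 * max 1 (κ ^ 2) ^ 2 := by positivity
  -- If `n < 2 * τ` the bound holds almost surely: `B ^ 2 / l` is `B ^ 2 * √n`, and `√n = n * l ≤ 2
  -- * τ * l`. Otherwise Markov's inequality is strong enough.
  rcases lt_or_ge (n : ℝ) (2 * τ) with hcase | hcase
  · have hae : ∀ᵐ D ∂sourceLaw n μ, ∀ x, ‖empTaskCov H l D x - taskCov f x‖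
        ≤ sourceConst κ R B a * τ * ρ * ‖x‖ := by
      have h1 : ∀ᵐ D ∂sourceLaw n μ, ∀ i j, |(D i j).2| ≤ B := by
        refine ae_all_iff.2 fun i => ?_
        exact (measurePreserving_eval (fun i => Measure.pi fun _ : Fin (n + n) => μ i)
          i).quasiMeasurePreserving.ae (ae_pi_abs_le (ι := Fin (n + n)) (hB i))
      filter_upwards [h1] with D hD x
      have h2 : ‖empTaskCov H l D x‖ ≤ B ^ 2 / l * ‖x‖ := by
        refine norm_average_rankOne_apply_le hNpos _ _ (fun i => ?_) x
        have h3 := norm_ridge_top_sq_le (H := H) hn0 hlpos (fun j => hD i (Fin.castAdd n j))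
        have h4 := norm_ridge_top_sq_le (H := H) hn0 hlpos (fun j => hD i (Fin.natAdd n j))
        have h5 := two_mul_le_add_sq
          ‖ridge (⊤ : Submodule ℝ H) l fun j => D i (Fin.castAdd n j)‖
          ‖ridge (⊤ : Submodule ℝ H) l fun j => D i (Fin.natAdd n j)‖
        linarith
      have h3 : ‖taskCov f x‖ ≤ M ^ 2 * ‖x‖ := by
        refine norm_average_rankOne_apply_le hNpos _ _ (fun i => ?_) x
        have h4 := (hs i).norm_le hκ hK hr0 hr1
        rw [sq]
        exact mul_le_mul h4 h4 (norm_nonneg _) ((norm_nonneg _).trans h4)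
      refine (norm_sub_le _ _).trans ((add_le_add h2 h3).trans ?_)
      rw [← add_mul]
      gcongr
      have h4 : B ^ 2 / l = B ^ 2 * √n := by rw [hlinv, div_inv_eq_mul]
      have h5 : √(n : ℝ) ≤ 2 * τ * l := by
        rw [hlinv, ← div_eq_mul_inv, le_div_iff₀ hsq, Real.mul_self_sqrt hnpos.le]
        exact hcase.le
      have h6 : 1 ≤ √(n : ℝ) := Real.one_le_sqrt.2 hn'
      calc B ^ 2 / l + M ^ 2 ≤ (B ^ 2 + M ^ 2) * √n := by
            rw [h4, add_mul]
            gcongr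
            exact le_mul_of_one_le_right (by positivity) h6
        _ ≤ (B ^ 2 + M ^ 2) * (2 * τ * ρ) := by
            gcongr
            exact h5.trans (by gcongr)
        _ ≤ sourceConst κ R B a * τ * ρ := by
            rw [hconst]
            have : 0 ≤ (K1 + 2 * (2 * R ^ 2 * max 1 (κ ^ 2) ^ 2)) * τ * ρ := by positivity
            nlinarith
    rw [ae_iff.1 hae]
    exact zero_le
  · obtain ⟨hmeas, hlint⟩ := lintegral_hsNorm_empTaskCov_sub_sq_le (H := H) hκ hK hNpos hn0 hlpos μ
      (fun i => (hf i).1) hB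
    have hbias := hsNorm_taskCov_meanRidge_sub_le hκ hK hn0 hlpos hr0 hr1 μ f hf hs
    have h2 : 1 + 1 / (l * √n) = 2 := by
      rw [hlinv, inv_mul_cancel₀ hsq.ne']; norm_num
    rw [h2, hlr] at hbias
    have hsub : {D : Fin N → Fin (n + n) → X × ℝ | ¬ ∀ x, ‖empTaskCov H l D x - taskCov f x‖
        ≤ sourceConst κ R B a * τ * ρ * ‖x‖} ⊆ {D | ENNReal.ofReal (K1 * l) ^ 2 ≤
          hsNorm (empTaskCov H l D - taskCov fun i => meanRidge H n l (μ i)) ^ 2} := by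
      intro D hD
      by_contra hcon
      refine hD fun x => ?_
      simp only [Set.mem_ofPred_eq, not_le] at hcon
      have h3 := ((ENNReal.pow_lt_pow_left_iff two_ne_zero).1 hcon).le
      have h4 := norm_apply_le_of_hsNorm_le (by positivity) h3 x
      have h5 := norm_apply_le_of_hsNorm_le (by positivity) hbias x
      have h6 : empTaskCov H l D x - taskCov f x
          = (empTaskCov H l D - taskCov fun i => meanRidge H n l (μ i)) x
            + ((taskCov fun i => meanRidge H n l (μ i)) - taskCov f) x := by
        simp only [sub_apply]; abel
      rw [h6]
      refine (norm_add_le _ _).trans ((add_le_add h4 h5).trans ?_)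
      rw [← add_mul]
      gcongr
      calc K1 * l + 2 * R ^ 2 * max 1 (κ ^ 2) ^ 2 * ρ * 2
          ≤ K1 * ρ + 2 * (2 * R ^ 2 * max 1 (κ ^ 2) ^ 2) * ρ := by
            have := mul_le_mul_of_nonneg_left hl_le hK1pos.le
            linarith
        _ ≤ sourceConst κ R B a * 1 * ρ := by
            rw [hconst]
            have : 0 ≤ 2 * (B ^ 2 + M ^ 2) * ρ := by positivity
            linarith
        _ ≤ sourceConst κ R B a * τ * ρ := by
            have := sourceConst_nonneg κ R B a
            gcongr
    have hpos : 0 < (K1 * l) ^ 2 := by positivity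
    refine (measure_mono hsub).trans ((meas_ge_le_lintegral_div hmeas ?_ ?_).trans ?_)
    · rw [← ENNReal.ofReal_pow (by positivity)]
      exact (ENNReal.ofReal_pos.2 hpos).ne'
    · simp
    rw [← ENNReal.ofReal_pow (by positivity)]
    refine (ENNReal.div_le_div_right hlint _).trans ?_
    rw [← ENNReal.ofReal_div_of_pos hpos]
    refine ENNReal.ofReal_le_ofReal ?_
    have hl2 : l ^ 2 = 1 / n := by
      rw [hlinv, inv_pow, Real.sq_sqrt hnpos.le, one_div]
    -- Markov's inequality leaves a multiple of `n ^ 2 / N`. Half of the exponent in `N ≥ a * exp n`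
    -- absorbs `n ^ 2`, the other half gives `exp (-τ)` because `n / 2 ≥ τ`.
    have hexp : (n : ℝ) ^ 2 ≤ 8 * Real.exp (n / 2) := by
      have := Real.quadratic_le_exp_of_nonneg (by positivity : (0 : ℝ) ≤ n / 2)
      nlinarith
    have hval : (B ^ 2 / l) ^ 2 / N / (K1 * l) ^ 2 = B ^ 4 * a * n ^ 2 / (8 * (B ^ 4 + 1) * N) := by
      rw [mul_pow, div_pow, hK1sq, hl2]
      field_simp
    rw [hval, div_le_iff₀ (by positivity)]
    have he1 : Real.exp (n / 2) * Real.exp (n / 2) = Real.exp n := by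
      rw [← Real.exp_add]; congr 1; ring
    have he2 : 1 ≤ Real.exp (-τ) * Real.exp (n / 2) := by
      rw [← Real.exp_add]; exact Real.one_le_exp (by linarith)
    have he3 : Real.exp (n / 2) ≤ Real.exp (-τ) * Real.exp n := by
      rw [← he1]
      nlinarith [Real.exp_pos ((n : ℝ) / 2)]
    calc B ^ 4 * a * n ^ 2 ≤ (B ^ 4 + 1) * a * (8 * (Real.exp (-τ) * Real.exp n)) := by
          gcongr
          · linarith
          · linarith
      _ = 8 * (B ^ 4 + 1) * Real.exp (-τ) * (a * Real.exp n) := by ring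
      _ ≤ 8 * (B ^ 4 + 1) * Real.exp (-τ) * N := by gcongr
      _ ≤ 2 * Real.exp (-τ) * (8 * (B ^ 4 + 1) * N) := by
          have : 0 ≤ 8 * (B ^ 4 + 1) * Real.exp (-τ) * N := by positivity
          linarith

end SourceTail

/-! ### Lower tail of a sum of independent random rank one matrices -/

section MatrixTail

open Matrix

variable {ι : Type*} [Fintype ι] [DecidableEq ι]

/-- `A` is symmetric and bounded below by `c`. -/
def SymmGE (A : Matrix ι ι ℝ) (c : ℝ) : Prop :=
  Aᵀ = A ∧ ∀ g : ι → ℝ, c * (g ⬝ᵥ g) ≤ g ⬝ᵥ (A *ᵥ g)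

theorem exists_orthogonal_diagonalization {A : Matrix ι ι ℝ} (hA : Aᵀ = A) :
    ∃ (U : Matrix ι ι ℝ) (α : ι → ℝ), U * Uᵀ = 1 ∧ Uᵀ * U = 1 ∧ A = U * diagonal α * Uᵀ := by
  have hH : A.IsHermitian := by rw [IsHermitian, conjTranspose_eq_transpose_of_trivial, hA]
  refine ⟨hH.eigenvectorUnitary, hH.eigenvalues, ?_, ?_, ?_⟩
  · have h := Unitary.coe_mul_star_self hH.eigenvectorUnitary
    rwa [Unitary.coe_star, star_eq_conjTranspose, conjTranspose_eq_transpose_of_trivial] at h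
  · have h := Unitary.coe_star_mul_self hH.eigenvectorUnitary
    rwa [star_eq_conjTranspose, conjTranspose_eq_transpose_of_trivial] at h
  · have h := hH.spectral_theorem
    rw [Unitary.conjStarAlgAut_apply, star_eq_conjTranspose,
      conjTranspose_eq_transpose_of_trivial] at h
    exact h

theorem quadratic_form_conj_diagonal (U : Matrix ι ι ℝ) (α : ι → ℝ) (x : ι → ℝ) :
    x ⬝ᵥ ((U * diagonal α * Uᵀ) *ᵥ x) = ∑ k, (Uᵀ *ᵥ x) k ^ 2 * α k := by
  rw [← mulVec_mulVec, ← mulVec_mulVec, dotProduct_mulVec, ← mulVec_transpose, dotProduct]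
  refine Finset.sum_congr rfl fun k _ => ?_
  rw [mulVec_diagonal]
  ring

theorem conj_diagonal_pow {U : Matrix ι ι ℝ} (hU : U * Uᵀ = 1) (hU' : Uᵀ * U = 1) (β : ι → ℝ)
    (j : ℕ) : (U * diagonal β * Uᵀ) ^ j = U * diagonal (fun k => β k ^ j) * Uᵀ := by
  induction j with
  | zero => simp [hU]
  | succ j ih =>
    rw [pow_succ, ih]
    have h : U * diagonal (fun k => β k ^ j) * Uᵀ * (U * diagonal β * Uᵀ)
        = U * diagonal (fun k => β k ^ j) * (Uᵀ * U) * diagonal β * Uᵀ := by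
      simp only [Matrix.mul_assoc]
    rw [h, hU', Matrix.mul_one, Matrix.mul_assoc U, diagonal_mul_diagonal]
    simp only [pow_succ]

/-- Spectral form of the inverse of a matrix bounded below by `c > 0`. -/
theorem SymmGE.exists_inv_eq {A : Matrix ι ι ℝ} {c : ℝ} (hA : SymmGE A c) (hc : 0 < c) :
    ∃ (U : Matrix ι ι ℝ) (β : ι → ℝ), Uᵀ * U = 1 ∧ U * Uᵀ = 1 ∧ (∀ k, 0 < β k ∧ c * β k ≤ 1) ∧
      A = U * diagonal (fun k => (β k)⁻¹) * Uᵀ ∧ A * A⁻¹ = 1 ∧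
      ∀ j : ℕ, A⁻¹ ^ j = U * diagonal (fun k => β k ^ j) * Uᵀ := by
  obtain ⟨U, α, hU, hU', hAU⟩ := exists_orthogonal_diagonalization hA.1
  have hα : ∀ k, c ≤ α k := by
    intro k
    have h1 := hA.2 (U *ᵥ Pi.single k 1)
    rw [hAU, quadratic_form_conj_diagonal, mulVec_mulVec, hU', one_mulVec, dotProduct_mulVec,
      ← mulVec_transpose, mulVec_mulVec, hU', one_mulVec] at h1
    simpa [Pi.single_apply] using h1
  have hα0 : ∀ k, 0 < α k := fun k => hc.trans_le (hα k)
  have hinv : A * (U * diagonal (fun k => (α k)⁻¹) * Uᵀ) = 1 := by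
    have h : U * diagonal α * Uᵀ * (U * diagonal (fun k => (α k)⁻¹) * Uᵀ)
        = U * diagonal α * (Uᵀ * U) * diagonal (fun k => (α k)⁻¹) * Uᵀ := by
      simp only [Matrix.mul_assoc]
    rw [hAU, h, hU', Matrix.mul_one, Matrix.mul_assoc U, diagonal_mul_diagonal]
    simp [(hα0 _).ne', hU]
  have hinv' : A⁻¹ = U * diagonal (fun k => (α k)⁻¹) * Uᵀ := inv_eq_right_inv hinv
  refine ⟨U, fun k => (α k)⁻¹, hU', hU, fun k => ⟨inv_pos.2 (hα0 k), ?_⟩, ?_, ?_, fun j => ?_⟩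
  · rw [← div_eq_mul_inv, div_le_one (hα0 k)]
    exact hα k
  · simpa using hAU
  · rw [hinv', hinv]
  · rw [hinv', conj_diagonal_pow hU hU']

theorem SymmGE.inv_transpose {A : Matrix ι ι ℝ} {c : ℝ} (hA : SymmGE A c) : (A⁻¹)ᵀ = A⁻¹ := by
  rw [transpose_nonsing_inv, hA.1]

theorem SymmGE.quadratic_inv_pow_nonneg {A : Matrix ι ι ℝ} {c : ℝ} (hA : SymmGE A c) (hc : 0 < c)
    (x : ι → ℝ) (j : ℕ) : 0 ≤ x ⬝ᵥ ((A⁻¹ ^ j) *ᵥ x) := by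
  obtain ⟨U, β, -, -, hβ, -, -, hpow⟩ := hA.exists_inv_eq hc
  rw [hpow, quadratic_form_conj_diagonal]
  exact Finset.sum_nonneg fun k _ => mul_nonneg (sq_nonneg _) (pow_nonneg (hβ k).1.le j)

theorem SymmGE.quadratic_inv_le {A : Matrix ι ι ℝ} {c : ℝ} (hA : SymmGE A c) (hc : 0 < c)
    (x : ι → ℝ) : c * (x ⬝ᵥ (A⁻¹ *ᵥ x)) ≤ x ⬝ᵥ x := by
  obtain ⟨U, β, -, hU, hβ, -, -, hpow⟩ := hA.exists_inv_eq hc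
  have h1 := hpow 1
  have h0 : x ⬝ᵥ x = ∑ k, (Uᵀ *ᵥ x) k ^ 2 * 1 := by
    rw [← quadratic_form_conj_diagonal U (fun _ => 1) x]
    simp [hU]
  rw [pow_one] at h1
  rw [h1, quadratic_form_conj_diagonal, h0, Finset.mul_sum]
  refine Finset.sum_le_sum fun k _ => ?_
  rw [pow_one]
  nlinarith [(hβ k).2, sq_nonneg ((Uᵀ *ᵥ x) k), mul_le_mul_of_nonneg_left (hβ k).2
    (sq_nonneg ((Uᵀ *ᵥ x) k))]

/-- Chebyshev's inequality for the spectral moments of `A⁻¹` at `x`. -/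
theorem SymmGE.moment_mul_le {A : Matrix ι ι ℝ} {c : ℝ} (hA : SymmGE A c) (hc : 0 < c)
    (x : ι → ℝ) (i j : ℕ) :
    (x ⬝ᵥ ((A⁻¹ ^ (i + 1)) *ᵥ x)) * (x ⬝ᵥ ((A⁻¹ ^ (j + 1)) *ᵥ x))
      ≤ (x ⬝ᵥ (A⁻¹ *ᵥ x)) * (x ⬝ᵥ ((A⁻¹ ^ (i + j + 1)) *ᵥ x)) := by
  obtain ⟨U, β, -, -, hβ, -, -, hpow⟩ := hA.exists_inv_eq hc
  have h1 := hpow 1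
  rw [pow_one] at h1
  set w : ι → ℝ := fun k => (Uᵀ *ᵥ x) k ^ 2 with hw
  rw [hpow, hpow, hpow, h1]
  simp only [quadratic_form_conj_diagonal, pow_one]
  -- Both powers are increasing in the eigenvalue, so the two differences have the same sign.
  have key : 0 ≤ ∑ k, ∑ l, w k * w l * β k * β l * ((β k ^ i - β l ^ i) * (β k ^ j - β l ^ j)) := by
    refine Finset.sum_nonneg fun k _ => Finset.sum_nonneg fun l _ => ?_
    have hk := (hβ k).1.le
    have hl := (hβ l).1.le
    refine mul_nonneg (by positivity) ?_
    rcases le_total (β k) (β l) with h | h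
    · exact mul_nonneg_of_nonpos_of_nonpos (sub_nonpos.2 (pow_le_pow_left₀ hk h i))
        (sub_nonpos.2 (pow_le_pow_left₀ hk h j))
    · exact mul_nonneg (sub_nonneg.2 (pow_le_pow_left₀ hl h i))
        (sub_nonneg.2 (pow_le_pow_left₀ hl h j))
  have hexp : ∑ k, ∑ l, w k * w l * β k * β l * ((β k ^ i - β l ^ i) * (β k ^ j - β l ^ j))
      = 2 * ((∑ k, w k * β k) * ∑ k, w k * β k ^ (i + j + 1))
        - 2 * ((∑ k, w k * β k ^ (i + 1)) * ∑ k, w k * β k ^ (j + 1)) := by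
    have hterm : ∀ k l, w k * w l * β k * β l * ((β k ^ i - β l ^ i) * (β k ^ j - β l ^ j))
        = (w k * β k ^ (i + j + 1)) * (w l * β l) + (w k * β k) * (w l * β l ^ (i + j + 1))
          - (w k * β k ^ (i + 1)) * (w l * β l ^ (j + 1))
          - (w k * β k ^ (j + 1)) * (w l * β l ^ (i + 1)) := fun k l => by ring
    simp only [hterm, Finset.sum_sub_distrib, Finset.sum_add_distrib, ← Finset.sum_mul_sum]
    ring
  rw [hexp] at key
  linarith

omit [DecidableEq ι] in
theorem SymmGE.add_vecMulVec {A : Matrix ι ι ℝ} {c : ℝ} (hA : SymmGE A c) (x : ι → ℝ) :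
    SymmGE (A + vecMulVec x x) c := by
  refine ⟨by rw [transpose_add, hA.1, transpose_vecMulVec], fun g => (hA.2 g).trans ?_⟩
  rw [add_mulVec, dotProduct_add, vecMulVec_mulVec]
  have : 0 ≤ g ⬝ᵥ MulOpposite.op (x ⬝ᵥ g) • x := by
    rw [dotProduct_smul, dotProduct_comm g x]
    exact mul_self_nonneg _
  linarith

/-- The Sherman-Morrison formula. -/
theorem SymmGE.inv_add_vecMulVec {A : Matrix ι ι ℝ} {c : ℝ} (hA : SymmGE A c) (hc : 0 < c)
    (x : ι → ℝ) : (A + vecMulVec x x)⁻¹ = A⁻¹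
      - (1 + x ⬝ᵥ (A⁻¹ *ᵥ x))⁻¹ • vecMulVec (A⁻¹ *ᵥ x) (A⁻¹ *ᵥ x) := by
  obtain ⟨-, -, -, -, -, -, hinv, -⟩ := hA.exists_inv_eq hc
  have hr : 0 ≤ x ⬝ᵥ (A⁻¹ *ᵥ x) := by
    simpa using hA.quadratic_inv_pow_nonneg hc x 1
  set r := x ⬝ᵥ (A⁻¹ *ᵥ x) with hrdef
  refine inv_eq_right_inv ?_
  have h1 : A * vecMulVec (A⁻¹ *ᵥ x) (A⁻¹ *ᵥ x) = vecMulVec x (A⁻¹ *ᵥ x) := by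
    rw [mul_vecMulVec, mulVec_mulVec, hinv, one_mulVec]
  have h2 : vecMulVec x x * A⁻¹ = vecMulVec x (A⁻¹ *ᵥ x) := by
    rw [vecMulVec_mul, ← mulVec_transpose, hA.inv_transpose]
  have h3 : vecMulVec x x * vecMulVec (A⁻¹ *ᵥ x) (A⁻¹ *ᵥ x) = r • vecMulVec x (A⁻¹ *ᵥ x) := by
    ext i j
    rw [vecMulVec_mul_vecMulVec]
    simp only [vecMulVec_apply, Pi.smul_apply, smul_eq_mul, Matrix.smul_apply]
    rw [hrdef]
    ring
  rw [add_mul, mul_sub, mul_sub, hinv, mul_smul_comm, mul_smul_comm, h1, h2, h3, smul_smul]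
  have h4 : (1 : ℝ) + r ≠ 0 := by positivity
  have h5 : (1 + r)⁻¹ * r = 1 - (1 + r)⁻¹ := by field_simp; ring
  rw [h5, sub_smul, one_smul]
  abel

/-- Adding a small rank one matrix to `A` decreases the trace of `A⁻ᵖ` to first order. -/
theorem SymmGE.trace_inv_pow_add_vecMulVec_le {A : Matrix ι ι ℝ} {c : ℝ} (hA : SymmGE A c)
    (hc : 0 < c) (x : ι → ℝ) {p : ℕ} (hp : 1 ≤ p) (hxp : 2 * p * (x ⬝ᵥ x) ≤ c) :
    ((A + vecMulVec x x)⁻¹ ^ p).trace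
      ≤ (A⁻¹ ^ p).trace - p / 4 * (x ⬝ᵥ ((A⁻¹ ^ (p + 1)) *ᵥ x)) := by
  have hA' := hA.add_vecMulVec x
  set B := A⁻¹ with hB
  set B' := (A + vecMulVec x x)⁻¹ with hB'
  set r := x ⬝ᵥ (B *ᵥ x) with hr
  set y := B *ᵥ x with hy
  set ρ := (1 + r)⁻¹ with hρ
  have hp' : (1 : ℝ) ≤ p := by exact_mod_cast hp
  have hBt : Bᵀ = B := hA.inv_transpose
  have hr0 : 0 ≤ r := by simpa using hA.quadratic_inv_pow_nonneg hc x 1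
  have hrp : 2 * p * r ≤ 1 := by
    have h1 := hA.quadratic_inv_le hc x
    have h2 : c * (2 * p * r) ≤ c * 1 := by nlinarith
    exact le_of_mul_le_mul_left h2 hc
  have hρ0 : 1 / 2 ≤ ρ := by
    rw [hρ, ← one_div]
    exact one_div_le_one_div_of_le (by positivity) (by nlinarith)
  have hρ1 : ρ ≤ 1 := inv_le_one_of_one_le₀ (by linarith)
  have hSM : B' = B - ρ • vecMulVec y y := hA.inv_add_vecMulVec hc x
  have hdiff : B - B' = ρ • vecMulVec y y := by rw [hSM]; abel
  -- moments of `B` at `y`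
  have hmom : ∀ j, y ⬝ᵥ ((B ^ j) *ᵥ y) = x ⬝ᵥ ((B ^ (j + 2)) *ᵥ x) := by
    intro j
    have h1 : B ^ (j + 2) = B * (B ^ j * B) := by rw [← pow_succ, ← pow_succ']
    rw [h1, ← mulVec_mulVec, ← mulVec_mulVec, dotProduct_mulVec x, ← mulVec_transpose, hBt]
  set mu : ℕ → ℝ := fun j => y ⬝ᵥ ((B ^ j) *ᵥ y) with hmu
  have hmu0 : ∀ j, 0 ≤ mu j := fun j => hA.quadratic_inv_pow_nonneg hc y j
  have hmumul : ∀ i j, mu i * mu j ≤ r * mu (i + j + 1) := by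
    intro i j
    simp only [hmu, hmom]
    have h1 := hA.moment_mul_le hc x (i + 1) (j + 1)
    have h2 : i + 1 + (j + 1) + 1 = i + j + 1 + 2 := by ring
    rw [h2] at h1
    exact h1
  -- Mixed moments of the inverses after and before the update. They are compared with the pure
  -- moments `mu`, which only involve `B`.
  set nu : ℕ → ℕ → ℝ := fun b a => y ⬝ᵥ ((B' ^ b * B ^ a) *ᵥ y) with hnu
  have hnu0 : ∀ b, 0 ≤ nu b 0 := fun b => by
    simp only [hnu, pow_zero, mul_one]
    exact hA'.quadratic_inv_pow_nonneg hc y b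
  have hrec : ∀ b a, nu (b + 1) a = nu b (a + 1) - ρ * (nu b 0 * mu a) := by
    intro b a
    have h1 : B' ^ (b + 1) * B ^ a =
        B' ^ b * B ^ (a + 1) - ρ • (B' ^ b * vecMulVec y y * B ^ a) := by
      rw [pow_succ, Matrix.mul_assoc, hSM, sub_mul, ← hSM, mul_sub, ← pow_succ', smul_mul_assoc,
        mul_smul_comm, Matrix.mul_assoc]
    have h2 : y ⬝ᵥ ((B' ^ b * vecMulVec y y * B ^ a) *ᵥ y) = nu b 0 * mu a := by
      rw [mul_vecMulVec, vecMulVec_mul, vecMulVec_mulVec, dotProduct_smul, ← dotProduct_mulVec]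
      simp only [hnu, hmu, pow_zero, mul_one, MulOpposite.smul_eq_mul_unop, MulOpposite.unop_op]
    simp only [hnu] at h2 ⊢
    rw [h1, sub_mulVec, dotProduct_sub, smul_mulVec, dotProduct_smul, h2, smul_eq_mul]
  have hupper : ∀ b a, nu b a ≤ mu (a + b) := by
    intro b
    induction b with
    | zero => intro a; simp [hnu, hmu]
    | succ b ih =>
      intro a
      rw [hrec]
      have h1 := ih (a + 1)
      have h2 : 0 ≤ ρ * (nu b 0 * mu a) :=
        mul_nonneg (by linarith) (mul_nonneg (hnu0 b) (hmu0 a))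
      have h3 : a + 1 + b = a + (b + 1) := by ring
      rw [h3] at h1
      linarith
  -- Each replacement of a factor `B` by `B'` loses at most `r * mu (a + b)`, by the moment
  -- inequality `hmumul` and `ρ ≤ 1`.
  have hlower : ∀ b a, (1 - r * b) * mu (a + b) ≤ nu b a := by
    intro b
    induction b with
    | zero => intro a; simp [hnu, hmu]
    | succ b ih =>
      intro a
      rw [hrec]
      have h1 := ih (a + 1)
      have h3 : a + 1 + b = a + (b + 1) := by ring
      rw [h3] at h1
      have h4 : nu b 0 ≤ mu b := by simpa using hupper b 0
      have h5 : ρ * (nu b 0 * mu a) ≤ r * mu (a + (b + 1)) := by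
        have h6 := hmumul b a
        have h7 : b + a + 1 = a + (b + 1) := by ring
        rw [h7] at h6
        have h8 : nu b 0 * mu a ≤ mu b * mu a := mul_le_mul_of_nonneg_right h4 (hmu0 a)
        have h9 : 0 ≤ nu b 0 * mu a := mul_nonneg (hnu0 b) (hmu0 a)
        nlinarith
      push_cast
      linarith
  -- The factors `B` are exchanged for `B'` one after another; every exchange inserts `ρ • vecMulVec
  -- y y`.
  have htel : (B ^ p).trace - (B' ^ p).trace = ∑ b ∈ Finset.range p, ρ * nu b (p - 1 - b) := by
    have h1 : ∀ b ∈ Finset.range p, ρ * nu b (p - 1 - b)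
        = (B' ^ b * B ^ (p - b)).trace - (B' ^ (b + 1) * B ^ (p - (b + 1))).trace := by
      intro b hb
      have hb' : b < p := Finset.mem_range.1 hb
      obtain ⟨a, rfl⟩ : ∃ a, p = b + 1 + a := ⟨p - (b + 1), by omega⟩
      have e1 : b + 1 + a - 1 - b = a := by omega
      have e2 : b + 1 + a - b = a + 1 := by omega
      have e3 : b + 1 + a - (b + 1) = a := by omega
      rw [e1, e2, e3, ← trace_sub, pow_succ' B, pow_succ B', ← Matrix.mul_assoc, ← sub_mul,
        ← mul_sub,
        hdiff, mul_smul_comm, smul_mul_assoc, trace_smul, mul_vecMulVec, vecMulVec_mul,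
        trace_vecMulVec, smul_eq_mul, ← mulVec_transpose, transpose_pow, hBt]
      congr 1
      simp only [hnu]
      rw [← mulVec_mulVec, dotProduct_mulVec, ← mulVec_transpose, transpose_pow, hA'.inv_transpose]
    rw [Finset.sum_congr rfl h1, Finset.sum_range_sub']
    simp
  -- The `1 / 4` is `ρ ≥ 1 / 2` times `1 - r * b ≥ 1 / 2`, both from `2 * p * r ≤ 1`.
  have hpos : ∀ b ∈ Finset.range p, 1 / 4 * mu (p - 1) ≤ ρ * nu b (p - 1 - b) := by
    intro b hb
    have hb' : b < p := Finset.mem_range.1 hb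
    have h1 := hlower b (p - 1 - b)
    have h2 : p - 1 - b + b = p - 1 := by omega
    rw [h2] at h1
    have h3 : (b : ℝ) ≤ p := by exact_mod_cast hb'.le
    have h4 : 1 / 2 ≤ 1 - r * b := by nlinarith
    have h5 : 1 / 2 * mu (p - 1) ≤ nu b (p - 1 - b) :=
      (mul_le_mul_of_nonneg_right h4 (hmu0 _)).trans h1
    have h6 := hmu0 (p - 1)
    nlinarith
  have hsum := Finset.card_nsmul_le_sum _ _ _ hpos
  rw [← htel, Finset.card_range, nsmul_eq_mul] at hsum
  have hlast : mu (p - 1) = x ⬝ᵥ ((B ^ (p + 1)) *ᵥ x) := by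
    simp only [hmu, hmom]
    have : p - 1 + 2 = p + 1 := by omega
    rw [this]
  rw [hlast] at hsum
  linarith

end MatrixTail

/-! ### Moment method for the smallest eigenvalue -/

section LowerTail

open Matrix

variable {ι : Type*} [Fintype ι] [DecidableEq ι]

theorem trace_conj_diagonal {U : Matrix ι ι ℝ} (hU : Uᵀ * U = 1) (β : ι → ℝ) :
    (U * diagonal β * Uᵀ).trace = ∑ k, β k := by
  rw [trace_mul_comm, ← Matrix.mul_assoc, hU, Matrix.one_mul, trace_diagonal]

theorem conj_diagonal_apply_self (U : Matrix ι ι ℝ) (β : ι → ℝ) (i : ι) :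
    (U * diagonal β * Uᵀ) i i = ∑ k, U i k ^ 2 * β k := by
  rw [mul_apply]
  refine Finset.sum_congr rfl fun k _ => ?_
  rw [mul_diagonal, transpose_apply]
  ring

/-- In an eigenbasis of `A` the quadratic form of `diagonal w` is at most the eigenvalue, which
cancels one inverse power. -/
theorem SymmGE.sum_mul_inv_pow_le {A : Matrix ι ι ℝ} {c : ℝ} (hA : SymmGE A c) (hc : 0 < c)
    {w : ι → ℝ} (hw : ∀ g : ι → ℝ, ∑ i, w i * g i ^ 2 ≤ g ⬝ᵥ (A *ᵥ g)) (p : ℕ) :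
    ∑ i, w i * (A⁻¹ ^ (p + 1)) i i ≤ (A⁻¹ ^ p).trace := by
  obtain ⟨U, β, hU, -, hβ, hAU, -, hpow⟩ := hA.exists_inv_eq hc
  have hcol : ∀ k, ∑ i, w i * U i k ^ 2 ≤ (β k)⁻¹ := by
    intro k
    have h1 := hw (U *ᵥ Pi.single k 1)
    rw [hAU, quadratic_form_conj_diagonal, mulVec_mulVec, hU, one_mulVec] at h1
    simpa [Pi.single_apply] using h1
  rw [hpow, hpow, trace_conj_diagonal hU]
  simp only [conj_diagonal_apply_self, Finset.mul_sum]
  rw [Finset.sum_comm]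
  refine Finset.sum_le_sum fun k _ => ?_
  have h2 : ∑ i, w i * (U i k ^ 2 * β k ^ (p + 1)) = (∑ i, w i * U i k ^ 2) * β k ^ (p + 1) := by
    rw [Finset.sum_mul]
    exact Finset.sum_congr rfl fun i _ => by ring
  rw [h2]
  refine (mul_le_mul_of_nonneg_right (hcol k) (pow_nonneg (hβ k).1.le _)).trans_eq ?_
  have := (hβ k).1.ne'
  rw [pow_succ', inv_mul_cancel_left₀ this]

theorem SymmGE.trace_inv_pow_nonneg {A : Matrix ι ι ℝ} {c : ℝ} (hA : SymmGE A c) (hc : 0 < c)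
    (p : ℕ) : 0 ≤ (A⁻¹ ^ p).trace := by
  obtain ⟨U, β, hU, -, hβ, -, -, hpow⟩ := hA.exists_inv_eq hc
  rw [hpow, trace_conj_diagonal hU]
  exact Finset.sum_nonneg fun k _ => pow_nonneg (hβ k).1.le _

theorem SymmGE.trace_inv_pow_le {A : Matrix ι ι ℝ} {c : ℝ} (hA : SymmGE A c) (hc : 0 < c)
    (p : ℕ) : (A⁻¹ ^ p).trace ≤ Fintype.card ι * (1 / c) ^ p := by
  obtain ⟨U, β, hU, -, hβ, -, -, hpow⟩ := hA.exists_inv_eq hc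
  rw [hpow, trace_conj_diagonal hU, ← nsmul_eq_mul]
  refine Finset.sum_le_card_nsmul _ _ _ fun k _ => pow_le_pow_left₀ (hβ k).1.le ?_ p
  rw [le_div_iff₀ hc, mul_comm]
  exact (hβ k).2

/-- Eigenvalue by eigenvalue this is `t * β ^ p - t ^ (p + 1) ≤ β ^ (p + 1)`. It linearizes the
drift, so that the recursion for the trace closes. -/
theorem SymmGE.le_trace_inv_pow_succ {A : Matrix ι ι ℝ} {c : ℝ} (hA : SymmGE A c) (hc : 0 < c)
    (p : ℕ) {t : ℝ} (ht : 0 ≤ t) :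
    t * (A⁻¹ ^ p).trace - Fintype.card ι * t ^ (p + 1) ≤ (A⁻¹ ^ (p + 1)).trace := by
  obtain ⟨U, β, hU, -, hβ, -, -, hpow⟩ := hA.exists_inv_eq hc
  rw [hpow, hpow, trace_conj_diagonal hU, trace_conj_diagonal hU, Finset.mul_sum, ← nsmul_eq_mul,
    ← Finset.card_univ, ← Finset.sum_const, ← Finset.sum_sub_distrib]
  refine Finset.sum_le_sum fun k _ => ?_
  have hk := (hβ k).1.le
  rw [pow_succ, pow_succ]
  rcases le_total t (β k) with h | h
  · have h1 : t * β k ^ p ≤ β k ^ p * β k := by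
      rw [mul_comm]; exact mul_le_mul_of_nonneg_left h (pow_nonneg hk p)
    have h2 : 0 ≤ t ^ p * t := by positivity
    linarith
  · have h1 : β k ^ p * (t - β k) ≤ t ^ p * t :=
      mul_le_mul (pow_le_pow_left₀ hk h p) (by linarith) (by linarith) (by positivity)
    linarith

/-- The trace dominates the `p`-th power of the largest eigenvalue of `A⁻¹`. -/
theorem SymmGE.of_trace_inv_pow_lt {A : Matrix ι ι ℝ} {c : ℝ} (hA : SymmGE A c) (hc : 0 < c)
    {p : ℕ} {c' : ℝ} (hc' : 0 < c') (h : (A⁻¹ ^ p).trace < (1 / c') ^ p) : SymmGE A c' := by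
  refine ⟨hA.1, fun g => ?_⟩
  obtain ⟨U, β, hU, hU', hβ, hAU, -, hpow⟩ := hA.exists_inv_eq hc
  rw [hpow, trace_conj_diagonal hU] at h
  have hk : ∀ k, c' ≤ (β k)⁻¹ := by
    intro k
    have h1 : β k ^ p < (1 / c') ^ p :=
      (Finset.single_le_sum (f := fun k => β k ^ p) (fun k _ => pow_nonneg (hβ k).1.le p)
        (Finset.mem_univ k)).trans_lt h
    have h2 := lt_of_pow_lt_pow_left₀ p (by positivity) h1
    rw [one_div] at h2
    exact ((le_inv_comm₀ (hβ k).1 hc').1 h2.le)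
  have h0 : g ⬝ᵥ g = ∑ k, (Uᵀ *ᵥ g) k ^ 2 * 1 := by
    rw [← quadratic_form_conj_diagonal U (fun _ => 1) g]
    simp [hU']
  rw [h0, hAU, quadratic_form_conj_diagonal, Finset.mul_sum]
  refine Finset.sum_le_sum fun k _ => ?_
  nlinarith [mul_le_mul_of_nonneg_left (hk k) (sq_nonneg ((Uᵀ *ᵥ g) k))]

variable {Ω : Type*} [MeasurableSpace Ω] {ν : Measure Ω} [IsProbabilityMeasure ν]

/-- The moment conditions on a random vector `x` of the lower tail bound. -/
structure WhitenedVector (ν : Measure Ω) (x : Ω → ι → ℝ) (d : ι → ℝ) (b : ℝ) : Prop where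
  measurable : Measurable x
  dotProduct_le : ∀ ω, x ω ⬝ᵥ x ω ≤ b
  integral_mul : ∀ i j, ∫ ω, x ω i * x ω j ∂ν = if i = j then 1 - d i else 0

variable {x : Ω → ι → ℝ} {d : ι → ℝ} {b : ℝ}

omit [IsProbabilityMeasure ν] in
theorem WhitenedVector.sq_le (hx : WhitenedVector ν x d b) (ω : Ω) (i : ι) : x ω i ^ 2 ≤ b := by
  refine le_trans ?_ (hx.dotProduct_le ω)
  rw [dotProduct, sq]
  exact Finset.single_le_sum (f := fun i => x ω i * x ω i) (fun i _ => mul_self_nonneg _)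
    (Finset.mem_univ i)

theorem WhitenedVector.integrable_mul (hx : WhitenedVector ν x d b) (i j : ι) :
    Integrable (fun ω => x ω i * x ω j) ν := by
  have hi : Measurable fun ω => x ω i := (measurable_pi_apply i).comp hx.measurable
  have hj : Measurable fun ω => x ω j := (measurable_pi_apply j).comp hx.measurable
  refine Integrable.of_bound (hi.mul hj).aestronglyMeasurable b
    (Filter.Eventually.of_forall fun ω => ?_)
  rw [Real.norm_eq_abs, abs_le]
  constructor <;> nlinarith [hx.sq_le ω i, hx.sq_le ω j, sq_nonneg (x ω i + x ω j),
    sq_nonneg (x ω i - x ω j)]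

omit [DecidableEq ι] in
theorem dotProduct_mulVec_eq_sum (M : Matrix ι ι ℝ) (y : ι → ℝ) :
    y ⬝ᵥ (M *ᵥ y) = ∑ i, ∑ j, M i j * (y i * y j) := by
  simp only [dotProduct, mulVec, Finset.mul_sum]
  exact Finset.sum_congr rfl fun i _ => Finset.sum_congr rfl fun j _ => by ring

theorem WhitenedVector.integrable_quadratic (hx : WhitenedVector ν x d b) (M : Matrix ι ι ℝ) :
    Integrable (fun ω => x ω ⬝ᵥ (M *ᵥ x ω)) ν := by
  simp only [dotProduct_mulVec_eq_sum]
  exact integrable_finsetSum _ fun i _ => integrable_finsetSum _ fun j _ =>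
    (hx.integrable_mul i j).const_mul _

theorem WhitenedVector.integral_quadratic (hx : WhitenedVector ν x d b) (M : Matrix ι ι ℝ) :
    ∫ ω, x ω ⬝ᵥ (M *ᵥ x ω) ∂ν = M.trace - ∑ i, d i * M i i := by
  have hint : ∀ i j, Integrable (fun ω => M i j * (x ω i * x ω j)) ν := fun i j =>
    (hx.integrable_mul i j).const_mul _
  have h1 : ∫ ω, ∑ i, ∑ j, M i j * (x ω i * x ω j) ∂ν
      = ∑ i, ∑ j, ∫ ω, M i j * (x ω i * x ω j) ∂ν := by
    rw [integral_finsetSum _ fun i _ => integrable_finsetSum _ fun j _ => hint i j]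
    exact Finset.sum_congr rfl fun i _ => integral_finsetSum _ fun j _ => hint i j
  simp only [dotProduct_mulVec_eq_sum]
  rw [h1, trace, ← Finset.sum_sub_distrib]
  refine Finset.sum_congr rfl fun i _ => ?_
  simp only [integral_const_mul, hx.integral_mul]
  simp
  ring

/-- The expected decrease is `p / 4` times the trace of `(1 - diagonal d) * A⁻¹ ^ (p + 1)`.
Linearizing at `16 / m` and paying `1 / m` for the part with `d` leaves the rate `15 / m`. -/
theorem WhitenedVector.lintegral_trace_inv_pow_add_le (hx : WhitenedVector ν x d b)
    {A : Matrix ι ι ℝ} {c : ℝ} (hA : SymmGE A c) (hc : 0 < c) {m p : ℕ} (hm : 0 < m)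
    (hAd : ∀ g : ι → ℝ, ∑ i, m * d i * g i ^ 2 ≤ g ⬝ᵥ (A *ᵥ g)) (hp : 1 ≤ p)
    (hb : 2 * p * b ≤ c) :
    ∫⁻ ω, ENNReal.ofReal ((A + vecMulVec (x ω) (x ω))⁻¹ ^ p).trace ∂ν ≤
      ENNReal.ofReal ((1 - 15 * p / (4 * m)) * (A⁻¹ ^ p).trace
        + p / 4 * (Fintype.card ι * (16 / m) ^ (p + 1))) := by
  have hm' : (0 : ℝ) < m := by exact_mod_cast hm
  have hle : ∀ ω, ((A + vecMulVec (x ω) (x ω))⁻¹ ^ p).trace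
      ≤ (A⁻¹ ^ p).trace - p / 4 * (x ω ⬝ᵥ ((A⁻¹ ^ (p + 1)) *ᵥ x ω)) := fun ω =>
    hA.trace_inv_pow_add_vecMulVec_le hc (x ω) hp
      ((mul_le_mul_of_nonneg_left (hx.dotProduct_le ω) (by positivity)).trans hb)
  have hint : Integrable (fun ω => (A⁻¹ ^ p).trace
      - p / 4 * (x ω ⬝ᵥ ((A⁻¹ ^ (p + 1)) *ᵥ x ω))) ν :=
    (integrable_const _).sub ((hx.integrable_quadratic _).const_mul _)
  refine (lintegral_mono fun ω => ENNReal.ofReal_le_ofReal (hle ω)).trans ?_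
  rw [← ofReal_integral_eq_lintegral_ofReal hint (Filter.Eventually.of_forall fun ω =>
    ((hA.add_vecMulVec (x ω)).trace_inv_pow_nonneg hc p).trans (hle ω))]
  refine ENNReal.ofReal_le_ofReal ?_
  rw [integral_sub (integrable_const _) ((hx.integrable_quadratic _).const_mul _),
    integral_const_mul, hx.integral_quadratic, integral_const, probReal_univ, one_smul]
  have h1 := hA.sum_mul_inv_pow_le hc hAd p
  have h2 := hA.le_trace_inv_pow_succ hc p (t := 16 / m) (by positivity)
  have h3 : ∑ i, m * d i * (A⁻¹ ^ (p + 1)) i i = m * ∑ i, d i * (A⁻¹ ^ (p + 1)) i i := by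
    rw [Finset.mul_sum]; exact Finset.sum_congr rfl fun i _ => by ring
  rw [h3] at h1
  have h4 : ∑ i, d i * (A⁻¹ ^ (p + 1)) i i ≤ (A⁻¹ ^ p).trace / m := by
    rw [le_div_iff₀ hm']; linarith
  have h5 : (0 : ℝ) ≤ p / 4 := by positivity
  have h6 : (1 - 15 * p / (4 * m)) * (A⁻¹ ^ p).trace
        + p / 4 * (Fintype.card ι * (16 / m) ^ (p + 1))
      = (A⁻¹ ^ p).trace - p / 4 * ((16 / m * (A⁻¹ ^ p).trace
        - Fintype.card ι * (16 / m : ℝ) ^ (p + 1)) - (A⁻¹ ^ p).trace / m) := by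
    field_simp
    ring
  rw [h6]
  have h7 := mul_le_mul_of_nonneg_left (sub_le_sub h2 h4) h5
  linarith

/-- An affine contraction iterated `k` times. Its fixed point is `16 / 15 * s * (16 / m) ^ p` with
`s = Fintype.card ι`, rounded up to a factor `2`; `4 * p ≤ m` keeps the rate nonnegative. -/
theorem WhitenedVector.lintegral_pi_trace_inv_pow_le (hx : WhitenedVector ν x d b) {c : ℝ}
    (hc : 0 < c) {m p : ℕ} (hm : 0 < m) (hp : 1 ≤ p) (hb : 2 * p * b ≤ c)
    (hpm : 4 * p ≤ m) (k : ℕ) :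
    ∀ A : Matrix ι ι ℝ, SymmGE A c → (∀ g : ι → ℝ, ∑ i, m * d i * g i ^ 2 ≤ g ⬝ᵥ (A *ᵥ g)) →
    ∫⁻ ω : Fin k → Ω, ENNReal.ofReal
        ((A + ∑ j, vecMulVec (x (ω j)) (x (ω j)))⁻¹ ^ p).trace ∂(Measure.pi fun _ => ν) ≤
      ENNReal.ofReal ((1 - 15 * p / (4 * m)) ^ k * (A⁻¹ ^ p).trace
        + (1 - (1 - 15 * p / (4 * m)) ^ k) * (2 * Fintype.card ι * (16 / m) ^ p)) := by
  have hm' : (0 : ℝ) < m := by exact_mod_cast hm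
  have hpm' : (4 : ℝ) * p ≤ m := by exact_mod_cast hpm
  set ϑ : ℝ := 1 - 15 * p / (4 * m) with hϑ
  have hϑ0 : 0 ≤ ϑ := by
    rw [hϑ, sub_nonneg, div_le_one (by positivity)]
    linarith
  have hϑ1 : ϑ ≤ 1 := by
    have : (0 : ℝ) ≤ 15 * p / (4 * m) := by positivity
    rw [hϑ]; linarith
  induction k with
  | zero =>
    intro A hA hAd
    simp
  | succ k ih =>
    intro A hA hAd
    set e := MeasurableEquiv.piFinSuccAbove (fun _ : Fin (k + 1) => Ω) 0 with he
    have hmp : MeasurePreserving e (Measure.pi fun _ : Fin (k + 1) => ν)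
        (ν.prod (Measure.pi fun _ : Fin k => ν)) :=
      measurePreserving_piFinSuccAbove (fun _ : Fin (k + 1) => ν) 0
    set G : Ω × (Fin k → Ω) → ℝ≥0∞ := fun q => ENNReal.ofReal
      ((A + vecMulVec (x q.1) (x q.1) + ∑ j, vecMulVec (x (q.2 j)) (x (q.2 j)))⁻¹ ^ p).trace with hG
    have h1 : ∀ ω : Fin (k + 1) → Ω, ENNReal.ofReal
        ((A + ∑ j, vecMulVec (x (ω j)) (x (ω j)))⁻¹ ^ p).trace = G (e ω) := by
      intro ω
      simp only [hG, Fin.sum_univ_succ, ← add_assoc]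
      rfl
    simp only [h1]
    rw [hmp.lintegral_comp_emb e.measurableEmbedding]
    refine (lintegral_prod_le _).trans ?_
    have hT : ∀ ω, 0 ≤ ((A + vecMulVec (x ω) (x ω))⁻¹ ^ p).trace := fun ω =>
      (hA.add_vecMulVec (x ω)).trace_inv_pow_nonneg hc p
    have hϑk : ϑ ^ k ≤ 1 := pow_le_one₀ hϑ0 hϑ1
    have hQ : 0 ≤ (1 - ϑ ^ k) * (2 * Fintype.card ι * (16 / m : ℝ) ^ p) :=
      mul_nonneg (by linarith) (by positivity)
    calc ∫⁻ ω, ∫⁻ ω', G (ω, ω') ∂(Measure.pi fun _ : Fin k => ν) ∂ν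
        ≤ ∫⁻ ω, (ENNReal.ofReal (ϑ ^ k)
              * ENNReal.ofReal ((A + vecMulVec (x ω) (x ω))⁻¹ ^ p).trace
            + ENNReal.ofReal ((1 - ϑ ^ k) * (2 * Fintype.card ι * (16 / m) ^ p))) ∂ν := by
          refine lintegral_mono fun ω => ?_
          refine (ih _ (hA.add_vecMulVec (x ω)) fun g => (hAd g).trans ?_).trans ?_
          · rw [add_mulVec, dotProduct_add, vecMulVec_mulVec]
            have : 0 ≤ g ⬝ᵥ MulOpposite.op (x ω ⬝ᵥ g) • x ω := by
              rw [dotProduct_smul, dotProduct_comm g (x ω)]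
              exact mul_self_nonneg _
            linarith
          · rw [← ENNReal.ofReal_mul (by positivity), ← ENNReal.ofReal_add
              (mul_nonneg (by positivity) (hT ω)) hQ]
      _ = ENNReal.ofReal (ϑ ^ k)
              * ∫⁻ ω, ENNReal.ofReal ((A + vecMulVec (x ω) (x ω))⁻¹ ^ p).trace ∂ν
            + ENNReal.ofReal ((1 - ϑ ^ k) * (2 * Fintype.card ι * (16 / m) ^ p)) := by
          rw [lintegral_add_right _ measurable_const, lintegral_const_mul' _ _
            ENNReal.ofReal_ne_top,
            lintegral_const, measure_univ, mul_one]
      _ ≤ ENNReal.ofReal (ϑ ^ k) * ENNReal.ofReal (ϑ * (A⁻¹ ^ p).trace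
              + p / 4 * (Fintype.card ι * (16 / m) ^ (p + 1)))
            + ENNReal.ofReal ((1 - ϑ ^ k) * (2 * Fintype.card ι * (16 / m) ^ p)) := by
          gcongr
          exact hx.lintegral_trace_inv_pow_add_le hA hc hm hAd hp hb
      _ ≤ _ := by
          have hTA := hA.trace_inv_pow_nonneg hc p
          rw [← ENNReal.ofReal_mul (by positivity), ← ENNReal.ofReal_add
            (mul_nonneg (by positivity) (by positivity)) hQ]
          refine ENNReal.ofReal_le_ofReal ?_
          have h2 : (p : ℝ) / 4 * (Fintype.card ι * (16 / m) ^ (p + 1))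
              ≤ (1 - ϑ) * (2 * Fintype.card ι * (16 / m : ℝ) ^ p) := by
            have h3 : (1 - ϑ) * (2 * Fintype.card ι * (16 / m : ℝ) ^ p)
                - (p : ℝ) / 4 * (Fintype.card ι * (16 / m) ^ (p + 1))
                = 7 / 2 * p / m * Fintype.card ι * (16 / m) ^ p := by
              rw [hϑ, pow_succ]
              field_simp
              ring
            have h4 : 0 ≤ 7 / 2 * p / m * Fintype.card ι * (16 / m : ℝ) ^ p := by positivity
            linarith
          have h5 := mul_le_mul_of_nonneg_left h2 (pow_nonneg hϑ0 k)
          rw [pow_succ ϑ k]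
          linarith

omit [DecidableEq ι] in
theorem SymmGE.add_sum_vecMulVec {A : Matrix ι ι ℝ} {c : ℝ} (hA : SymmGE A c) {m : ℕ}
    (z : Fin m → ι → ℝ) : SymmGE (A + ∑ j, vecMulVec (z j) (z j)) c := by
  induction m with
  | zero => simpa using hA
  | succ m ih =>
    rw [Fin.sum_univ_castSucc, ← add_assoc]
    exact (ih fun j => z j.castSucc).add_vecMulVec _

theorem SymmGE.continuous_trace_inv_pow {A : Matrix ι ι ℝ} {c : ℝ} (hA : SymmGE A c) (hc : 0 < c)
    (m p : ℕ) : Continuous fun z : Fin m → ι → ℝ =>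
      ((A + ∑ j, vecMulVec (z j) (z j))⁻¹ ^ p).trace := by
  have h1 : Continuous fun z : Fin m → ι → ℝ => A + ∑ j, vecMulVec (z j) (z j) :=
    continuous_const.add (continuous_finsetSum _ fun j _ =>
      (continuous_apply j).matrix_vecMulVec (continuous_apply j))
  have hdet : ∀ z : Fin m → ι → ℝ, (A + ∑ j, vecMulVec (z j) (z j)).det ≠ 0 := by
    intro z
    obtain ⟨-, -, -, -, -, -, hinv, -⟩ := (hA.add_sum_vecMulVec z).exists_inv_eq hc
    intro h
    have h2 := congrArg Matrix.det hinv
    rw [det_mul, h, zero_mul, det_one] at h2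
    exact zero_ne_one h2
  have h2 : Continuous fun z : Fin m → ι → ℝ => (A + ∑ j, vecMulVec (z j) (z j))⁻¹ := by
    simp only [inv_def, Ring.inverse_eq_inv']
    exact (h1.matrix_det.inv₀ hdet).smul h1.matrix_adjugate
  exact (h2.pow p).matrix_trace

/-- Both bases are at most `exp (-3)`, since `2 ≤ exp (3 / 4)` and `exp 3 ≤ 21`. -/
theorem two_mul_exp_pow_add_le (p : ℕ) :
    (2 * Real.exp (-(15 / 4))) ^ p + 2 * (1 / 21 : ℝ) ^ p ≤ 3 * Real.exp (-(3 * p)) := by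
  have he := Real.exp_one_gt_d9
  have he' := Real.exp_one_lt_d9
  have h3 : Real.exp 3 = Real.exp 1 ^ 3 := by
    rw [← Real.exp_nat_mul]; norm_num
  have h1 : (2 : ℝ) ≤ Real.exp (3 / 4) := by
    refine le_of_pow_le_pow_left₀ (n := 4) (by norm_num) (Real.exp_pos _).le ?_
    rw [← Real.exp_nat_mul]
    have : ((4 : ℕ) : ℝ) * (3 / 4) = 3 := by norm_num
    rw [this, h3]
    calc (2 : ℝ) ^ 4 ≤ 2.7 ^ 3 := by norm_num
      _ ≤ _ := by gcongr; linarith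
  have h2 : 2 * Real.exp (-(15 / 4)) ≤ Real.exp (-3) := by
    calc 2 * Real.exp (-(15 / 4)) ≤ Real.exp (3 / 4) * Real.exp (-(15 / 4)) := by gcongr
      _ = Real.exp (-3) := by rw [← Real.exp_add]; norm_num
  have h4 : (1 / 21 : ℝ) ≤ Real.exp (-3) := by
    rw [Real.exp_neg, ← one_div]
    refine one_div_le_one_div_of_le (Real.exp_pos _) ?_
    rw [h3]
    calc Real.exp 1 ^ 3 ≤ 2.72 ^ 3 := by gcongr; linarith
      _ ≤ 21 := by norm_num
  have h5 : Real.exp (-(3 * p)) = Real.exp (-3) ^ p := by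
    rw [← Real.exp_nat_mul]; congr 1; ring
  rw [h5]
  have h6 := pow_le_pow_left₀ (by positivity) h2 p
  have h7 := pow_le_pow_left₀ (by norm_num) h4 p
  linarith

/-- Lower tail bound for the smallest eigenvalue of a sum of independent random rank one matrices,
by the method of moments. -/
theorem WhitenedVector.measure_lower_tail_le (hx : WhitenedVector ν x d b) (hd : ∀ i, 0 ≤ d i)
    {m p : ℕ} (hp : 1 ≤ p) (hpm : 4 * p ≤ m) (hb : 2 * p * b ≤ m / 672) :
    (Measure.pi fun _ : Fin m => ν) {ω : Fin m → Ω | ∃ g : ι → ℝ,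
        ∑ j, (x (ω j) ⬝ᵥ g) ^ 2 + ∑ i, m * d i * g i ^ 2 < m / 672 * (g ⬝ᵥ g)} ≤
      ENNReal.ofReal (3 * Fintype.card ι * Real.exp (-(3 * p))) := by
  have hm : 0 < m := by omega
  have hm' : (0 : ℝ) < m := by exact_mod_cast hm
  have hpm' : (4 : ℝ) * p ≤ m := by exact_mod_cast hpm
  set c : ℝ := m / 672 with hcdef
  have hc : 0 < c := by positivity
  -- The process starts from the regularization plus an artificial `c`, which makes the matrix
  -- invertible. Reaching the lower bound `2 * c` at the end leaves `c` once the artificial part is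
  -- removed.
  set A : Matrix ι ι ℝ := diagonal fun i => c + m * d i with hAdef
  have hquad : ∀ g : ι → ℝ, g ⬝ᵥ (A *ᵥ g) = c * (g ⬝ᵥ g) + ∑ i, m * d i * g i ^ 2 := by
    intro g
    rw [dotProduct, dotProduct, Finset.mul_sum, ← Finset.sum_add_distrib]
    refine Finset.sum_congr rfl fun i _ => ?_
    rw [hAdef, mulVec_diagonal]
    ring
  have hgg : ∀ g : ι → ℝ, 0 ≤ g ⬝ᵥ g := fun g => Finset.sum_nonneg fun i _ => mul_self_nonneg _
  have hA : SymmGE A c := by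
    refine ⟨diagonal_transpose _, fun g => ?_⟩
    rw [hquad]
    have : 0 ≤ ∑ i, m * d i * g i ^ 2 := Finset.sum_nonneg fun i _ =>
      mul_nonneg (mul_nonneg hm'.le (hd i)) (sq_nonneg _)
    linarith
  have hAd : ∀ g : ι → ℝ, ∑ i, m * d i * g i ^ 2 ≤ g ⬝ᵥ (A *ᵥ g) := by
    intro g
    rw [hquad]
    have := mul_nonneg hc.le (hgg g)
    linarith
  set Φ : (Fin m → Ω) → ℝ := fun ω =>
    ((A + ∑ j, vecMulVec (x (ω j)) (x (ω j)))⁻¹ ^ p).trace with hΦ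
  have hmeas : Measurable Φ :=
    (hA.continuous_trace_inv_pow hc m p).measurable.comp
      (measurable_pi_lambda _ fun j => hx.measurable.comp (measurable_pi_apply j))
  have hsub : {ω : Fin m → Ω | ∃ g : ι → ℝ,
      ∑ j, (x (ω j) ⬝ᵥ g) ^ 2 + ∑ i, m * d i * g i ^ 2 < m / 672 * (g ⬝ᵥ g)}
      ⊆ {ω | ENNReal.ofReal ((1 / (2 * c)) ^ p) ≤ ENNReal.ofReal (Φ ω)} := by
    rintro ω ⟨g, hg⟩
    by_contra hlt
    have hlt' : Φ ω < (1 / (2 * c)) ^ p := by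
      by_contra h
      exact hlt (ENNReal.ofReal_le_ofReal (not_lt.1 h))
    have h1 := ((hA.add_sum_vecMulVec fun j => x (ω j)).of_trace_inv_pow_lt hc (by positivity)
      hlt').2 g
    rw [add_mulVec, dotProduct_add, hquad, sum_mulVec, dotProduct_sum] at h1
    have h2 : ∀ j, g ⬝ᵥ (vecMulVec (x (ω j)) (x (ω j)) *ᵥ g) = (x (ω j) ⬝ᵥ g) ^ 2 := by
      intro j
      rw [vecMulVec_mulVec, dotProduct_smul, dotProduct_comm g (x (ω j)), sq]
      rfl
    simp only [h2] at h1
    rw [← hcdef] at hg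
    linarith
  have hpos : (0 : ℝ) < (1 / (2 * c)) ^ p := by positivity
  refine (measure_mono hsub).trans ((meas_ge_le_lintegral_div hmeas.ennreal_ofReal.aemeasurable
    (ENNReal.ofReal_pos.2 hpos).ne' ENNReal.ofReal_ne_top).trans ?_)
  refine (ENNReal.div_le_div_right (hx.lintegral_pi_trace_inv_pow_le hc hm hp hb hpm m A hA hAd)
    _).trans ?_
  rw [← ENNReal.ofReal_div_of_pos hpos]
  refine ENNReal.ofReal_le_ofReal ?_
  rw [div_le_iff₀ hpos]
  set ϑ : ℝ := 1 - 15 * p / (4 * m) with hϑ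
  have hϑ0 : 0 ≤ ϑ := by
    rw [hϑ, sub_nonneg, div_le_one (by positivity)]
    linarith
  have hϑm : ϑ ^ m ≤ Real.exp (-(15 / 4)) ^ p := by
    have h1 : ϑ ≤ Real.exp (-(15 * p / (4 * m))) := by
      have := Real.add_one_le_exp (-(15 * p / (4 * m) : ℝ))
      rw [hϑ]; linarith
    refine (pow_le_pow_left₀ hϑ0 h1 m).trans_eq ?_
    rw [← Real.exp_nat_mul, ← Real.exp_nat_mul]
    congr 1
    field_simp
  have hϑm0 : 0 ≤ ϑ ^ m := pow_nonneg hϑ0 m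
  have hT := hA.trace_inv_pow_le hc p
  have hT0 := hA.trace_inv_pow_nonneg hc p
  set s : ℝ := (Fintype.card ι : ℝ) with hs
  have hs0 : 0 ≤ s := by positivity
  have h1 : ϑ ^ m * (A⁻¹ ^ p).trace ≤ Real.exp (-(15 / 4)) ^ p * (s * (1 / c) ^ p) :=
    mul_le_mul hϑm hT hT0 (by positivity)
  have h2 : (1 - ϑ ^ m) * (2 * s * (16 / m) ^ p) ≤ 2 * s * (16 / m : ℝ) ^ p :=
    mul_le_of_le_one_left (by positivity) (by linarith)
  have h3 := mul_le_mul_of_nonneg_left (two_mul_exp_pow_add_le p)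
    (mul_nonneg hs0 hpos.le)
  have h4 : Real.exp (-(15 / 4)) ^ p * (s * (1 / c) ^ p)
      = s * (1 / (2 * c)) ^ p * (2 * Real.exp (-(15 / 4))) ^ p := by
    have : (1 / c) ^ p = (1 / (2 * c)) ^ p * 2 ^ p := by
      rw [← mul_pow]; congr 1; field_simp
    rw [this, mul_pow]; ring
  -- Here `m / 672` enters: `2 * c * (16 / m) = 32 / 672 = 1 / 21`.
  have h5 : 2 * s * (16 / m : ℝ) ^ p = s * (1 / (2 * c)) ^ p * (2 * (1 / 21 : ℝ) ^ p) := by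
    have : (16 / m : ℝ) ^ p = (1 / (2 * c)) ^ p * (1 / 21) ^ p := by
      rw [← mul_pow]; congr 1; rw [hcdef]; field_simp; norm_num
    rw [this]; ring
  rw [h4] at h1
  rw [h5] at h2 ⊢
  linarith

end LowerTail

/-! ### Regression over a finite dimensional subspace -/

section NoiseTail

/-- The power series of `cosh √z` has nonnegative coefficients, so the power mean inequality applies
term by term to the `a i ^ 2`. -/
theorem cosh_sqrt_average_sq_le {ι : Type*} [Fintype ι] [Nonempty ι] (a : ι → ℝ) :
    Real.cosh (√((∑ i, a i ^ 2) / Fintype.card ι)) ≤ (∑ i, Real.cosh (a i)) / Fintype.card ι := by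
  have hn : (0 : ℝ) < Fintype.card ι := by exact_mod_cast Fintype.card_pos
  have h1 : HasSum (fun k : ℕ => (∑ i, a i ^ (2 * k) / ((2 * k).factorial : ℝ)) / Fintype.card ι)
      ((∑ i, Real.cosh (a i)) / Fintype.card ι) :=
    (hasSum_sum fun i _ => Real.hasSum_cosh (a i)).div_const _
  refine hasSum_le (fun k => ?_) (Real.hasSum_cosh _) h1
  rw [pow_mul, Real.sq_sqrt (by positivity), ← Finset.sum_div, div_right_comm]
  gcongr
  have h2 := Real.pow_arith_mean_le_arith_mean_pow Finset.univ (fun _ => 1 / (Fintype.card ι : ℝ))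
    (fun i => a i ^ 2) (fun _ _ => by positivity)
    (by rw [Finset.sum_const, Finset.card_univ, nsmul_eq_mul]; field_simp)
    (fun _ _ => sq_nonneg _) k
  simp only [← Finset.mul_sum, ← pow_mul, one_div] at h2
  rw [div_eq_inv_mul, div_eq_inv_mul]
  exact h2

variable {Ω : Type*} [MeasurableSpace Ω] {ν : Measure Ω} [IsProbabilityMeasure ν]

omit [IsProbabilityMeasure ν] in
theorem integrable_exp_of_abs_le_one [IsFiniteMeasure ν] {Z : Ω → ℝ} (hZ : AEStronglyMeasurable Z ν)
    (hle : ∀ᵐ ω ∂ν, |Z ω| ≤ 1) : Integrable (fun ω => Real.exp (Z ω)) ν := by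
  refine Integrable.of_bound (Real.continuous_exp.comp_aestronglyMeasurable hZ) (Real.exp 1) ?_
  filter_upwards [hle] with ω h
  rw [Real.norm_eq_abs, Real.abs_exp]
  exact Real.exp_le_exp.2 (le_of_abs_le h)

theorem integral_exp_le_one_add {Z : Ω → ℝ} (hZ : AEStronglyMeasurable Z ν)
    (hle : ∀ᵐ ω ∂ν, |Z ω| ≤ 1) (h0 : ∫ ω, Z ω ∂ν = 0) :
    ∫ ω, Real.exp (Z ω) ∂ν ≤ 1 + ∫ ω, Z ω ^ 2 ∂ν := by
  have hi : Integrable Z ν := Integrable.of_bound hZ 1 hle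
  have hi2 : Integrable (fun ω => Z ω ^ 2) ν := by
    refine Integrable.of_bound (hZ.pow 2) 1 ?_
    filter_upwards [hle] with ω h
    rw [Real.norm_eq_abs, abs_pow]
    exact pow_le_one₀ (abs_nonneg _) h
  have h1 : ∫ ω, Real.exp (Z ω) ∂ν ≤ ∫ ω, (1 + Z ω + Z ω ^ 2) ∂ν := by
    refine integral_mono_ae (integrable_exp_of_abs_le_one hZ hle)
      (((integrable_const _).add hi).add hi2) ?_
    filter_upwards [hle] with ω h
    have := le_of_abs_le (Real.abs_exp_sub_one_sub_id_le h)
    linarith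
  have h2 : ∫ ω, (1 + Z ω + Z ω ^ 2) ∂ν = 1 + ∫ ω, Z ω ^ 2 ∂ν := by
    have h3 : Integrable (fun ω => 1 + Z ω) ν := (integrable_const (1 : ℝ)).add hi
    rw [integral_add h3 hi2, integral_add (integrable_const (1 : ℝ)) hi, h0]
    simp
  exact h1.trans_eq h2

/-- From `exp z ≤ 1 + z + z ^ 2` for `|z| ≤ 1`, each factor has mean at most `1 + 1 / m ≤ exp (1 /
m)`. -/
theorem integral_pi_exp_sum_le {Z : Ω → ℝ} (hZ : AEStronglyMeasurable Z ν)
    (hle : ∀ᵐ ω ∂ν, |Z ω| ≤ 1) (h0 : ∫ ω, Z ω ∂ν = 0) {m : ℕ} (hm : 0 < m)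
    (hvar : ∫ ω, Z ω ^ 2 ∂ν ≤ 1 / m) :
    Integrable (fun ω : Fin m → Ω => Real.exp (∑ j, Z (ω j))) (Measure.pi fun _ => ν) ∧
    ∫ ω : Fin m → Ω, Real.exp (∑ j, Z (ω j)) ∂(Measure.pi fun _ => ν) ≤ Real.exp 1 := by
  simp only [Real.exp_sum]
  refine ⟨Integrable.fintype_prod fun _ => integrable_exp_of_abs_le_one hZ hle, ?_⟩
  rw [integral_fintype_prod_eq_pow (ι := Fin m) (fun ω => Real.exp (Z ω)), Fintype.card_fin]
  have h1 := integral_exp_le_one_add hZ hle h0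
  have h2 : ∫ ω, Real.exp (Z ω) ∂ν ≤ Real.exp (1 / m) := by
    have := Real.add_one_le_exp (1 / m : ℝ)
    linarith
  refine (pow_le_pow_left₀ (integral_nonneg fun ω => (Real.exp_pos _).le) h2 m).trans_eq ?_
  rw [← Real.exp_nat_mul]
  congr 1
  field_simp

/-- Exponential tail of the Euclidean norm of a sum of independent bounded centred vectors. -/
theorem measure_le_sqrt_average_sum_sq_le {ι : Type*} [Fintype ι] [Nonempty ι] {Z : ι → Ω → ℝ}
    (hZ : ∀ i, AEStronglyMeasurable (Z i) ν) (hle : ∀ i, ∀ᵐ ω ∂ν, |Z i ω| ≤ 1)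
    (h0 : ∀ i, ∫ ω, Z i ω ∂ν = 0) {m : ℕ} (hm : 0 < m)
    (hvar : ∀ i, ∫ ω, Z i ω ^ 2 ∂ν ≤ 1 / m) {t : ℝ} (ht : 0 ≤ t) :
    (Measure.pi fun _ : Fin m => ν)
      {ω : Fin m → Ω | t ≤ √((∑ i, (∑ j, Z i (ω j)) ^ 2) / Fintype.card ι)}
      ≤ ENNReal.ofReal (2 * Real.exp 1 * Real.exp (-t)) := by
  have hn : (0 : ℝ) < Fintype.card ι := by exact_mod_cast Fintype.card_pos
  have hcosh : ∀ i, Integrable (fun ω : Fin m → Ω => Real.cosh (∑ j, Z i (ω j)))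
        (Measure.pi fun _ => ν) ∧
      ∫ ω : Fin m → Ω, Real.cosh (∑ j, Z i (ω j)) ∂(Measure.pi fun _ => ν) ≤ Real.exp 1 := by
    intro i
    obtain ⟨hi, hb⟩ := integral_pi_exp_sum_le (hZ i) (hle i) (h0 i) hm (hvar i)
    obtain ⟨hi', hb'⟩ := integral_pi_exp_sum_le (Z := fun ω => -Z i ω) (hZ i).neg
      (by simpa using hle i) (by rw [integral_neg, h0 i, neg_zero]) hm (by simpa using hvar i)
    simp only [Finset.sum_neg_distrib] at hi' hb'
    simp only [Real.cosh_eq]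
    refine ⟨(hi.add hi').div_const 2, ?_⟩
    rw [integral_div, integral_add hi hi']
    linarith
  -- Averaging the hyperbolic cosines over the coordinates, rather than taking a union bound, avoids
  -- a loss of order `log s` for `s` coordinates.
  set G : (Fin m → Ω) → ℝ := fun ω => (∑ i, Real.cosh (∑ j, Z i (ω j))) / Fintype.card ι with hG
  have hGi : Integrable G (Measure.pi fun _ => ν) :=
    (integrable_finsetSum _ fun i _ => (hcosh i).1).div_const _
  have hGle : ∫ ω, G ω ∂(Measure.pi fun _ => ν) ≤ Real.exp 1 := by
    rw [hG, integral_div, integral_finsetSum _ fun i _ => (hcosh i).1, div_le_iff₀ hn]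
    refine (Finset.sum_le_card_nsmul _ _ _ fun i _ => (hcosh i).2).trans_eq ?_
    rw [Finset.card_univ, nsmul_eq_mul, mul_comm]
  have hG0 : ∀ ω, 0 ≤ G ω := fun ω =>
    div_nonneg (Finset.sum_nonneg fun i _ => (Real.cosh_pos _).le) hn.le
  have hsub : {ω : Fin m → Ω | t ≤ √((∑ i, (∑ j, Z i (ω j)) ^ 2) / Fintype.card ι)}
      ⊆ {ω | Real.cosh t ≤ G ω} := by
    intro ω hω
    refine le_trans ?_ (cosh_sqrt_average_sq_le fun i => ∑ j, Z i (ω j))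
    rw [Real.cosh_le_cosh, abs_of_nonneg ht, abs_of_nonneg (Real.sqrt_nonneg _)]
    exact hω
  refine (measure_mono hsub).trans ?_
  have h1 := mul_meas_ge_le_integral_of_nonneg (Filter.Eventually.of_forall hG0) hGi (Real.cosh t)
  rw [← ofReal_measureReal]
  refine ENNReal.ofReal_le_ofReal ?_
  have h2 : Real.exp t / 2 ≤ Real.cosh t := by
    rw [Real.cosh_eq]
    have := Real.exp_pos (-t)
    linarith
  set P := (Measure.pi fun _ : Fin m => ν).real {ω | Real.cosh t ≤ G ω} with hP
  have hP0 : 0 ≤ P := measureReal_nonneg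
  have h3 : Real.exp t / 2 * P ≤ Real.exp 1 :=
    (mul_le_mul_of_nonneg_right h2 hP0).trans (h1.trans hGle)
  have h4 : Real.exp t * Real.exp (-t) = 1 := by rw [← Real.exp_add, add_neg_cancel, Real.exp_zero]
  have h5 := mul_le_mul_of_nonneg_right h3 (Real.exp_pos (-t)).le
  have h6 : Real.exp t / 2 * P * Real.exp (-t) = P / 2 := by
    calc _ = P / 2 * (Real.exp t * Real.exp (-t)) := by ring
      _ = P / 2 := by rw [h4, mul_one]
  linarith

end NoiseTail

/-! ### Excess risk as a population norm, and a basis adapted to it -/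

section Target

variable {X H : Type*} [MeasurableSpace X] [NormedAddCommGroup H] [InnerProductSpace ℝ H]
  [CompleteSpace H] [TopologicalSpace.SeparableSpace H] [RKHS ℝ H X ℝ] {κ : ℝ}
  {μ : Measure (X × ℝ)} [IsProbabilityMeasure μ]

-- Expanding the square, the cross term vanishes because the residual is orthogonal to functions of
-- the input.
omit [TopologicalSpace.SeparableSpace H] in
theorem excessRisk_eq (hκ : 0 ≤ κ) (hK : KernelAssumptions H κ) {f fstar : H}
    (hf : IsRegressionFunction μ fstar) {B : ℝ} (hB : ∀ᵐ p ∂μ, |p.2| ≤ B) :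
    excessRisk μ f fstar = √(∫ p, (f - fstar) p.1 ^ 2 ∂μ) := by
  have hm : ∀ g : H, Measurable fun p : X × ℝ => g p.1 := fun g =>
    (measurable_coe hK g).comp measurable_fst
  have hb : ∀ g : H, ∀ᵐ p ∂μ, ‖(p.2 - g p.1) ^ 2‖ ≤ (B + κ * ‖g‖) ^ 2 := by
    intro g
    filter_upwards [hB] with p hp
    rw [norm_pow, Real.norm_eq_abs]
    have h1 := abs_sub p.2 (g p.1)
    have h2 := abs_apply_le hκ hK g p.1
    gcongr
    linarith
  have hi : ∀ g : H, Integrable (fun p : X × ℝ => (p.2 - g p.1) ^ 2) μ := fun g =>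
    Integrable.of_bound ((measurable_snd.sub (hm g)).pow_const 2).aestronglyMeasurable _ (hb g)
  have hcross := hf.integral_residual_smul (h := fun x => (f - fstar) x)
    (measurable_coe hK (f - fstar)).stronglyMeasurable (c := κ * ‖f - fstar‖)
    (fun x => abs_apply_le hκ hK _ x)
  have hi2 : Integrable (fun p : X × ℝ => (f - fstar) p.1 ^ 2) μ := by
    refine Integrable.of_bound ((hm _).pow_const 2).aestronglyMeasurable ((κ * ‖f - fstar‖) ^ 2)
      (Filter.Eventually.of_forall fun p => ?_)
    rw [norm_pow, Real.norm_eq_abs]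
    have := abs_apply_le hκ hK (f - fstar) p.1
    gcongr
  have hi3 : Integrable (fun p : X × ℝ => (p.2 - fstar p.1) • (f - fstar) p.1) μ := by
    refine Integrable.of_bound ((measurable_snd.sub (hm _)).mul (hm _)).aestronglyMeasurable
      ((B + κ * ‖fstar‖) * (κ * ‖f - fstar‖)) ?_
    filter_upwards [hB] with p hp
    rw [norm_smul, Real.norm_eq_abs, Real.norm_eq_abs]
    have h1 := abs_sub p.2 (fstar p.1)
    have h2 := abs_apply_le hκ hK fstar p.1
    have h3 := abs_apply_le hκ hK (f - fstar) p.1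
    have h4 := abs_nonneg p.2
    gcongr
    · linarith [abs_nonneg (fstar p.1)]
    · linarith
  unfold excessRisk risk
  congr 1
  rw [← integral_sub (hi f) (hi fstar)]
  have h1 : ∀ p : X × ℝ, (p.2 - f p.1) ^ 2 - (p.2 - fstar p.1) ^ 2
      = (f - fstar) p.1 ^ 2 - 2 * ((p.2 - fstar p.1) • (f - fstar) p.1) := by
    intro p
    rw [RKHS.coe_sub, Pi.sub_apply, smul_eq_mul]
    ring
  simp only [h1]
  rw [integral_sub hi2 (hi3.const_mul 2), integral_const_mul, hcross]
  ring

/-- An orthonormal basis of a finite dimensional subspace that is orthogonal for the second moment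
form of a distribution. -/
theorem exists_orthonormal_covariance_diagonal (hκ : 0 ≤ κ) (hK : KernelAssumptions H κ)
    (W : Submodule ℝ H) [FiniteDimensional ℝ W] {s : ℕ} (hs : Module.finrank ℝ W = s) :
    ∃ (e : Fin s → H) (σ : Fin s → ℝ), Orthonormal ℝ e ∧ (∀ i, e i ∈ W) ∧ (∀ i, 0 ≤ σ i) ∧
      (∀ g ∈ W, g = ∑ i, inner ℝ (e i) g • e i) ∧
      ∀ i j, ∫ p, e i p.1 * e j p.1 ∂μ = if i = j then σ i else 0 := by
  have hcov := isPositive_covariance (μ := μ) hκ hK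
  -- The compression of the covariance to `W`; its eigenbasis is orthogonal for both inner products.
  set T : W →ₗ[ℝ] W := (W.orthogonalProjectionOnto : H →ₗ[ℝ] W) ∘ₗ (covariance H μ : H →ₗ[ℝ] H)
    ∘ₗ W.subtype with hT
  have hTi : ∀ g h : W, inner ℝ (T g) h = inner ℝ (covariance H μ g) (h : H) := by
    intro g h
    exact Submodule.inner_orthogonalProjectionOnto_eq_of_mem_right h _
  have hsymm : T.IsSymmetric := by
    intro g h
    exact (hTi g h).trans ((hcov.1 (g : H) (h : H)).trans
      ((real_inner_comm _ _).trans ((hTi h g).symm.trans (real_inner_comm _ _))))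
  set b := hsymm.eigenvectorBasis hs with hb
  have hdiag : ∀ i j, ∫ p, (b i : H) p.1 * (b j : H) p.1 ∂μ
      = if i = j then hsymm.eigenvalues hs i else 0 := by
    intro i j
    rw [← inner_covariance hκ hK, ← hTi, hsymm.apply_eigenvectorBasis hs i, inner_smul_left,
      orthonormal_iff_ite.1 b.orthonormal i j]
    simp
  refine ⟨fun i => b i, hsymm.eigenvalues hs, ?_, fun i => (b i).2, fun i => ?_, fun g hg => ?_,
    hdiag⟩
  · exact b.orthonormal.comp_linearIsometry W.subtypeₗᵢ
  · have := hdiag i i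
    rw [if_pos rfl] at this
    rw [← this]
    exact integral_nonneg fun p => mul_self_nonneg _
  · have h1 := congrArg Subtype.val (b.sum_repr' ⟨g, hg⟩)
    simpa using h1.symm

end Target

/-! ### Empirical norm and noise on a fixed subspace -/

section TargetConcentration

open Matrix

variable {X H : Type*} [MeasurableSpace X] [NormedAddCommGroup H] [InnerProductSpace ℝ H]
  [CompleteSpace H] [TopologicalSpace.SeparableSpace H] [RKHS ℝ H X ℝ] {κ : ℝ}
  {μ : Measure (X × ℝ)} [IsProbabilityMeasure μ]

/-- Whitened coordinates on a finite dimensional subspace of the reproducing kernel Hilbert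
space. -/
theorem exists_whitenedVector (hκ : 0 ≤ κ) (hK : KernelAssumptions H κ)
    (W : Submodule ℝ H) [FiniteDimensional ℝ W] {s : ℕ} (hs : Module.finrank ℝ W = s) {ρ : ℝ}
    (hρ : 0 < ρ) :
    ∃ (x : X → Fin s → ℝ) (d : Fin s → ℝ), Measurable x ∧ (∀ i, 0 ≤ d i) ∧
      WhitenedVector μ (fun p => x p.1) d (κ ^ 2 / ρ) ∧
      ∀ g ∈ W, ∃ u : Fin s → ℝ, (∀ p, x p ⬝ᵥ u = g p) ∧
        u ⬝ᵥ u = ∫ p, g p.1 ^ 2 ∂μ + ρ * ‖g‖ ^ 2 ∧ ∑ i, d i * u i ^ 2 = ρ * ‖g‖ ^ 2 := by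
  obtain ⟨e, σ, he, heW, hσ, hg, hdiag⟩ :=
    exists_orthonormal_covariance_diagonal (μ := μ) hκ hK W hs
  have hpos : ∀ i, 0 < σ i + ρ := fun i => by linarith [hσ i]
  have hsq : ∀ i, √(σ i + ρ) ^ 2 = σ i + ρ := fun i => Real.sq_sqrt (hpos i).le
  have hsqrt : ∀ i, 0 < √(σ i + ρ) := fun i => Real.sqrt_pos.2 (hpos i)
  have hmeas : Measurable fun (q : X) (i : Fin s) => e i q / √(σ i + ρ) :=
    measurable_pi_lambda _ fun i => (measurable_coe hK (e i)).div_const _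
  -- Dividing by `√(σ i + ρ)` makes the Euclidean norm of the coordinates equal to the regularized
  -- population norm; the share `ρ / (σ i + ρ)` comes from the penalty and is not random.
  refine ⟨fun q i => e i q / √(σ i + ρ), fun i => ρ / (σ i + ρ), hmeas,
    fun i => (div_pos hρ (hpos i)).le, ⟨hmeas.comp measurable_fst, fun p => ?_, fun i j => ?_⟩,
    fun g hgW => ⟨fun i => √(σ i + ρ) * inner ℝ (e i) g, fun p => ?_, ?_, ?_⟩⟩
  · have h1 : ∑ i, ‖inner ℝ (e i) (featureMap H p.1)‖ ^ 2 ≤ ‖featureMap H p.1‖ ^ 2 :=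
      he.sum_inner_products_le _
    have h2 := norm_featureMap_le hκ hK p.1
    have h3 : ‖featureMap H p.1‖ ^ 2 ≤ κ ^ 2 := by gcongr
    rw [le_div_iff₀ hρ, dotProduct, Finset.sum_mul]
    refine le_trans (Finset.sum_le_sum fun i _ => ?_) (h1.trans h3)
    rw [real_inner_comm, inner_featureMap, Real.norm_eq_abs, sq_abs, ← sq, div_pow, hsq,
      div_mul_eq_mul_div, div_le_iff₀ (hpos i)]
    nlinarith [hσ i, mul_nonneg (sq_nonneg (e i p.1)) (hσ i)]
  · have h1 : ∀ p : X × ℝ, e i p.1 / √(σ i + ρ) * (e j p.1 / √(σ j + ρ))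
        = (e i p.1 * e j p.1) / (√(σ i + ρ) * √(σ j + ρ)) := fun p => by
      rw [div_mul_div_comm]
    simp only [h1]
    rw [integral_div, hdiag]
    split_ifs with hij
    · subst hij
      rw [← sq, hsq]
      have := (hpos i).ne'
      field_simp
      ring
    · rw [zero_div]
  · have h1 : g p = ∑ i, inner ℝ (e i) g * e i p := by
      conv_lhs => rw [← inner_featureMap, hg g hgW, inner_sum]
      refine Finset.sum_congr rfl fun i _ => ?_
      rw [inner_smul_right, inner_featureMap]
    rw [h1, dotProduct]
    refine Finset.sum_congr rfl fun i _ => ?_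
    have := (hsqrt i).ne'
    field_simp
  · have hn : ‖g‖ ^ 2 = ∑ i, inner ℝ (e i) g ^ 2 := by
      rw [← real_inner_self_eq_norm_sq]
      conv_lhs => rw [hg g hgW]
      rw [he.inner_sum]
      exact Finset.sum_congr rfl fun i _ => by simp [sq]
    have hint : ∫ p, g p.1 ^ 2 ∂μ = ∑ i, σ i * inner ℝ (e i) g ^ 2 := by
      have h1 : ∀ i, ∫ p, e i p.1 * g p.1 ∂μ = σ i * inner ℝ (e i) g := by
        intro i
        rw [← inner_covariance hκ hK]
        conv_lhs => rw [hg g hgW, inner_sum]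
        simp only [inner_smul_right]
        simp only [inner_covariance hκ hK, hdiag]
        simp [mul_comm]
      have h2 : ∫ p, g p.1 ^ 2 ∂μ = inner ℝ g (covariance H μ g) := by
        rw [real_inner_comm, inner_covariance hκ hK]
        simp only [sq]
      rw [h2]
      conv_lhs => enter [2]; rw [hg g hgW]
      rw [sum_inner]
      refine Finset.sum_congr rfl fun i _ => ?_
      rw [inner_smul_left, ← (isPositive_covariance hκ hK).1.apply_clm, inner_covariance hκ hK, h1]
      simp
      ring
    rw [hint, hn, Finset.mul_sum, ← Finset.sum_add_distrib, dotProduct]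
    refine Finset.sum_congr rfl fun i _ => ?_
    have := hsq i
    linear_combination (inner ℝ (e i) g) ^ 2 * this
  · have hn : ‖g‖ ^ 2 = ∑ i, inner ℝ (e i) g ^ 2 := by
      rw [← real_inner_self_eq_norm_sq]
      conv_lhs => rw [hg g hgW]
      rw [he.inner_sum]
      exact Finset.sum_congr rfl fun i _ => by simp [sq]
    rw [hn, Finset.mul_sum]
    refine Finset.sum_congr rfl fun i _ => ?_
    have := (hpos i).ne'
    rw [mul_pow, hsq]
    field_simp

/-- The constants are tied together: `2688 = 12 * 224 = 4 * 672` meets the boundedness condition of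
the lower tail bound when `p ≤ 2 * L`, and `150528 = 672 * 224`. The factor `s` in that bound is
absorbed by `exp L`. -/
theorem measure_empirical_norm_lt_le (hκ : 0 < κ) (hK : KernelAssumptions H κ)
    (W : Submodule ℝ H) [FiniteDimensional ℝ W] {s : ℕ} (hs : Module.finrank ℝ W = s)
    {L : ℝ} (hL : 2 ≤ L) (hsL : (s : ℝ) ≤ Real.exp L) {m : ℕ} (hm : 0 < m) {l : ℝ}
    (hl : l = 12 * κ ^ 2 * L / m) :
    (Measure.pi fun _ : Fin m => μ) {D : Fin m → X × ℝ | ∃ g ∈ W,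
        150528 * ((∑ j, g (D j).1 ^ 2) / m + l * ‖g‖ ^ 2)
          < ∫ p, g p.1 ^ 2 ∂μ + 224 * l * ‖g‖ ^ 2}
      ≤ ENNReal.ofReal (3 * Real.exp (-(2 * L))) := by
  have hm' : (0 : ℝ) < m := by exact_mod_cast hm
  have hl0 : 0 < l := by rw [hl]; positivity
  -- For a large penalty the population norm is controlled by the penalty alone and the event is
  -- empty; otherwise `m` is large compared with `L`.
  rcases le_or_gt (κ ^ 2) (224 * l) with hbig | hsmall
  · refine le_of_eq_of_le (le_antisymm ?_ zero_le) zero_le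
    rw [← measure_empty (μ := Measure.pi fun _ : Fin m => μ)]
    refine measure_mono ?_
    rintro D ⟨g, -, hg⟩
    have h1 : ∫ p, g p.1 ^ 2 ∂μ ≤ κ ^ 2 * ‖g‖ ^ 2 := by
      have h2 : ∫ p, g p.1 ^ 2 ∂μ ≤ ∫ _, (κ * ‖g‖) ^ 2 ∂μ := by
        refine integral_mono_of_nonneg (Filter.Eventually.of_forall fun p => sq_nonneg _)
          (integrable_const _) (Filter.Eventually.of_forall fun p => ?_)
        exact sq_le_sq' (by linarith [neg_abs_le (g p.1), abs_apply_le hκ.le hK g p.1])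
          ((le_abs_self _).trans (abs_apply_le hκ.le hK g p.1))
      simpa [mul_pow] using h2
    have h3 : κ ^ 2 * ‖g‖ ^ 2 ≤ 224 * l * ‖g‖ ^ 2 := by gcongr
    have h4 : 0 ≤ (∑ j, g (D j).1 ^ 2) / m := by positivity
    have h5 : 0 ≤ l * ‖g‖ ^ 2 := by positivity
    exfalso
    linarith
  · have hLm : 2688 * L < m := by
      rw [hl, ← mul_div_assoc, div_lt_iff₀ hm'] at hsmall
      have : κ ^ 2 * (2688 * L) < κ ^ 2 * m := by linarith
      exact lt_of_mul_lt_mul_left this (by positivity)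
    set p := ⌈L⌉₊ with hp
    have hpL : L ≤ p := Nat.le_ceil L
    have hp2 : (p : ℝ) ≤ 2 * L := by
      have := Nat.ceil_lt_add_one (by linarith : 0 ≤ L)
      linarith
    have hp1 : 1 ≤ p := Nat.one_le_ceil_iff.2 (by linarith)
    have hρ : 0 < 224 * l := by positivity
    obtain ⟨x, d, -, hd, hx, hW⟩ := exists_whitenedVector (μ := μ) hκ.le hK W hs hρ
    have h4p : 4 * p ≤ m := by
      have : ((4 * p : ℕ) : ℝ) ≤ m := by push_cast; linarith
      exact_mod_cast this
    have hb : 2 * p * (κ ^ 2 / (224 * l)) ≤ (m : ℝ) / 672 := by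
      have h1 : κ ^ 2 / (224 * l) = m / (2688 * L) := by
        rw [hl]; field_simp; norm_num
      rw [h1, mul_div_assoc', div_le_div_iff₀ (by positivity) (by norm_num)]
      nlinarith
    have h1 := hx.measure_lower_tail_le hd hp1 h4p hb
    refine (measure_mono ?_).trans (h1.trans (ENNReal.ofReal_le_ofReal ?_))
    · rintro D ⟨g, hg, hlt⟩
      obtain ⟨u, hu1, hu2, hu3⟩ := hW g hg
      refine ⟨u, ?_⟩
      simp only [hu1]
      have h2 : ∑ i, m * d i * u i ^ 2 = m * (224 * l * ‖g‖ ^ 2) := by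
        rw [← hu3, Finset.mul_sum]
        exact Finset.sum_congr rfl fun i _ => by ring
      rw [h2, hu2]
      have h3 := mul_lt_mul_of_pos_left hlt (by positivity : (0 : ℝ) < m / 672)
      have h4 : (m : ℝ) / 672 * (150528 * ((∑ j, g (D j).1 ^ 2) / m + l * ‖g‖ ^ 2))
          = 224 * (∑ j, g (D j).1 ^ 2) + m * (224 * l * ‖g‖ ^ 2) := by
        field_simp
        ring
      have h5 : 0 ≤ ∑ j, g (D j).1 ^ 2 := by positivity
      linarith
    · rw [Fintype.card_fin]
      have h2 : Real.exp (-(3 * p)) ≤ Real.exp (-(3 * L)) := Real.exp_le_exp.2 (by linarith)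
      calc 3 * (s : ℝ) * Real.exp (-(3 * p)) ≤ 3 * Real.exp L * Real.exp (-(3 * L)) := by gcongr
        _ = 3 * Real.exp (-(2 * L)) := by rw [mul_assoc, ← Real.exp_add]; congr 2; ring

/-- In whitened coordinates the noise is a linear functional, so Cauchy-Schwarz bounds it for all
`g` at once by the Euclidean norm of `s` centred sums. -/
theorem measure_noise_gt_le (hκ : 0 ≤ κ) (hK : KernelAssumptions H κ)
    (W : Submodule ℝ H) [FiniteDimensional ℝ W] {s : ℕ} (hs : Module.finrank ℝ W = s)
    (hs1 : 1 ≤ s) {f : H} (hf : IsRegressionFunction μ f) {B : ℝ} (hB : 0 < B)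
    (hfB : ∀ᵐ p ∂μ, |p.2 - f p.1| ≤ B) {m : ℕ} (hm : 0 < m) {ρ : ℝ} (hρ : 0 < ρ)
    (hκρ : κ ^ 2 ≤ m * ρ) {t : ℝ} (ht : 0 ≤ t) :
    (Measure.pi fun _ : Fin m => μ) {D : Fin m → X × ℝ | ∃ g ∈ W,
        t * B * √(m * s) * √(∫ p, g p.1 ^ 2 ∂μ + ρ * ‖g‖ ^ 2)
          < |∑ j, ((D j).2 - f (D j).1) * g (D j).1|}
      ≤ ENNReal.ofReal (2 * Real.exp 1 * Real.exp (-t)) := by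
  have hm' : (0 : ℝ) < m := by exact_mod_cast hm
  have hs' : (0 : ℝ) < s := by exact_mod_cast hs1
  obtain ⟨x, d, hxm, hd, hx, hW⟩ := exists_whitenedVector (μ := μ) hκ hK W hs hρ
  have : Nonempty (Fin s) := ⟨⟨0, hs1⟩⟩
  -- Normalization that makes each summand at most `1` and its variance at most `1 / m`: `κ² ≤ m ρ`
  -- bounds the coordinates by `√m`, and their second moments are at most `1`.
  set θ : ℝ := (B * √m)⁻¹ with hθ
  have hsm : 0 < √(m : ℝ) := Real.sqrt_pos.2 hm'
  have hθ0 : 0 < θ := by positivity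
  have hθm : θ ^ 2 * (B ^ 2 * m) = 1 := by
    rw [hθ, inv_pow, mul_pow, Real.sq_sqrt hm'.le]
    field_simp
  have hxi : ∀ i, Measurable fun q => x q i := fun i => (measurable_pi_apply i).comp hxm
  have hxb : ∀ q i, |x q i| ≤ √m := by
    intro q i
    refine Real.abs_le_sqrt ((hx.sq_le (q, 0) i).trans ?_)
    rw [div_le_iff₀ hρ]
    exact hκρ
  set Z : Fin s → X × ℝ → ℝ := fun i p => (p.2 - f p.1) * (θ * x p.1 i) with hZ
  have hZm : ∀ i, AEStronglyMeasurable (Z i) μ := fun i =>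
    ((measurable_snd.sub ((measurable_coe hK f).comp measurable_fst)).mul
      (((hxi i).comp measurable_fst).const_mul θ)).aestronglyMeasurable
  have hZle : ∀ i, ∀ᵐ p ∂μ, |Z i p| ≤ 1 := by
    intro i
    filter_upwards [hfB] with p hp
    rw [hZ, abs_mul, abs_mul, abs_of_pos hθ0]
    calc |p.2 - f p.1| * (θ * |x p.1 i|) ≤ B * (θ * √m) := by gcongr; exact hxb _ _
      _ = 1 := by rw [hθ]; field_simp
  have hZ0 : ∀ i, ∫ p, Z i p ∂μ = 0 := fun i =>
    hf.integral_residual_smul (h := fun q => θ * x q i) ((hxi i).const_mul θ).stronglyMeasurable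
      (c := θ * √m) fun q => by
        rw [Real.norm_eq_abs, abs_mul, abs_of_pos hθ0]
        gcongr
        exact hxb _ _
  have hZ2 : ∀ i, ∫ p, Z i p ^ 2 ∂μ ≤ 1 / m := by
    intro i
    have h1 : ∫ p, Z i p ^ 2 ∂μ ≤ ∫ p, 1 / m * (x p.1 i * x p.1 i) ∂μ := by
      refine integral_mono_of_nonneg (Filter.Eventually.of_forall fun p => sq_nonneg _)
        ((hx.integrable_mul i i).const_mul _) ?_
      filter_upwards [hfB] with p hp
      have h2 : (p.2 - f p.1) ^ 2 ≤ B ^ 2 := sq_le_sq' (by linarith [neg_abs_le (p.2 - f p.1)])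
        ((le_abs_self _).trans hp)
      have h3 : θ ^ 2 * B ^ 2 = 1 / m := by
        rw [eq_div_iff hm'.ne']; linarith
      rw [← h3]
      have h4 : 0 ≤ θ ^ 2 * x p.1 i ^ 2 := by positivity
      have h5 := mul_le_mul_of_nonneg_right h2 h4
      simp only [hZ]
      linarith
    rw [integral_const_mul, hx.integral_mul, if_pos rfl] at h1
    refine h1.trans (mul_le_of_le_one_right (by positivity) ?_)
    linarith [hd i]
  refine (measure_mono ?_).trans (measure_le_sqrt_average_sum_sq_le hZm hZle hZ0 hm hZ2 ht)
  rintro D ⟨g, hg, hlt⟩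
  obtain ⟨u, hu1, hu2, -⟩ := hW g hg
  rw [← hu2] at hlt
  change t ≤ √((∑ i, (∑ j, Z i (D j)) ^ 2) / Fintype.card (Fin s))
  rw [Fintype.card_fin]
  by_contra hcon
  rw [not_le] at hcon
  set S : Fin s → ℝ := fun i => ∑ j, Z i (D j) with hS
  have h1 : θ * ∑ j, ((D j).2 - f (D j).1) * g (D j).1 = ∑ i, S i * u i := by
    simp only [← hu1, dotProduct, Finset.mul_sum, hS, Finset.sum_mul, hZ]
    rw [Finset.sum_comm]
    exact Finset.sum_congr rfl fun i _ => Finset.sum_congr rfl fun j _ => by ring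
  have h2 : |∑ i, S i * u i| ≤ √(∑ i, S i ^ 2) * √(u ⬝ᵥ u) := by
    rw [← Real.sqrt_mul (Finset.sum_nonneg fun i _ => sq_nonneg _)]
    refine Real.abs_le_sqrt ?_
    refine (Finset.sum_mul_sq_le_sq_mul_sq _ _ _).trans_eq ?_
    rw [dotProduct]
    simp only [sq]
  have h3 : √(∑ i, S i ^ 2) ≤ t * √s := by
    have h4 : √(∑ i, S i ^ 2) = √((∑ i, S i ^ 2) / s) * √s := by
      rw [← Real.sqrt_mul (by positivity), div_mul_cancel₀ _ hs'.ne']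
    rw [h4]
    gcongr
  have h5 : θ * (t * B * √(m * s) * √(u ⬝ᵥ u)) = t * √s * √(u ⬝ᵥ u) := by
    rw [hθ, Real.sqrt_mul hm'.le]
    field_simp
  have h6 := mul_lt_mul_of_pos_left hlt hθ0
  have h8 : θ * |∑ j, ((D j).2 - f (D j).1) * g (D j).1| = |∑ i, S i * u i| := by
    rw [← h1, abs_mul, abs_of_pos hθ0]
  rw [h5, h8] at h6
  have h7 := h2.trans (mul_le_mul_of_nonneg_right h3 (Real.sqrt_nonneg _))
  linarith

end TargetConcentration

/-! ### Risk of the target estimator -/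

section TargetRisk

variable {X H : Type*} [MeasurableSpace X] [NormedAddCommGroup H] [InnerProductSpace ℝ H]
  [CompleteSpace H] [TopologicalSpace.SeparableSpace H] [RKHS ℝ H X ℝ] {κ : ℝ}
  {μ : Measure (X × ℝ)} [IsProbabilityMeasure μ]

omit [TopologicalSpace.SeparableSpace H] in
/-- Excess risk of the ridge estimator over a subspace on which the empirical norm dominates the
population norm. -/
theorem excessRisk_ridge_le (hκ : 0 ≤ κ) (hK : KernelAssumptions H κ) {W : Submodule ℝ H}
    [CompleteSpace W] {f : H} (hf : IsRegressionFunction μ f) {B : ℝ}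
    (hB : ∀ᵐ p ∂μ, |p.2| ≤ B) {m : ℕ} (hm : 0 < m) {l : ℝ} (hl : 0 < l) {D : Fin m → X × ℝ}
    (hiso : ∀ g ∈ W, ∫ p, g p.1 ^ 2 ∂μ + 224 * l * ‖g‖ ^ 2
      ≤ 150528 * ((∑ j, g (D j).1 ^ 2) / m + l * ‖g‖ ^ 2)) {T : ℝ} (hT : 0 ≤ T)
    (hnoise : ∀ g ∈ W, |∑ j, ((D j).2 - f (D j).1) * g (D j).1|
      ≤ T * √(∫ p, g p.1 ^ 2 ∂μ + 224 * l * ‖g‖ ^ 2)) {δ F : ℝ}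
    (hδ : ‖f - W.starProjection f‖ ≤ δ) (hF : ‖f‖ ≤ F) :
    excessRisk μ (ridge W l D) f ≤ 800 * (400 * T / m + √l * F) + 802 * (κ * δ) := by
  have hm' : (0 : ℝ) < m := by exact_mod_cast hm
  have hR := isRidge_ridge hm W hl D
  set w := W.starProjection f with hw
  have hwW : w ∈ W := W.starProjection_apply_mem f
  set d := ridge W l D - w with hd
  have hdW : d ∈ W := W.sub_mem hR.1 hwW
  set q := f - w with hq
  have hδ0 : 0 ≤ δ := (norm_nonneg _).trans hδ
  have hF0 : 0 ≤ F := (norm_nonneg _).trans hF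
  have hqb : ∀ x, |q x| ≤ κ * δ := fun x =>
    (abs_apply_le hκ hK q x).trans (mul_le_mul_of_nonneg_left hδ hκ)
  have hwF : ‖w‖ ≤ F := (W.norm_starProjection_apply_le f).trans hF
  set E := √((∑ j, d (D j).1 ^ 2) / m + l * ‖d‖ ^ 2) with hE
  have hE0 : 0 ≤ E := Real.sqrt_nonneg _
  have hE2 : E ^ 2 = (∑ j, d (D j).1 ^ 2) / m + l * ‖d‖ ^ 2 := Real.sq_sqrt (by positivity)
  -- The factor `400` is an upper bound for `√150528`.
  have hnorm : √(∫ p, d p.1 ^ 2 ∂μ + 224 * l * ‖d‖ ^ 2) ≤ 400 * E := by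
    refine Real.sqrt_le_iff.2 ⟨by positivity, (hiso d hdW).trans ?_⟩
    rw [← hE2]
    nlinarith [sq_nonneg E]
  have hemp : ∑ j, |q (D j).1 * d (D j).1| ≤ m * (κ * δ * E) := by
    have h1 : (∑ j, |d (D j).1|) ^ 2 ≤ (m * E) ^ 2 := by
      have h2 := sq_sum_le_card_mul_sum_sq (s := Finset.univ) (f := fun j => |d (D j).1|)
      simp only [sq_abs, Finset.card_univ, Fintype.card_fin] at h2
      refine h2.trans ?_
      rw [mul_pow, hE2]
      have h3 : (m : ℝ) ^ 2 * ((∑ j, d (D j).1 ^ 2) / m + l * ‖d‖ ^ 2)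
          = m * ∑ j, d (D j).1 ^ 2 + m ^ 2 * (l * ‖d‖ ^ 2) := by field_simp
      rw [h3]
      have : 0 ≤ (m : ℝ) ^ 2 * (l * ‖d‖ ^ 2) := by positivity
      linarith
    have h4 : ∑ j, |d (D j).1| ≤ m * E :=
      (le_abs_self _).trans (abs_le_of_sq_le_sq h1 (by positivity))
    calc ∑ j, |q (D j).1 * d (D j).1| ≤ ∑ j, κ * δ * |d (D j).1| := by
          refine Finset.sum_le_sum fun j _ => ?_
          rw [abs_mul]
          exact mul_le_mul_of_nonneg_right (hqb _) (abs_nonneg _)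
      _ = κ * δ * ∑ j, |d (D j).1| := by rw [Finset.mul_sum]
      _ ≤ κ * δ * (m * E) := by gcongr
      _ = _ := by ring
  have hpen : |l * inner ℝ w d| ≤ √l * F * E := by
    have h1 : √l * ‖d‖ ≤ E := by
      refine Real.le_sqrt_of_sq_le ?_
      rw [mul_pow, Real.sq_sqrt hl.le]
      have : 0 ≤ (∑ j, d (D j).1 ^ 2) / m := by positivity
      linarith
    calc |l * inner ℝ w d| ≤ l * (F * ‖d‖) := by
          rw [abs_mul, abs_of_pos hl]
          refine mul_le_mul_of_nonneg_left ((abs_real_inner_le_norm _ _).trans ?_) hl.le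
          gcongr
      _ = √l * F * (√l * ‖d‖) := by
          nth_rewrite 1 [← Real.mul_self_sqrt hl.le]
          ring
      _ ≤ _ := by gcongr
  -- The normal equation tested on `d` splits `E * E` into noise, approximation error and penalty,
  -- each linear in `E`.
  have hEE : E * E ≤ E * (400 * T / m + κ * δ + √l * F) := by
    have h1 := hR.normal_equation hl.le hdW
    have h2 : ∑ j, ((D j).2 - ridge W l D (D j).1) * d (D j).1
        = ∑ j, ((D j).2 - f (D j).1) * d (D j).1 + ∑ j, q (D j).1 * d (D j).1
          - ∑ j, d (D j).1 ^ 2 := by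
      rw [← Finset.sum_add_distrib, ← Finset.sum_sub_distrib]
      refine Finset.sum_congr rfl fun j _ => ?_
      simp only [hd, hq, RKHS.coe_sub, Pi.sub_apply]
      ring
    have h3 : inner ℝ (ridge W l D) d = ‖d‖ ^ 2 + inner ℝ w d := by
      have h5 : ridge W l D = d + w := by rw [hd, sub_add_cancel]
      rw [h5, inner_add_left, real_inner_self_eq_norm_sq]
    rw [h2, h3] at h1
    have h4 : E * E = ((∑ j, ((D j).2 - f (D j).1) * d (D j).1)
        + ∑ j, q (D j).1 * d (D j).1) / m - l * inner ℝ w d := by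
      rw [← sq, hE2]
      field_simp
      linarith
    have h5 : ∑ j, ((D j).2 - f (D j).1) * d (D j).1 ≤ T * (400 * E) :=
      (le_abs_self _).trans ((hnoise d hdW).trans (mul_le_mul_of_nonneg_left hnorm hT))
    have h6 : ∑ j, q (D j).1 * d (D j).1 ≤ m * (κ * δ * E) :=
      (Finset.sum_le_sum fun j _ => le_abs_self _).trans hemp
    have h7 := neg_le_of_abs_le hpen
    have h8 : ((∑ j, ((D j).2 - f (D j).1) * d (D j).1)
        + ∑ j, q (D j).1 * d (D j).1) / m ≤ (T * (400 * E) + m * (κ * δ * E)) / m := by gcongr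
    have h9 : (T * (400 * E) + m * (κ * δ * E)) / m = E * (400 * T / m + κ * δ) := by
      field_simp
    rw [h4]
    linarith
  have hEle : E ≤ 400 * T / m + κ * δ + √l * F := by
    rcases hE0.eq_or_lt with h | h
    · rw [← h]; positivity
    · exact le_of_mul_le_mul_left hEE h
  -- The error is `d - q`. Inserting the bound on `E` into `800 * E + 2 * (κ * δ)` produces the
  -- final `802`.
  have hrisk : excessRisk μ (ridge W l D) f ≤ 2 * (400 * E + κ * δ) := by
    rw [excessRisk_eq hκ hK hf hB]
    refine Real.sqrt_le_iff.2 ⟨by positivity, ?_⟩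
    have hm2 : ∀ g : H, Integrable (fun p : X × ℝ => g p.1 ^ 2) μ := by
      intro g
      refine Integrable.of_bound
        (((measurable_coe hK g).comp measurable_fst).pow_const 2).aestronglyMeasurable
        ((κ * ‖g‖) ^ 2) (Filter.Eventually.of_forall fun p => ?_)
      rw [norm_pow, Real.norm_eq_abs]
      have := abs_apply_le hκ hK g p.1
      gcongr
    have h1 : ∫ p, (ridge W l D - f) p.1 ^ 2 ∂μ ≤ ∫ p, (2 * d p.1 ^ 2 + 2 * (κ * δ) ^ 2) ∂μ := by
      refine integral_mono (hm2 _) (((hm2 d).const_mul 2).add (integrable_const _)) fun p => ?_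
      have h2 : (ridge W l D - f) p.1 = d p.1 - q p.1 := by
        simp only [hd, hq, RKHS.coe_sub, Pi.sub_apply]
        ring
      have h3 : q p.1 ^ 2 ≤ (κ * δ) ^ 2 := sq_le_sq' (neg_le_of_abs_le (hqb _))
        (le_of_abs_le (hqb _))
      simp only [h2]
      nlinarith [sq_nonneg (d p.1 + q p.1)]
    have h4 : ∫ p, (2 * d p.1 ^ 2 + 2 * (κ * δ) ^ 2) ∂μ
        = 2 * ∫ p, d p.1 ^ 2 ∂μ + 2 * (κ * δ) ^ 2 := by
      rw [integral_add ((hm2 d).const_mul 2) (integrable_const _), integral_const_mul]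
      simp
    have h5 : ∫ p, d p.1 ^ 2 ∂μ ≤ (400 * E) ^ 2 := by
      have h6 : ∫ p, d p.1 ^ 2 ∂μ ≤ ∫ p, d p.1 ^ 2 ∂μ + 224 * l * ‖d‖ ^ 2 := by
        have : 0 ≤ 224 * l * ‖d‖ ^ 2 := by positivity
        linarith
      exact h6.trans (Real.sqrt_le_left (by positivity) |>.1 hnorm)
    have h7 : 0 ≤ κ * δ := by positivity
    rw [h4] at h1
    nlinarith [mul_nonneg hE0 h7, sq_nonneg E, sq_nonneg (κ * δ)]
  linarith

/-- Both bad events are taken at level `2 * τ`, with total probability at most `(3 + 2 e) exp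
(-2τ)`; `τ ≥ 13 / 5` reduces this to `3 exp (-τ)`. -/
theorem measure_excessRisk_ridge_gt_le (hκ : 0 < κ) (hK : KernelAssumptions H κ)
    (W : Submodule ℝ H) [FiniteDimensional ℝ W] {s : ℕ} (hs : Module.finrank ℝ W = s)
    (hs1 : 1 ≤ s) {f : H} (hf : IsRegressionFunction μ f) {B F δ τ : ℝ}
    (hB : ∀ᵐ p ∂μ, |p.2| ≤ B) (hF : ‖f‖ ≤ F) (hδ : ‖f - W.starProjection f‖ ≤ δ)
    (hτ : 13 / 5 ≤ τ) {m : ℕ} (hm : 0 < m) :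
    (Measure.pi fun _ : Fin m => μ) {D : Fin m → X × ℝ |
        800 * (800 * (B + κ * F + 1) + 4 * κ * F) * (τ * √((s : ℝ) / m)) + 802 * (κ * δ)
          < excessRisk μ (ridge W (12 * κ ^ 2 * max (Real.log s) τ / m) D) f}
      ≤ ENNReal.ofReal (3 * Real.exp (-τ)) := by
  have hm' : (0 : ℝ) < m := by exact_mod_cast hm
  have hs' : (1 : ℝ) ≤ s := by exact_mod_cast hs1
  have hF0 : 0 ≤ F := (norm_nonneg _).trans hF
  have hB0 : 0 ≤ B := by
    obtain ⟨p, hp⟩ := hB.exists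
    exact (abs_nonneg _).trans hp
  set L := max (Real.log s) τ with hL
  have hτL : τ ≤ L := le_max_right _ _
  have hsL : (s : ℝ) ≤ Real.exp L := by
    rw [← Real.log_le_iff_le_exp (by linarith)]
    exact le_max_left _ _
  have hLs : L ≤ τ * s := by
    refine max_le ?_ ?_
    · have := Real.log_le_sub_one_of_pos (by linarith : (0 : ℝ) < s)
      nlinarith
    · nlinarith
  set l := 12 * κ ^ 2 * L / m with hl
  have hl0 : 0 < l := by
    have : 0 < L := by linarith
    positivity
  have hB1 : 0 < B + κ * F + 1 := by positivity
  have hres : ∀ᵐ p ∂μ, |p.2 - f p.1| ≤ B + κ * F + 1 := by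
    filter_upwards [hB] with p hp
    have h1 := abs_sub p.2 (f p.1)
    have h2 := abs_apply_le hκ.le hK f p.1
    have h3 : κ * ‖f‖ ≤ κ * F := by gcongr
    linarith
  have hκl : κ ^ 2 ≤ m * (224 * l) := by
    have h1 : (m : ℝ) * (224 * l) = 2688 * L * κ ^ 2 := by rw [hl]; field_simp; ring
    rw [h1]
    nlinarith [sq_nonneg κ]
  have h1 := measure_empirical_norm_lt_le (μ := μ) hκ hK W hs (L := L) (by linarith) hsL hm hl
  have h2 := measure_noise_gt_le hκ.le hK W hs hs1 hf hB1 hres hm (ρ := 224 * l) (by positivity)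
    hκl (t := 2 * τ) (by linarith)
  set T := 2 * τ * (B + κ * F + 1) * √(m * s) with hT
  have hT0 : 0 ≤ T := by
    have : 0 ≤ τ := by linarith
    positivity
  have hbound : 800 * (400 * T / m + √l * F) + 802 * (κ * δ)
      ≤ 800 * (800 * (B + κ * F + 1) + 4 * κ * F) * (τ * √((s : ℝ) / m)) + 802 * (κ * δ) := by
    have h3 : √((m : ℝ) * s) / m = √((s : ℝ) / m) := by
      rw [div_eq_iff hm'.ne']
      nth_rewrite 3 [← Real.sqrt_sq hm'.le]
      rw [← Real.sqrt_mul (by positivity)]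
      congr 1
      field_simp
    have h4 : 400 * T / m = 800 * (B + κ * F + 1) * (τ * √((s : ℝ) / m)) := by
      rw [← h3, hT]; ring
    -- From `12 ≤ 4 ^ 2` and `L ≤ τ * s ≤ τ ^ 2 * s`.
    have h5 : √l ≤ 4 * κ * (τ * √((s : ℝ) / m)) := by
      refine Real.sqrt_le_iff.2 ⟨by positivity, ?_⟩
      rw [mul_pow, mul_pow, mul_pow, Real.sq_sqrt (by positivity), hl, ← mul_div_assoc,
        ← mul_div_assoc]
      refine div_le_div_of_nonneg_right ?_ hm'.le
      have h6 : L ≤ τ ^ 2 * s := by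
        have h8 : τ ≤ τ ^ 2 := by nlinarith
        exact hLs.trans (mul_le_mul_of_nonneg_right h8 (by linarith))
      nlinarith [mul_le_mul_of_nonneg_left h6 (sq_nonneg κ), mul_nonneg (sq_nonneg κ)
        (by linarith : 0 ≤ L)]
    have h7 := mul_le_mul_of_nonneg_right h5 hF0
    rw [h4]
    linarith
  refine (measure_mono (t := _ ∪ _) ?_).trans ((measure_union_le _ _).trans
    ((add_le_add h1 h2).trans ?_))
  · intro D hD
    by_contra hcon
    rw [Set.mem_union, not_or] at hcon
    obtain ⟨hc1, hc2⟩ := hcon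
    refine absurd hD (not_lt.2 (le_trans ?_ hbound))
    refine excessRisk_ridge_le hκ.le hK hf hB hm hl0 (fun g hg => ?_) hT0 (fun g hg => ?_) hδ hF
    · by_contra h
      exact hc1 ⟨g, hg, not_le.1 h⟩
    · by_contra h
      exact hc2 ⟨g, hg, not_le.1 h⟩
  · rw [← ENNReal.ofReal_add (by positivity) (by positivity)]
    refine ENNReal.ofReal_le_ofReal ?_
    have h3 : Real.exp (-(2 * L)) ≤ Real.exp (-(2 * τ)) := Real.exp_le_exp.2 (by linarith)
    have h4 : Real.exp (-τ) = Real.exp (-(2 * τ)) * Real.exp τ := by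
      rw [← Real.exp_add]; congr 1; ring
    have h5 : (18 / 5 : ℝ) ≤ Real.exp τ := by linarith [Real.add_one_le_exp τ]
    have h6 := Real.exp_one_lt_d9
    have h7 := Real.exp_pos (-(2 * τ))
    rw [h4]
    nlinarith

omit [TopologicalSpace.SeparableSpace H] in
/-- In a reproducing kernel Hilbert space with zero kernel every function vanishes. -/
theorem eq_zero_of_kernel_zero (hK : KernelAssumptions H 0) (f : H) : f = 0 := by
  refine DFunLike.coe_injective (funext fun x => ?_)
  have h1 := abs_apply_le le_rfl hK f x
  have h2 := abs_apply_le le_rfl hK (0 : H) x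
  rw [zero_mul] at h1 h2
  rw [abs_nonpos_iff.1 h1, abs_nonpos_iff.1 h2]

end TargetRisk

end MetaKRR
end

/-! ### Assembly of the two statements -/

theorem mainTheorem10 :
    -- bias bound
    (∃ J : ℝ → ℝ → ℝ, ∀ (X : Type*) (H : Type*) [MeasurableSpace X] [NormedAddCommGroup H]
      [InnerProductSpace ℝ H] [CompleteSpace H] [TopologicalSpace.SeparableSpace H]
      [RKHS ℝ H X ℝ] (κ R r l : ℝ) (N n : ℕ)
      (μ : Fin N → Measure (X × ℝ)) [∀ i, IsProbabilityMeasure (μ i)] (f : Fin N → H),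
      0 ≤ κ → MetaKRR.KernelAssumptions H κ →
      0 ≤ r → r ≤ 1 → 0 < l → l ≤ 1 → 1 ≤ n →
      (∀ i, MetaKRR.IsRegressionFunction (μ i) (f i)) →
      (∀ i, MetaKRR.SourceCondition (μ i) r R (f i)) →
      (∀ i, Integrable (fun D => MetaKRR.ridge (⊤ : Submodule ℝ H) l D)
        (Measure.pi fun _ : Fin n => μ i)) ∧
      MetaKRR.hsNorm (MetaKRR.taskCov (fun i => MetaKRR.meanRidge H n l (μ i))
          - MetaKRR.taskCov f)
        ≤ ENNReal.ofReal (J κ R * l ^ r * (1 + 1 / (l * √(n : ℝ))))) ∧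
    -- excess risk in the regime of at least exponentially many source tasks
    (∃ C : ℝ → ℝ → ℝ → ℝ → ℝ → ℝ → ℝ, ∀ (X : Type*) (H : Type*) [MeasurableSpace X]
      [NormedAddCommGroup H] [InnerProductSpace ℝ H] [CompleteSpace H]
      [TopologicalSpace.SeparableSpace H] [RKHS ℝ H X ℝ]
      (κ R B γ F a r τ : ℝ) (s N n nT : ℕ)
      (μ : Fin N → Measure (X × ℝ)) [∀ i, IsProbabilityMeasure (μ i)]
      (μT : Measure (X × ℝ)) [IsProbabilityMeasure μT]
      (f : Fin N → H) (fT : H) (Hs : Submodule ℝ H),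
      0 ≤ κ → MetaKRR.KernelAssumptions H κ →
      0 ≤ r → r ≤ 1 → 0 < a → 0 < γ → 13 / 5 ≤ τ → 1 ≤ s → 1 ≤ n →
      a * Real.exp n ≤ N → 12 * κ ^ 2 * max (Real.log s) τ ≤ nT →
      (∀ i, MetaKRR.IsRegressionFunction (μ i) (f i)) →
      MetaKRR.IsRegressionFunction μT fT →
      Module.finrank ℝ Hs = s → Submodule.span ℝ (Set.range f) = Hs → fT ∈ Hs →
      (∀ i, MetaKRR.SourceCondition (μ i) r R (f i)) →
      (∀ i, ∀ᵐ p ∂μ i, |p.2| ≤ B) → (∀ᵐ p ∂μT, |p.2| ≤ B) →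
      (∀ t : ℝ, t ≠ 0 →
        Module.End.HasEigenvalue (MetaKRR.taskCov f : H →ₗ[ℝ] H) t → γ ≤ t) →
      ‖fT‖ ≤ F →
      MetaKRR.sourceLaw n μ
        {D | ∃ v : Fin s → H,
          MetaKRR.IsTopRightSingular (MetaKRR.empTaskCov H ((n : ℝ) ^ (-(1 / 2) : ℝ)) D) v ∧
          ENNReal.ofReal (3 * Real.exp (-τ)) <
            (Measure.pi fun _ : Fin nT => μT)
              {DT | C κ R B γ F a * τ * (√((s : ℝ) / nT) + (n : ℝ) ^ (-(r / 2))) <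
                MetaKRR.excessRisk μT
                  (MetaKRR.ridge (Submodule.span ℝ (Set.range v))
                    (12 * κ ^ 2 * max (Real.log s) τ / nT) DT) fT}}
        ≤ ENNReal.ofReal (2 * Real.exp (-τ))) := by
  refine ⟨⟨fun κ R => 2 * R ^ 2 * max 1 (κ ^ 2) ^ 2, ?_⟩,
    ⟨fun κ R B γ F a => 800 * (800 * (B + κ * F + 1) + 4 * κ * F)
      + 802 * (κ * (2 * MetaKRR.sourceConst κ R B a * F / γ)), ?_⟩⟩
  · intro X H _ _ _ _ _ _ κ R r l N n μ _ f hκ hK hr0 hr1 hl _ hn hf hs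
    exact ⟨fun i => MetaKRR.integrable_ridge hκ hK hn hl (hf i).1,
      MetaKRR.hsNorm_taskCov_meanRidge_sub_le hκ hK hn hl hr0 hr1 μ f hf hs⟩
  · intro X H _ _ _ _ _ _ κ R B γ F a r τ s N n nT μ _ μT _ f fT Hs hκ hK hr0 hr1 ha hγ hτ hs1
      hn hN hnT hf hfT hHs hspan hfTs hsrc hB hBT hgap hF
    subst hspan
    -- A zero kernel makes the space trivial, which contradicts `s ≥ 1`.
    have hκ0 : 0 < κ := by
      refine lt_of_le_of_ne hκ fun h => ?_
      subst h
      have : Subsingleton (Submodule.span ℝ (Set.range f)) :=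
        ⟨fun g h => Subtype.ext ((MetaKRR.eq_zero_of_kernel_zero hK g.1).trans
          (MetaKRR.eq_zero_of_kernel_zero hK h.1).symm)⟩
      rw [Module.finrank_zero_of_subsingleton] at hHs
      omega
    have hN0 : 0 < N := by
      have h1 : 0 < a * Real.exp n := by positivity
      exact_mod_cast h1.trans_le hN
    have hnT0 : 0 < nT := by
      have h1 : 0 < max (Real.log s) τ := lt_of_lt_of_le (by linarith) (le_max_right _ _)
      have h2 : 0 < 12 * κ ^ 2 * max (Real.log s) τ := by positivity
      exact_mod_cast h2.trans_le hnT
    have hF0 : 0 ≤ F := (norm_nonneg _).trans hF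
    have hB0 : 0 ≤ B := by
      obtain ⟨p, hp⟩ := hBT.exists
      exact (abs_nonneg _).trans hp
    -- The bad event of the operator deviation contains the failures for all `v` simultaneously,
    -- because the perturbation bound is deterministic.
    refine (measure_mono ?_).trans
      (MetaKRR.sourceLaw_norm_sub_gt_le hκ hK hn hr0 hr1 ha (by linarith) hN μ f hf hsrc hB)
    rintro D ⟨v, hv, hlt⟩ hD
    refine absurd hlt (not_lt.2 ?_)
    set W := Submodule.span ℝ (Set.range v) with hW
    have : FiniteDimensional ℝ W := FiniteDimensional.span_of_finite ℝ (Set.finite_range v)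
    have hWs : Module.finrank ℝ W = s := by
      rw [hW, finrank_span_eq_card hv.1.linearIndependent, Fintype.card_fin]
    set K := MetaKRR.sourceConst κ R B a with hKdef
    have hK0 : 0 ≤ K := MetaKRR.sourceConst_nonneg κ R B a
    set u : ℝ := (n : ℝ) ^ (-(r / 2)) with hu
    have hu0 : 0 ≤ u := by positivity
    have hτ0 : 0 ≤ τ := by linarith
    have hδ : ‖fT - W.starProjection fT‖ ≤ 2 * (K * τ * u) * F / γ :=
      (hv.norm_sub_starProjection_le hN0 f hγ hgap hfTs hHs (by positivity) hD hW).trans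
        (by gcongr)
    refine (measure_mono ?_).trans
      (MetaKRR.measure_excessRisk_ridge_gt_le hκ0 hK W hWs hs1 hfT hBT hF hδ hτ hnT0)
    intro DT hDT
    simp only [Set.mem_ofPred_eq] at hDT ⊢
    refine lt_of_le_of_lt ?_ hDT
    set w : ℝ := √((s : ℝ) / nT) with hw
    have hw0 : 0 ≤ w := Real.sqrt_nonneg _
    have h1 : 0 ≤ 800 * (800 * (B + κ * F + 1) + 4 * κ * F) * (τ * u) := by positivity
    have h2 : 0 ≤ 802 * (κ * (2 * K * F / γ)) * (τ * w) := by positivity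
    have h3 : 802 * (κ * (2 * (K * τ * u) * F / γ)) = 802 * (κ * (2 * K * F / γ)) * (τ * u) := by
      ring
    rw [h3]
    linarith
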